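/- **Model.** Fix a database size of $n$ bits and a block size of $B$ bits, and let $N=\lceil n/B\rceil$; the database is an array of $N$ blocks, i.e. of elements of $\{0,1\}^B$. An access request is a triple $(\mathrm{op},\mathrm{addr},\mathrm{val})$ with $\mathrm{op}\in\{\mathrm{read},\mathrm{write}\}$ and $\mathrm{val}\in\{0,1\}^B$; it is *logical* if $\mathrm{addr}\in[N]=\{0,\dots,N-1\}$ is a database address and *physical* if $\mathrm{addr}$ is an address of the server, which holds $S$ blocks and has *server space* $SB$ bits. A (possibly stateful, randomized) ORAM simulator, run by the user, starts from a randomized setup of the server contents and of its own memory for an initial database; it then receives logical requests one at a time and answers each of them, online, with a block, after making a sequence of physical requests to the server (which replies to each with the current block of the addressed cell). All local state of the user is held in a *permanent memory*, kept between logical accesses, and a *temporary memory*, which exists only during a logical access; encryption of the blocks is left out of the accounting. The simulator is *correct* if, with certainty, every logical request (read or write) with address $i$ is answered by the block most recently written to $i$ before it (the initial block if there is none). It is *information-theoretically secure* if the distribution of the sequence of physical addresses is the same for any two logical request sequences of the same length (and any two initial databases). The *worst-case bandwidth blowup* is the largest number of physical requests (blocks communicated) that a logical access can make. The *temporary* (*permanent*)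 *space usage* of the user is the size of the temporary (permanent) memory, in units of $B$ bits. A function $\nu$ is *negligible* if $\nu(n)=o(n^{-\kappa})$ for every constant $\kappa>0$. All limits are for $n\to\infty$, $\lg$ is the logarithm to base $2$, and $B$ is a function of $n$. **Theorem.** Let $B=B(n)$ be a positive integer with $B\ge 3\lg n$ for all $n\ge 1$ and $B=O(n^c)$ for some constant $0<c<1$. Let $f,g:\mathbb N\to\mathbb R$ be such that $f(n)=\omega(\log n)$ (that is, $f(n)/\log n\to+\infty$), $f(n)=O(\log^2 n)$, $g(n)=\omega(1)$ (that is, $g(n)\to+\infty$) and $g(n)=o\big(\sqrt{f(n)/\log n}\big)$. Then there is a family of correct and information-theoretically secure ORAM simulators, one for each $n$, such that 1. the server space is $$n\Big(1+\Theta\Big(\frac{\log n}{B}+\frac{g(n)}{\sqrt{f(n)/\log n}}\Big)\Big)\ \text{bits};$$ 2. the worst-case bandwidth blowup is $O(\log^2 n)$; 3. the temporary space usage of the user is, in the worst case, $O(f(n))$ blocks; 4. for every $R=\omega(\log n)$ and every constant $\kappa>0$, the probability that the permanent space usage of the user becomes larger than $R(n)$ blocks at some time during at most $n^{\kappa}$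 logical accesses is at most $\nu(n)$ for some negligible function $\nu$, uniformly over the initial database and the sequence of logical requests. Moreover, if in addition $B=\omega(\log n)$, then this family is succinct: its server space is $n+o(n)$ bits. -/

import Mathlib

open Filter Asymptotics

/-! # Oblivious RAM simulators and their performance measures -/

namespace ORAM

/-- A block is a chunk of `B` bits. -/
abbrev Block (B : ℕ) : Type := Fin B → Bool

/-- A memory consisting of `N` cells, each of which holds one block. -/
abbrev Store (N B : ℕ) : Type := Fin N → Block B

/-- The number of blocks of a database of `n` bits, `⌈n / B⌉`. -/
def numBlocks (n B : ℕ) : ℕ := n ⌈/⌉ B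

/-- The two kinds of access requests. -/
inductive Op : Type
  | read
  | write

/-- An access request `(op, addr, val)` to a memory of `N` blocks. -/
structure Request (N B : ℕ) : Type where
  op : Op
  addr : Fin N
  val : Block B

/-- The effect of an access request on the memory it addresses. -/
def Request.apply {N B : ℕ} (r : Request N B) (s : Store N B) : Store N B :=
  match r.op with
  | Op.read => s
  | Op.write => Function.update s r.addr r.val

/-- The contents of the local memory of the user, as bit strings: the permanent part, which is
kept from one logical access to the next, and the temporary part, which exists only during a
logical access. There is no other local state: a program counter, a pending request, a received
block, and so on, all have to be kept in one of these two parts. -/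
structure UserMemory : Type where
  perm : List Bool
  temp : List Bool

/-- What the simulator receives: a logical request, or the reply of the server to the last
physical request. -/
inductive Input (N B : ℕ) : Type
  | logical (r : Request N B)
  | reply (v : Block B)

/-- What the simulator emits: a physical request to the server, or the block that answers the
current logical request. -/
inductive Output (S B : ℕ) : Type
  | physical (r : Request S B)
  | answer (v : Block B)

/-- An ORAM simulator (possibly stateful and probabilistic) for a database of `N` blocks of `B`
bits, on a server that holds `S` blocks.

* `setup` initializes the permanent memory of the user and the server for an initial database.
* `step` is the reaction to an input: from the local memory and the input, a random new local
  memory and a random output.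
* `budget` is the number of physical requests after which an unfinished logical access is cut
  off without an answer (which the correctness condition rules out). -/
structure Simulator (B N S : ℕ) : Type where
  setup : Store N B → PMF (List Bool × Store S B)
  step : UserMemory → Input N B → PMF (UserMemory × Output S B)
  budget : ℕ

/-- The record of one logical access: the answer, the addresses of the physical requests in the
order in which they were made, all the contents that the local memory had during the access, and
the permanent memory and the server contents at its end. -/
structure Access (B S : ℕ) : Type where
  answer : Option (Block B)
  addrs : List (Fin S)
  memories : List UserMemory
  perm : List Bool
  server : Store S B

namespace Simulator

variable {B N S : ℕ}

/-- Runs the simulator from local memory `m`, input `i` and server contents `s` until it answers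
or would exceed the given number of physical requests. The server executes each physical request
and replies with the resulting content of the addressed cell. -/
noncomputable def run (O : Simulator B N S) :
    ℕ → UserMemory → Input N B → Store S B → PMF (Access B S)
  | 0, m, i, s =>
      (O.step m i).map fun x =>
        match x.2 with
        | Output.answer v => ⟨some v, [], [x.1], x.1.perm, s⟩
        | Output.physical _ => ⟨none, [], [x.1], x.1.perm, s⟩
  | k + 1, m, i, s =>
      (O.step m i).bind fun x =>
        match x.2 with
        | Output.answer v => PMF.pure ⟨some v, [], [x.1], x.1.perm, s⟩
        | Output.physical r =>
            (O.run k x.1 (Input.reply (r.apply s r.addr)) (r.apply s)).map fun a =>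
              { a with addrs := r.addr :: a.addrs, memories := x.1 :: a.memories }

/-- One logical access. It starts with an empty temporary memory. -/
noncomputable def access (O : Simulator B N S) (p : List Bool) (s : Store S B)
    (r : Request N B) : PMF (Access B S) :=
  O.run O.budget ⟨p, []⟩ (Input.logical r) s

/-- The records of a sequence of logical accesses, answered online one after the other. -/
noncomputable def accesses (O : Simulator B N S) :
    List (Request N B) → List Bool → Store S B → PMF (List (Access B S))
  | [], _, _ => PMF.pure []
  | r :: rs, p, s =>
      (O.access p s r).bind fun a => (O.accesses rs a.perm a.server).map fun as => a :: as

/-- A complete execution on an initial database `D` and a sequence of logical requests: the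
permanent memory after the setup, and the records of the accesses. -/
noncomputable def execution (O : Simulator B N S) (D : Store N B) (rs : List (Request N B)) :
    PMF (List Bool × List (Access B S)) :=
  (O.setup D).bind fun x => (O.accesses rs x.1 x.2).map fun as => (x.1, as)

/-- The right answers to a sequence of logical requests: each request, be it a read or a write,
is answered by the block most recently written before it to its address (the block of the
initial database if there is none). -/
def rightAnswers : Store N B → List (Request N B) → List (Block B)
  | _, [] => []
  | D, r :: rs => D r.addr :: rightAnswers (r.apply D) rs

/-- Correctness: in every possible execution all answers are given and are right. -/
def Correct (O : Simulator B N S) : Prop :=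
  ∀ (D : Store N B) (rs : List (Request N B)), ∀ e ∈ (O.execution D rs).support,
    e.2.map Access.answer = (rightAnswers D rs).map some

/-- Information-theoretic security: the distribution of the physical addresses, listed access by
access, is the same for all sequences of logical requests of the same length (and all initial
databases). -/
def Secure (O : Simulator B N S) : Prop :=
  ∀ (D D' : Store N B) (rs rs' : List (Request N B)), rs.length = rs'.length →
    (O.execution D rs).map (fun e => e.2.map Access.addrs) =
      (O.execution D' rs').map (fun e => e.2.map Access.addrs)

/-- The worst-case bandwidth blowup is at most `W`: in every possible execution, each logical
access makes at most `W` physical requests, each of which transfers one block. -/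
def BandwidthAtMost (O : Simulator B N S) (W : ℝ) : Prop :=
  ∀ (D : Store N B) (rs : List (Request N B)), ∀ e ∈ (O.execution D rs).support,
    ∀ a ∈ e.2, (a.addrs.length : ℝ) ≤ W

/-- The temporary space usage of the user is at most `T` blocks: in every possible execution, at
every time during an access, the temporary memory has at most `T * B` bits. -/
def TemporarySpaceAtMost (O : Simulator B N S) (T : ℝ) : Prop :=
  ∀ (D : Store N B) (rs : List (Request N B)), ∀ e ∈ (O.execution D rs).support,
    ∀ a ∈ e.2, ∀ m ∈ a.memories, (m.temp.length : ℝ) ≤ T * B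

/-- The executions in which the permanent memory of the user has more than `R` blocks, that is,
more than `R * B` bits, at some time (between or during accesses). -/
def permanentSpaceExceeds (B S : ℕ) (R : ℝ) : Set (List Bool × List (Access B S)) :=
  {e | R * B < e.1.length ∨ ∃ a ∈ e.2, ∃ m ∈ a.memories, R * B < m.perm.length}

end Simulator

/-- The server space usage in bits of a server with `S` blocks of `B` bits. -/
def serverSpace (B S : ℕ) : ℝ := (S : ℝ) * B

/-- A negligible function: smaller than `1 / n ^ κ`, asymptotically, for every `κ > 0`. -/
def Negligible (ν : ℕ → ℝ) : Prop :=
  ∀ κ : ℝ, 0 < κ → ν =o[atTop] fun n : ℕ => 1 / (n : ℝ) ^ κ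

/-- A server space usage of `n + o(n)` bits for a database of `n` bits. -/
def Succinct (space : ℕ → ℝ) : Prop :=
  (fun n : ℕ => space n - n) =o[atTop] fun n : ℕ => (n : ℝ)

end ORAM

/-! The simulator is a tree ORAM with a recursive position map. Every block carries a uniform label
of `l` bits and lies either in the stash, which the user keeps, or in a node on the path to the leaf
named by its label. Labels are packed `β = B / l` per block into position-map blocks, which have
labels themselves, up to a single top block whose label the user keeps. An access walks down this
chain. Each block met is fetched along its path, relabelled by a fresh coin and put back as deep as
the capacities allow; then a second path, prescribed by a counter, is repacked in the same way.
Nodes at level `d` are residues modulo `2 ^ d`, so any `2 ^ d` consecutive evictions visit all of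
them. Data blocks and position-map blocks have separate trees.

Security. An access reveals old labels and replaces them by coins. Exchanging the two is a
bijection, so the new labelling is uniform and independent of what was revealed
(`average_average_exchange`, `LabelModel.uniform_bind_revealed`). Access and eviction times depend
on the requests alone; hence at each fixed moment the labels are uniform given the times, and every
stage of every access costs the same overflow probability (`LabelModel.average_risk_le`).

Stash. Greedy packing maintains that a block stays above a node of its path that was evicted since
the last access to the block only if this node is full. If the stash is large, there is then an
ancestor-closed set `T` of nodes such that the blocks that would sit in `T` with unbounded
capacities outnumber the capacity of `T` by the stash size (`Placed.exists_overfull`). At most `2 ^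
(d + 1)` blocks can have their ideal node at an inner level `d`, each with probability `2 ^ (-d)`
per node, so the expected load of an inner node is at most `2`, against a capacity of `5`. A
Chernoff bound and a union bound over `T`, weighted by `4 ^ (-|T|)`, give an overflow probability of
order `2 ^ (-R)` (`card_overloaded_mul_le`).

Space. With `F = f n` and `q = g n / √(F / log n)`, the data tree has between `F` and `2F` blocks
per leaf on average, and its leaves have capacity `K ≈ N / 2 ^ D + qF`. A leaf overflows ideally
with probability at most `exp (-q²F/8) = n ^ (-g²/8)`, which is negligible. Leaves cost a factor `1
+ O(q)`, labels and block numbers a factor `1 + O(log n / B)`; inner nodes, rounding and position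
map fit into the same slack (`Admissible.space_le`). A path has `O(log n + K) = O(F)` cells, and at
most `log n` position-map paths of `O(log n)` cells are used, whence the memory and bandwidth
bounds. -/

namespace ORAM

/-! ### Prefix codes -/

/-- There is a prefix-free binary code for `α` in which `x` has a code word of at most `len x`
bits. -/
def HasCode (α : Type) (len : α → ℕ) : Prop :=
  ∃ e : α → List Bool, (∀ x y s t, e x ++ s = e y ++ t → x = y ∧ s = t) ∧
    ∀ x, (e x).length ≤ len x

namespace HasCode

variable {α β : Type} {lα : α → ℕ} {lβ : β → ℕ}

theorem exists_injective (h : HasCode α lα) :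
    ∃ e : α → List Bool, Function.Injective e ∧ ∀ x, (e x).length ≤ lα x := by
  obtain ⟨e, he, hl⟩ := h
  exact ⟨e, fun x y hxy => (he x y [] [] (by rw [hxy])).1, hl⟩

theorem of_card [Fintype α] {k : ℕ} (h : Fintype.card α ≤ 2 ^ k) : HasCode α fun _ => k := by
  have h' : Fintype.card α ≤ Fintype.card (Fin k → Bool) := by simpa using h
  obtain ⟨φ⟩ := Function.Embedding.nonempty_of_card_le h'
  refine ⟨fun x => List.ofFn (φ x), fun x y s t hst => ?_, fun x => by simp⟩
  have := List.append_inj hst (by simp)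
  exact ⟨φ.injective (List.ofFn_injective this.1), this.2⟩

theorem comap (h : HasCode β lβ) (f : α → β) (hf : Function.Injective f) :
    HasCode α fun x => lβ (f x) := by
  obtain ⟨e, he, hl⟩ := h
  refine ⟨fun x => e (f x), fun x y s t hst => ?_, fun x => hl _⟩
  have := he _ _ _ _ hst
  exact ⟨hf this.1, this.2⟩

theorem mono (h : HasCode α lα) {l' : α → ℕ} (hl' : ∀ x, lα x ≤ l' x) : HasCode α l' := by
  obtain ⟨e, he, hl⟩ := h
  exact ⟨e, he, fun x => (hl x).trans (hl' x)⟩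

theorem prod (hα : HasCode α lα) (hβ : HasCode β lβ) :
    HasCode (α × β) fun x => lα x.1 + lβ x.2 := by
  obtain ⟨e, he, hl⟩ := hα
  obtain ⟨e', he', hl'⟩ := hβ
  refine ⟨fun x => e x.1 ++ e' x.2, fun x y s t hst => ?_, fun x => ?_⟩
  · rw [List.append_assoc, List.append_assoc] at hst
    obtain ⟨h1, h2⟩ := he _ _ _ _ hst
    obtain ⟨h3, h4⟩ := he' _ _ _ _ h2
    exact ⟨Prod.ext h1 h3, h4⟩
  · rw [List.length_append]
    exact add_le_add (hl _) (hl' _)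

theorem sum (hα : HasCode α lα) (hβ : HasCode β lβ) :
    HasCode (α ⊕ β) fun x => 1 + Sum.elim lα lβ x := by
  obtain ⟨e, he, hl⟩ := hα
  obtain ⟨e', he', hl'⟩ := hβ
  refine ⟨Sum.elim (fun x => false :: e x) (fun x => true :: e' x), ?_, ?_⟩
  · rintro (x | x) (y | y) s t hst
    · simp only [Sum.elim_inl, List.cons_append, List.cons.injEq, true_and] at hst
      simpa using he _ _ _ _ hst
    · simp at hst
    · simp at hst
    · simp only [Sum.elim_inr, List.cons_append, List.cons.injEq, true_and] at hst
      simpa using he' _ _ _ _ hst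
  · rintro (x | x)
    · have := hl x
      simp; omega
    · have := hl' x
      simp; omega

/-- A bit `true` announces each element and a bit `false` ends the list, which explains the `k + 1`
bits per element and the final bit. -/
theorem list {k : ℕ} (hα : HasCode α fun _ => k) :
    HasCode (List α) fun x => x.length * (k + 1) + 1 := by
  obtain ⟨e, he, hl⟩ := hα
  refine ⟨fun x => x.flatMap (fun a => true :: e a) ++ [false], fun x => ?_, fun x => ?_⟩
  · induction x with
    | nil =>
      rintro (_ | ⟨b, y⟩) s t hst
      · simpa using hst
      · simp at hst
    | cons a x ih =>
      rintro (_ | ⟨b, y⟩) s t hst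
      · simp at hst
      · simp only [List.flatMap_cons, List.cons_append, List.append_assoc, List.cons.injEq,
          true_and] at hst
        obtain ⟨h1, h2⟩ := he _ _ _ _ hst
        obtain ⟨h3, h4⟩ := ih y s t (by simpa using h2)
        exact ⟨by rw [h1, h3], h4⟩
  · induction x with
    | nil => simp
    | cons a x ih =>
      have := hl a
      simp only [List.flatMap_cons, List.length_append, List.length_cons, List.length_nil] at ih ⊢
      nlinarith

theorem finset {k : ℕ} (hα : HasCode α fun _ => k) :
    HasCode (Finset α) fun x => x.card * (k + 1) + 1 := by
  refine (hα.list.comap Finset.toList ?_).mono fun x => by simp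
  intro x y h
  classical
  ext a
  rw [← Finset.mem_toList, h, Finset.mem_toList]

end HasCode

/-! ### Machines that work in rounds

In a round, a list of server cells is read, a local computation is made, and the same cells are
written. -/

/-- A user algorithm that works in rounds. `start` reacts to a logical request, `done` tells
whether the access is complete, `cells` lists the cells of the next round, and `upd` is the local
computation of a round: from the contents of the cells, it computes their new contents. -/
structure Machine (B N S : ℕ) where
  Perm : Type
  Temp : Type
  Coin : Type
  [permNonempty : Nonempty Perm]
  [tempNonempty : Nonempty Temp]
  [coinFintype : Fintype Coin]
  [coinNonempty : Nonempty Coin]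
  start : Perm → Request N B → Coin → Perm × Temp
  done : Temp → Option (Block B)
  cells : Perm → Temp → List (Fin S)
  upd : Perm → Temp → Store S B → Perm × Temp × Store S B

attribute [instance] Machine.permNonempty Machine.tempNonempty Machine.coinFintype
  Machine.coinNonempty

/-- The progress within a round: the cells still to be read (the first of which is being read) and
the contents already read, or the writes still to be made. -/
abbrev Progress (B S : ℕ) : Type :=
  (List (Fin S) × List (Fin S × Block B)) ⊕ List (Fin S × Block B)

namespace Progress

/-- The number of cells kept in memory. -/
def size {B S : ℕ} : Progress B S → ℕ :=
  Sum.elim (fun x => x.1.length + x.2.length) List.length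

end Progress

/-- The server after a list of writes. -/
def writeAll {B S : ℕ} (w : List (Fin S × Block B)) (s : Store S B) : Store S B :=
  w.foldl (fun s x => Function.update s x.1 x.2) s

/-- All writes to a cell carry the same block, so repetitions in the list of cells are harmless. -/
theorem writeAll_map {B S : ℕ} (A : List (Fin S)) (t s : Store S B) :
    writeAll (A.map fun c => (c, t c)) s = fun c => if c ∈ A then t c else s c := by
  induction A generalizing s with
  | nil => simp [writeAll]
  | cons a A ih =>
    have : writeAll ((a :: A).map fun c => (c, t c)) s
        = writeAll (A.map fun c => (c, t c)) (Function.update s a (t a)) := rfl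
    rw [this, ih]
    funext c
    by_cases h : c ∈ A
    · simp [h]
    · by_cases h' : c = a
      · subst h'; simp
      · simp [h, h']

namespace Machine

variable {B N S : ℕ} (M : Machine B N S)

section

variable (ep : M.Perm → List Bool) (et : M.Temp × Progress B S → List Bool)

/-- The user memory in a given state. -/
def mem (p : M.Perm) (t : M.Temp) (q : Progress B S) : UserMemory := ⟨ep p, et (t, q)⟩

/-- The beginning of a round. -/
def beginRound (p : M.Perm) (t : M.Temp) : UserMemory × Output S B :=
  match M.done t with
  | some v => (M.mem ep et p t (Sum.inr []), Output.answer v)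
  | none =>
    match M.cells p t with
    -- A dummy answer: a round without cells is excluded in all results about runs.
    | [] => (M.mem ep et p t (Sum.inr []), Output.answer fun _ => false)
    | c :: A => (M.mem ep et p t (Sum.inl (c :: A, [])), Output.physical ⟨Op.read, c, fun _ => false⟩)

/-- The next write of a round. -/
def nextWrite (p : M.Perm) (t : M.Temp) : List (Fin S × Block B) → UserMemory × Output S B
  | [] => M.beginRound ep et p t
  | x :: w => (M.mem ep et p t (Sum.inr w), Output.physical ⟨Op.write, x.1, x.2⟩)

/-- The reaction to a reply of the server. -/
def react (p : M.Perm) (t : M.Temp) (v : Block B) : Progress B S → UserMemory × Output S B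
  | Sum.inr w => M.nextWrite ep et p t w
  -- Unreachable: the cell being read stays at the head of the list until its reply arrives.
  | Sum.inl ([], _) => M.beginRound ep et p t
  | Sum.inl (c :: c' :: A, l) =>
      (M.mem ep et p t (Sum.inl (c' :: A, l ++ [(c, v)])),
        Output.physical ⟨Op.read, c', fun _ => false⟩)
  | Sum.inl ([c], l) =>
      let x := M.upd p t (writeAll (l ++ [(c, v)]) fun _ _ => false)
      -- The cells to be written are those of the old state, which are the ones that were read.
      M.nextWrite ep et x.1 x.2.1 ((M.cells p t).map fun c => (c, x.2.2 c))

/-- The simulator given by a machine, an initialization and an encoding of its states. -/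
noncomputable def simulator (setup : Store N B → PMF (M.Perm × Store S B)) (budget : ℕ) :
    Simulator B N S where
  setup D := (setup D).map fun x => (ep x.1, x.2)
  step m i :=
    match i with
    -- Coins are tossed only here; all other steps are deterministic. Injectivity of the encodings
    -- makes `Function.invFun` a decoder.
    | Input.logical r => (PMF.uniformOfFintype M.Coin).map fun ω =>
        M.beginRound ep et (M.start (Function.invFun ep m.perm) r ω).1
          (M.start (Function.invFun ep m.perm) r ω).2
    | Input.reply v => PMF.pure
        (M.react ep et (Function.invFun ep m.perm) (Function.invFun et m.temp).1 v
          (Function.invFun et m.temp).2)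
  budget := budget

end

end Machine

/-! ### Execution of a machine, request by request. -/

namespace Simulator

variable {B N S : ℕ} (O : Simulator B N S)

/-- The rest of an access after a step of the simulator. -/
noncomputable def resume : ℕ → UserMemory × Output S B → Store S B → PMF (Access B S)
  | 0, x, s => PMF.pure
      (match x.2 with
        | Output.answer v => ⟨some v, [], [x.1], x.1.perm, s⟩
        | Output.physical _ => ⟨none, [], [x.1], x.1.perm, s⟩)
  | k + 1, x, s =>
        match x.2 with
        | Output.answer v => PMF.pure ⟨some v, [], [x.1], x.1.perm, s⟩
        | Output.physical r =>
            (O.run k x.1 (Input.reply (r.apply s r.addr)) (r.apply s)).map fun a =>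
              { a with addrs := r.addr :: a.addrs, memories := x.1 :: a.memories }

theorem run_eq (k : ℕ) (m : UserMemory) (i : Input N B) (s : Store S B) :
    O.run k m i s = (O.step m i).bind fun x => O.resume k x s := by
  cases k with
  | zero => rfl
  | succ k => rfl

/-- With any budget of at least `k` requests, the rest of the access is `a`. -/
def Runs (x : UserMemory × Output S B) (s : Store S B) (k : ℕ) (a : Access B S) : Prop :=
  ∀ k', k ≤ k' → O.resume k' x s = PMF.pure a

/-- Adds physical requests and memory contents to the beginning of an access. -/
def prepend (l : List (Fin S)) (ms : List UserMemory) (a : Access B S) : Access B S :=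
  { a with addrs := l ++ a.addrs, memories := ms ++ a.memories }

variable {O}

theorem Runs.mono {x : UserMemory × Output S B} {s : Store S B} {k l : ℕ} {a : Access B S}
    (h : O.Runs x s k a) (hkl : k ≤ l) : O.Runs x s l a := fun k' hk' => h k' (hkl.trans hk')

theorem runs_answer (m : UserMemory) (v : Block B) (s : Store S B) :
    O.Runs (m, Output.answer v) s 0 ⟨some v, [], [m], m.perm, s⟩ := by
  rintro (_ | k) _ <;> rfl

theorem runs_physical {m : UserMemory} {r : Request S B} {s : Store S B} {k : ℕ}
    {a : Access B S} {x : UserMemory × Output S B}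
    (hx : O.step m (Input.reply (r.apply s r.addr)) = PMF.pure x)
    (h : O.Runs x (r.apply s) k a) :
    O.Runs (m, Output.physical r) s (k + 1) (prepend [r.addr] [m] a) := by
  rintro (_ | k') hk'
  · omega
  · show (O.run k' m (Input.reply (r.apply s r.addr)) (r.apply s)).map _ = _
    rw [run_eq, hx, PMF.pure_bind, h k' (by omega), PMF.pure_map]
    rfl

end Simulator

namespace Machine

open Simulator

variable {B N S : ℕ} (M : Machine B N S) {ep : M.Perm → List Bool}
  {et : M.Temp × Progress B S → List Bool} (hep : Function.Injective ep)
  (het : Function.Injective et) {setup : Store N B → PMF (M.Perm × Store S B)} {budget : ℕ}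

include hep het in
theorem step_reply (p : M.Perm) (t : M.Temp) (q : Progress B S) (v : Block B) :
    (M.simulator ep et setup budget).step (M.mem ep et p t q) (Input.reply v)
      = PMF.pure (M.react ep et p t v q) := by
  simp only [simulator, mem, Function.leftInverse_invFun hep p, Function.leftInverse_invFun het (t, q)]

include hep het in
-- In continuation style: a completed run from the end of the writes is extended backwards. The list
-- `ms` keeps track of the memory contents for the space bounds.
theorem runs_nextWrite (p : M.Perm) (t : M.Temp) (w : List (Fin S × Block B)) (s : Store S B)
    {k : ℕ} {a : Access B S}
    (h : (M.simulator ep et setup budget).Runs (M.beginRound ep et p t) (writeAll w s) k a) :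
    ∃ ms : List UserMemory,
      (∀ m ∈ ms, ∃ q : Progress B S, q.size ≤ w.length ∧ m = M.mem ep et p t q) ∧
      (M.simulator ep et setup budget).Runs (M.nextWrite ep et p t w) s (k + w.length)
        (prepend (w.map Prod.fst) ms a) := by
  induction w generalizing s with
  | nil => exact ⟨[], by simp, h⟩
  | cons x w ih =>
    obtain ⟨ms, hms, hr⟩ := ih (Function.update s x.1 x.2) h
    refine ⟨M.mem ep et p t (Sum.inr w) :: ms, ?_, ?_⟩
    · intro m hm
      rcases List.mem_cons.1 hm with rfl | hm
      · exact ⟨_, by simp [Progress.size], rfl⟩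
      · obtain ⟨q, hq, rfl⟩ := hms m hm
        exact ⟨q, hq.trans (by simp), rfl⟩
    · have := runs_physical (r := ⟨Op.write, x.1, x.2⟩) (s := s)
        (M.step_reply (setup := setup) (budget := budget) hep het p t (Sum.inr w) _) hr
      exact this

include hep het in
theorem runs_read (p : M.Perm) (t : M.Temp) (A : List (Fin S)) (c : Fin S)
    (l : List (Fin S × Block B)) (s : Store S B) {k : ℕ} {a : Access B S}
    {x : M.Perm × M.Temp × Store S B}
    (hx : x = M.upd p t (writeAll (l ++ (c :: A).map fun c => (c, s c)) fun _ _ => false))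
    (h : (M.simulator ep et setup budget).Runs
      (M.nextWrite ep et x.1 x.2.1 ((M.cells p t).map fun c => (c, x.2.2 c))) s k a) :
    ∃ ms : List UserMemory,
      (∀ m ∈ ms, ∃ q : Progress B S, q.size ≤ l.length + (A.length + 1) ∧
        m = M.mem ep et p t q) ∧
      (M.simulator ep et setup budget).Runs
        (M.mem ep et p t (Sum.inl (c :: A, l)), Output.physical ⟨Op.read, c, fun _ => false⟩) s
        (k + (A.length + 1)) (prepend (c :: A) ms a) := by
  induction A generalizing c l with
  | nil =>
    refine ⟨[M.mem ep et p t (Sum.inl ([c], l))], ?_, ?_⟩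
    · intro m hm
      rw [List.mem_singleton] at hm
      exact ⟨_, by simp [Progress.size]; omega, hm⟩
    · refine runs_physical (r := ⟨Op.read, c, fun _ => false⟩) (s := s)
        (M.step_reply (setup := setup) (budget := budget) hep het p t (Sum.inl ([c], l)) _) ?_
      subst hx
      exact h
  | cons c' A ih =>
    obtain ⟨ms, hms, hr⟩ := ih c' (l ++ [(c, s c)]) (by simpa using hx)
    refine ⟨M.mem ep et p t (Sum.inl (c :: c' :: A, l)) :: ms, ?_, ?_⟩
    · intro m hm
      rcases List.mem_cons.1 hm with rfl | hm
      · exact ⟨_, by simp [Progress.size]; omega, rfl⟩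
      · obtain ⟨q, hq, rfl⟩ := hms m hm
        exact ⟨q, hq.trans (by simp; omega), rfl⟩
    · exact runs_physical (r := ⟨Op.read, c, fun _ => false⟩) (s := s)
        (M.step_reply (setup := setup) (budget := budget) hep het p t (Sum.inl (c :: c' :: A, l)) _)
        hr

/-- The effect of a round. -/
def round (x : M.Perm × M.Temp × Store S B) : M.Perm × M.Temp × Store S B :=
  let A := M.cells x.1 x.2.1
  -- The local computation may depend on the listed cells only, so all others are masked.
  let y := M.upd x.1 x.2.1 fun c => if c ∈ A then x.2.2 c else fun _ => false
  (y.1, y.2.1, fun c => if c ∈ A then y.2.2 c else x.2.2 c)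

include hep het in
-- All reads precede all writes, so a round shows its list of cells twice and the addresses are a
-- function of this list alone.
theorem runs_round (x : M.Perm × M.Temp × Store S B) (hd : M.done x.2.1 = none)
    (hA : M.cells x.1 x.2.1 ≠ []) {k : ℕ} {a : Access B S}
    (h : (M.simulator ep et setup budget).Runs
      (M.beginRound ep et (M.round x).1 (M.round x).2.1) (M.round x).2.2 k a) :
    ∃ ms : List UserMemory,
      (∀ m ∈ ms, ∃ q : Progress B S, q.size ≤ (M.cells x.1 x.2.1).length ∧
        (m = M.mem ep et x.1 x.2.1 q ∨ m = M.mem ep et (M.round x).1 (M.round x).2.1 q)) ∧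
      (M.simulator ep et setup budget).Runs (M.beginRound ep et x.1 x.2.1) x.2.2
        (k + 2 * (M.cells x.1 x.2.1).length)
        (prepend (M.cells x.1 x.2.1 ++ M.cells x.1 x.2.1) ms a) := by
  obtain ⟨p, t, s⟩ := x
  dsimp only at *
  set A := M.cells p t with hAdef
  obtain ⟨c, A', hcA⟩ := List.exists_cons_of_ne_nil hA
  set y := M.upd p t fun c => if c ∈ A then s c else fun _ => false with hy
  have h1 : M.round (p, t, s) = (y.1, y.2.1, fun c => if c ∈ A then y.2.2 c else s c) := rfl
  rw [h1, ← writeAll_map] at h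
  obtain ⟨ms, hms, hr⟩ := M.runs_nextWrite hep het y.1 y.2.1 _ s h
  have hy' : y = M.upd p t (writeAll ([] ++ (c :: A').map fun c => (c, s c)) fun _ _ => false) := by
    rw [hy, List.nil_append, ← hcA, writeAll_map]
  obtain ⟨ms', hms', hr'⟩ := M.runs_read hep het p t A' c [] s hy' hr
  refine ⟨ms' ++ ms, ?_, ?_⟩
  · intro m hm
    rcases List.mem_append.1 hm with hm | hm
    · obtain ⟨q, hq, rfl⟩ := hms' m hm
      exact ⟨q, by rw [hcA]; simpa using hq, Or.inl rfl⟩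
    · obtain ⟨q, hq, rfl⟩ := hms m hm
      exact ⟨q, by simpa using hq, Or.inr (by rw [h1])⟩
  · have hb : M.beginRound ep et p t = (M.mem ep et p t (Sum.inl (c :: A', [])),
        Output.physical ⟨Op.read, c, fun _ => false⟩) := by
      simp only [beginRound, hd, ← hAdef, hcA]
    rw [hb]
    have e1 : k + (List.map (fun c => (c, y.2.2 c)) (M.cells p t)).length + (A'.length + 1)
        = k + 2 * A.length := by
      rw [← hAdef, hcA]; simp; ring
    have e2 : prepend (c :: A') ms' (prepend
          ((List.map (fun c => (c, y.2.2 c)) (M.cells p t)).map Prod.fst) ms a)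
        = prepend (A ++ A) (ms' ++ ms) a := by
      rw [List.map_map, ← hAdef]
      have : (Prod.fst ∘ fun c => (c, y.2.2 c)) = (id : Fin S → Fin S) := rfl
      rw [this, List.map_id, ← hcA]
      simp [prepend]
    rw [← e1, ← e2]
    exact hr'

include hep het in
/-- The course of an access, given the contents of the user memory and of the server between the
rounds. -/
theorem runs_rounds {kmax : ℕ} (n : ℕ) (x : ℕ → M.Perm × M.Temp × Store S B) (v : Block B)
    (hx : ∀ j < n, x (j + 1) = M.round (x j))
    (hd : ∀ j < n, M.done (x j).2.1 = none) (hv : M.done (x n).2.1 = some v)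
    (hA : ∀ j < n, M.cells (x j).1 (x j).2.1 ≠ [])
    (hk : ∀ j < n, (M.cells (x j).1 (x j).2.1).length ≤ kmax) :
    ∃ a : Access B S,
      (M.simulator ep et setup budget).Runs (M.beginRound ep et (x 0).1 (x 0).2.1) (x 0).2.2
        (n * (2 * kmax)) a ∧
      a.answer = some v ∧
      a.addrs = (List.range n).flatMap (fun j =>
        M.cells (x j).1 (x j).2.1 ++ M.cells (x j).1 (x j).2.1) ∧
      (∀ m ∈ a.memories, ∃ j ≤ n, ∃ q : Progress B S, q.size ≤ kmax ∧
        m = M.mem ep et (x j).1 (x j).2.1 q) ∧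
      a.perm = ep (x n).1 ∧ a.server = (x n).2.2 := by
  induction n generalizing x with
  | zero =>
    have hb : M.beginRound ep et (x 0).1 (x 0).2.1
        = (M.mem ep et (x 0).1 (x 0).2.1 (Sum.inr []), Output.answer v) := by
      simp only [beginRound, hv]
    refine ⟨_, by rw [hb]; simpa using runs_answer _ _ _, rfl, rfl, ?_, rfl, rfl⟩
    intro m hm
    exact ⟨0, le_rfl, Sum.inr [], by simp [Progress.size], by simpa using hm⟩
  | succ n ih =>
    obtain ⟨a, ha, h1, h2, h3, h4, h5⟩ := ih (fun j => x (j + 1))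
      (fun j hj => hx _ (by omega)) (fun j hj => hd _ (by omega)) hv
      (fun j hj => hA _ (by omega)) (fun j hj => hk _ (by omega))
    simp only [zero_add, hx 0 (Nat.succ_pos n)] at ha
    obtain ⟨ms, hms, hr⟩ := M.runs_round hep het (x 0) (hd 0 (Nat.succ_pos n))
      (hA 0 (Nat.succ_pos n)) ha
    refine ⟨_, hr.mono ?_, h1, ?_, ?_, h4, h5⟩
    · have := hk 0 (Nat.succ_pos n)
      nlinarith
    · rw [List.range_succ_eq_map, List.flatMap_cons, List.flatMap_map]
      simp only [prepend, h2]
    · intro m hm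
      rcases List.mem_append.1 hm with hm | hm
      · obtain ⟨q, hq, hq'⟩ := hms m hm
        rcases hq' with hq' | hq'
        · exact ⟨0, by omega, q, hq.trans (hk 0 (Nat.succ_pos n)), hq'⟩
        · exact ⟨1, by omega, q, hq.trans (hk 0 (Nat.succ_pos n)), by
            rw [hq', ← hx 0 (Nat.succ_pos n)]⟩
      · obtain ⟨j, hj, q, hq, rfl⟩ := h3 m hm
        exact ⟨j + 1, by omega, q, hq, rfl⟩

include hep in
-- After the coin of `start` the access is deterministic, so its law is the image of the uniform law
-- of the coin.
theorem access_eq (p : M.Perm) (s : Store S B) (r : Request N B) (a : M.Coin → Access B S)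
    (h : ∀ ω, (M.simulator ep et setup budget).Runs
      (M.beginRound ep et (M.start p r ω).1 (M.start p r ω).2) s budget (a ω)) :
    (M.simulator ep et setup budget).access (ep p) s r
      = (PMF.uniformOfFintype M.Coin).map a := by
  rw [access, run_eq]
  have hs : (M.simulator ep et setup budget).step ⟨ep p, []⟩ (Input.logical r)
      = (PMF.uniformOfFintype M.Coin).map fun ω =>
        M.beginRound ep et (M.start p r ω).1 (M.start p r ω).2 := by
    simp only [simulator, Function.leftInverse_invFun hep p]
  rw [hs, PMF.bind_map, ← PMF.bind_pure_comp]
  congr 1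
  funext ω
  exact h ω budget le_rfl

end Machine

/-! ### Greedy placement of blocks -/

/-- `loc` places the elements of `E` at levels at most `t`, does not exceed the capacities, and
each element is as deep as the capacities allow. -/
structure IsGreedy {α ν : Type} [DecidableEq ν] (E : Finset α) (t : α → ℕ) (key : α → ℕ → ν)
    (cap : ℕ → ν → ℕ) (loc : α → ℕ) : Prop where
  le : ∀ e ∈ E, loc e ≤ t e
  card_le : ∀ d v, 1 ≤ d → (E.filter fun e => loc e = d ∧ key e d = v).card ≤ cap d v
  full : ∀ e ∈ E, ∀ d, loc e < d → d ≤ t e →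
    cap d (key e d) ≤ (E.filter fun e' => loc e' = d ∧ key e' d = key e d).card

/-- Among the admissible placements, one with the largest sum of levels is greedy: room in a deeper
permitted node would allow a move that increases the sum. Everything at level `0` is admissible
because that level has no capacity bound. -/
theorem exists_isGreedy {α ν : Type} [DecidableEq ν] (E : Finset α) (t : α → ℕ)
    (key : α → ℕ → ν) (cap : ℕ → ν → ℕ) : ∃ loc, IsGreedy E t key cap loc := by
  classical
  let P : (α → ℕ) → Prop := fun loc => (∀ e ∈ E, loc e ≤ t e) ∧
    ∀ d v, 1 ≤ d → (E.filter fun e => loc e = d ∧ key e d = v).card ≤ cap d v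
  let V : Set ℕ := {n | ∃ loc, P loc ∧ ∑ e ∈ E, loc e = n}
  have hne : V.Nonempty := by
    refine ⟨0, fun _ => 0, ⟨fun e _ => Nat.zero_le _, fun d v hd => ?_⟩, by simp⟩
    rw [Finset.filter_false_of_mem fun e _ h => by have := h.1; simp at this; omega]
    simp
  have hbd : BddAbove V := by
    refine ⟨∑ e ∈ E, t e, ?_⟩
    rintro n ⟨loc, hP, rfl⟩
    exact Finset.sum_le_sum hP.1
  obtain ⟨loc, hP, hloc⟩ := Nat.sSup_mem hne hbd
  refine ⟨loc, hP.1, hP.2, fun e he d hd hdt => ?_⟩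
  by_contra! hlt
  have hP' : P (Function.update loc e d) := by
    refine ⟨fun e' he' => ?_, fun d' v hd' => ?_⟩
    · by_cases h : e' = e
      · subst h; simpa using hdt
      · simpa [h] using hP.1 e' he'
    · by_cases hv : d' = d ∧ v = key e d
      · obtain ⟨rfl, rfl⟩ := hv
        refine le_trans (Finset.card_le_card (t := insert e
          (E.filter fun e' => loc e' = d' ∧ key e' d' = key e d')) ?_)
          ((Finset.card_insert_le _ _).trans hlt)
        intro x hx
        rw [Finset.mem_filter] at hx
        by_cases h : x = e
        · simp [h]
        · simp only [Finset.mem_insert, h, Finset.mem_filter, false_or]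
          simpa [h] using hx
      · refine le_trans (Finset.card_le_card ?_) (hP.2 d' v hd')
        intro x hx
        rw [Finset.mem_filter] at hx ⊢
        by_cases h : x = e
        · subst h
          simp only [Function.update_self] at hx
          exact absurd ⟨hx.2.1.symm, by rw [← hx.2.2, hx.2.1]⟩ hv
        · simpa [h] using hx
  have h1 : ∑ e' ∈ E, Function.update loc e d e' ≤ sSup V := le_csSup hbd ⟨_, hP', rfl⟩
  rw [← hloc] at h1
  refine absurd h1 (not_le.2 (Finset.sum_lt_sum (fun e' _ => ?_) ⟨e, he, by simpa using hd⟩))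
  by_cases h : e' = e
  · subst h; simpa using hd.le
  · simp [h]

/-- The depth down to which the paths to two leaves agree. -/
def commonDepth (D x y : ℕ) : ℕ := Nat.findGreatest (fun d => x % 2 ^ d = y % 2 ^ d) D

theorem mod_pow_eq_of_le {x y d e : ℕ} (h : x % 2 ^ d = y % 2 ^ d) (hed : e ≤ d) :
    x % 2 ^ e = y % 2 ^ e := by
  have := congrArg (· % 2 ^ e) h
  simpa [Nat.mod_mod_of_dvd _ (pow_dvd_pow 2 hed)] using this

theorem commonDepth_le (D x y : ℕ) : commonDepth D x y ≤ D := Nat.findGreatest_le D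

theorem mod_commonDepth (D x y : ℕ) :
    x % 2 ^ commonDepth D x y = y % 2 ^ commonDepth D x y :=
  Nat.findGreatest_spec (P := fun d => x % 2 ^ d = y % 2 ^ d) (Nat.zero_le D)
    (by simp [Nat.mod_one])

theorem le_commonDepth {D x y d : ℕ} (hd : d ≤ D) (h : x % 2 ^ d = y % 2 ^ d) :
    d ≤ commonDepth D x y := Nat.le_findGreatest hd h

/-! ### The invariant of the trees and the ideal nodes. -/

section Trees

variable {U : Type} [Fintype U] (tree : U → Bool) (D : Bool → ℕ)
  (cap : Bool → ℕ → ℕ)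

/-- The blocks located in a node, given the labels and the levels of the blocks. The node of
tree `b` at level `d` with index `r` is on the paths to the leaves congruent to `r` modulo `2 ^ d`.
The only node at level `0` is the stash. -/
def located (lam lev : U → ℕ) (b : Bool) (d r : ℕ) : Finset U :=
  Finset.univ.filter fun u => tree u = b ∧ lev u = d ∧ lam u % 2 ^ d = r

/-- At a time between the last access to block `u` and now, the path through the node of `u` at
level `d` has been evicted. -/
def Evicted (lam lst : U → ℕ) (cnt : Bool → ℕ) (u : U) (d : ℕ) : Prop :=
  ∃ τ, lst u ≤ τ ∧ τ < cnt (tree u) ∧ τ % 2 ^ d = lam u % 2 ^ d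

/-- The invariant of the placement of blocks in the trees. -/
structure Placed (lam lev lst : U → ℕ) (cnt : Bool → ℕ) : Prop where
  le : ∀ u, lev u ≤ D (tree u)
  card_le : ∀ b d r, 1 ≤ d → (located tree lam lev b d r).card ≤ cap b d
  full : ∀ u d, lev u < d → d ≤ D (tree u) → Evicted tree lam lst cnt u d →
    cap (tree u) d ≤ (located tree lam lev (tree u) d (lam u % 2 ^ d)).card

/-- The blocks on the path to leaf `P` of tree `b`, including the stash. -/
def visible (lam lev : U → ℕ) (b : Bool) (P : ℕ) : Finset U :=
  Finset.univ.filter fun u => tree u = b ∧ lam u % 2 ^ lev u = P % 2 ^ lev u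

variable {tree D cap}

/-- On the repacked path fullness follows from greediness, whatever happened before, so `hfull` is
required off the path only. This covers both accesses and evictions. -/
theorem Placed.repack {lam lev lst : U → ℕ} {cnt : Bool → ℕ} {b : Bool} {P : ℕ} {loc : U → ℕ}
    (hle : ∀ u, lev u ≤ D (tree u))
    (hcard : ∀ b d r, 1 ≤ d → (located tree lam lev b d r).card ≤ cap b d)
    (hfull : ∀ u d, lev u < d → d ≤ D (tree u) → Evicted tree lam lst cnt u d →
      ¬ (tree u = b ∧ lam u % 2 ^ d = P % 2 ^ d) →
      cap (tree u) d ≤ (located tree lam lev (tree u) d (lam u % 2 ^ d)).card)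
    (hloc : IsGreedy (visible tree lam lev b P) (fun u => commonDepth (D b) (lam u) P)
      (fun u d => lam u % 2 ^ d) (fun d _ => cap b d) loc)
    {lev' : U → ℕ} (hvis : ∀ u ∈ visible tree lam lev b P, lev' u = loc u)
    (hinv : ∀ u ∉ visible tree lam lev b P, lev' u = lev u) :
    Placed tree D cap lam lev' lst cnt := by
  have memv : ∀ u, u ∈ visible tree lam lev b P ↔
      tree u = b ∧ lam u % 2 ^ lev u = P % 2 ^ lev u := fun u => by simp [visible]
  have onpath : ∀ u ∈ visible tree lam lev b P, lam u % 2 ^ lev' u = P % 2 ^ lev' u := by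
    intro u hu
    rw [hvis u hu]
    exact mod_pow_eq_of_le (mod_commonDepth (D b) (lam u) P) (hloc.le u hu)
  have ltree : ∀ u ∈ visible tree lam lev b P, lev' u ≤ D (tree u) := by
    intro u hu
    rw [hvis u hu, ((memv u).1 hu).1]
    exact (hloc.le u hu).trans (commonDepth_le _ _ _)
  -- nodes on the path hold exactly the newly placed blocks, the others have not changed
  have on : ∀ d, located tree lam lev' b d (P % 2 ^ d) =
      (visible tree lam lev b P).filter fun u => loc u = d ∧ lam u % 2 ^ d = P % 2 ^ d := by
    intro d
    ext u
    simp only [located, Finset.mem_filter, Finset.mem_univ, true_and]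
    constructor
    · rintro ⟨h1, h2, h3⟩
      have hu : u ∈ visible tree lam lev b P := by
        by_contra hu
        rw [hinv u hu] at h2
        exact hu ((memv u).2 ⟨h1, by rw [h2, h3]⟩)
      exact ⟨hu, by rw [← hvis u hu, h2], h3⟩
    · rintro ⟨hu, h2, h3⟩
      exact ⟨((memv u).1 hu).1, by rw [hvis u hu, h2], h3⟩
  have off : ∀ b' d r, ¬ (b' = b ∧ r = P % 2 ^ d) →
      located tree lam lev' b' d r = located tree lam lev b' d r := by
    intro b' d r hoff
    ext u
    simp only [located, Finset.mem_filter, Finset.mem_univ, true_and]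
    by_cases hu : u ∈ visible tree lam lev b P
    · obtain ⟨h1, h2⟩ := (memv u).1 hu
      have h3 := onpath u hu
      constructor
      · rintro ⟨h4, h5, h6⟩
        exact absurd ⟨by rw [← h4, h1], by rw [← h6, ← h5, h3]⟩ hoff
      · rintro ⟨h4, h5, h6⟩
        exact absurd ⟨by rw [← h4, h1], by rw [← h6, ← h5, h2]⟩ hoff
    · rw [hinv u hu]
  refine ⟨fun u => ?_, fun b' d r hd => ?_, fun u d hd hdD hev => ?_⟩
  · by_cases hu : u ∈ visible tree lam lev b P
    · exact ltree u hu
    · rw [hinv u hu]; exact hle u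
  · by_cases h : b' = b ∧ r = P % 2 ^ d
    · obtain ⟨rfl, rfl⟩ := h
      rw [on]
      exact hloc.card_le d _ hd
    · rw [off _ _ _ h]
      exact hcard _ _ _ hd
  · by_cases h : tree u = b ∧ lam u % 2 ^ d = P % 2 ^ d
    · obtain ⟨h1, h2⟩ := h
      have hu : u ∈ visible tree lam lev b P := by
        by_contra hu
        rw [hinv u hu] at hd
        exact hu ((memv u).2 ⟨h1, mod_pow_eq_of_le h2 hd.le⟩)
      have := hloc.full u hu d (by rw [← hvis u hu]; exact hd)
        (le_commonDepth (by rw [← h1]; exact hdD) h2)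
      rw [h2, h1, on]
      simpa only [h2] using this
    · rw [off _ _ _ h]
      refine hfull u d ?_ hdD hev h
      by_cases hu : u ∈ visible tree lam lev b P
      -- A visible block at level `d` or deeper would have its node at level `d` on the path.
      · obtain ⟨h1, h2⟩ := (memv u).1 hu
        by_contra! hle'
        exact h ⟨h1, mod_pow_eq_of_le h2 hle'⟩
      · rw [← hinv u hu]; exact hd

/-- The initial placement: every block is as deep as possible. -/
theorem Placed.initial {lam lev lst : U → ℕ} {cnt : Bool → ℕ}
    (h : IsGreedy Finset.univ (fun u => D (tree u)) (fun u d => (tree u, lam u % 2 ^ d))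
      (fun d v => cap v.1 d) lev) : Placed tree D cap lam lev lst cnt := by
  have hl : ∀ b d r, located tree lam lev b d r = Finset.univ.filter fun u =>
      lev u = d ∧ (tree u, lam u % 2 ^ d) = (b, r) := by
    intro b d r
    ext u
    simp only [located, Finset.mem_filter, Finset.mem_univ, true_and, Prod.mk.injEq]
    tauto
  refine ⟨fun u => h.le u (Finset.mem_univ _), fun b d r hd => ?_, fun u d hd hdD _ => ?_⟩
  · rw [hl]
    exact h.card_le d (b, r) hd
  · rw [hl]
    exact h.full u (Finset.mem_univ _) d hd hdD

open Classical in
/-- The node, as a pair of a level and an index, where a block would be if all capacities were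
infinite. -/
noncomputable def idealNode (D : ℕ) (lst cnt x : ℕ) : ℕ × ℕ :=
  let d := Nat.findGreatest (fun d => ∃ τ, lst ≤ τ ∧ τ < cnt ∧ τ % 2 ^ d = x % 2 ^ d) D
  (d, x % 2 ^ d)

/-- A set of nodes of a tree is closed under taking ancestors. -/
def AncestorClosed (T : Finset (ℕ × ℕ)) : Prop :=
  ∀ v ∈ T, ∀ e ≤ v.1, (e, v.2 % 2 ^ e) ∈ T

/-- If the stash holds many blocks, then there is an ancestor-closed set of full nodes to which
many blocks would belong if all capacities were infinite. -/
theorem Placed.exists_overfull {lam lev lst : U → ℕ} {cnt : Bool → ℕ}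
    (h : Placed tree D cap lam lev lst cnt) (b : Bool) :
    ∃ T : Finset (ℕ × ℕ), AncestorClosed T ∧ (0, 0) ∈ T ∧ (∀ v ∈ T, v.1 ≤ D b ∧ v.2 < 2 ^ v.1) ∧
      (located tree lam lev b 0 0).card + ∑ v ∈ T.erase (0, 0), cap b v.1 ≤
        (Finset.univ.filter fun u => tree u = b ∧
          idealNode (D b) (lst u) (cnt b) (lam u) ∈ T).card := by
  classical
  -- The nodes that are full together with all their ancestors below the root. The root belongs to
  -- `T` vacuously.
  let T : Finset (ℕ × ℕ) := ((Finset.range (D b + 1)) ×ˢ (Finset.range (2 ^ D b))).filter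
    fun v => v.2 < 2 ^ v.1 ∧ ∀ e, 1 ≤ e → e ≤ v.1 →
      cap b e ≤ (located tree lam lev b e (v.2 % 2 ^ e)).card
  have memT : ∀ v : ℕ × ℕ, v ∈ T ↔ v.1 ≤ D b ∧ v.2 < 2 ^ v.1 ∧ ∀ e, 1 ≤ e → e ≤ v.1 →
      cap b e ≤ (located tree lam lev b e (v.2 % 2 ^ e)).card := by
    intro v
    simp only [T, Finset.mem_filter, Finset.mem_product, Finset.mem_range, Nat.lt_succ_iff]
    constructor
    · rintro ⟨⟨h1, _⟩, h2, h3⟩; exact ⟨h1, h2, h3⟩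
    · rintro ⟨h1, h2, h3⟩
      exact ⟨⟨h1, h2.trans_le (Nat.pow_le_pow_right (by norm_num) h1)⟩, h2, h3⟩
  have hmm : ∀ x e d : ℕ, e ≤ d → x % 2 ^ d % 2 ^ e = x % 2 ^ e := fun x e d hed =>
    Nat.mod_mod_of_dvd _ (pow_dvd_pow 2 hed)
  have h0 : ((0, 0) : ℕ × ℕ) ∈ T := (memT _).2 ⟨Nat.zero_le _, by simp, fun e h1 h2 => by
    simp at h2; omega⟩
  refine ⟨T, ?_, h0, fun v hv => ⟨((memT v).1 hv).1, ((memT v).1 hv).2.1⟩, ?_⟩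
  · intro v hv e he
    obtain ⟨h1, h2, h3⟩ := (memT v).1 hv
    refine (memT _).2 ⟨he.trans h1, Nat.mod_lt _ (by positivity), fun e' h1' h2' => ?_⟩
    have h2'' : e' ≤ e := h2'
    simp only [hmm _ _ _ h2'']
    exact h3 e' h1' (h2''.trans he)
  · calc (located tree lam lev b 0 0).card + ∑ v ∈ T.erase (0, 0), cap b v.1
        ≤ (located tree lam lev b 0 0).card
          + ∑ v ∈ T.erase (0, 0), (located tree lam lev b v.1 v.2).card := by
          refine Nat.add_le_add_left (Finset.sum_le_sum fun v hv => ?_) _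
          obtain ⟨hv0, hv⟩ := Finset.mem_erase.1 hv
          obtain ⟨h1, h2, h3⟩ := (memT v).1 hv
          have hpos : 1 ≤ v.1 := by
            by_contra hlt
            have h10 : v.1 = 0 := by omega
            have h20 : v.2 = 0 := by rw [h10] at h2; simpa using h2
            exact hv0 (Prod.ext h10 h20)
          have := h3 v.1 hpos le_rfl
          rwa [Nat.mod_eq_of_lt h2] at this
      _ = ∑ v ∈ T, (located tree lam lev b v.1 v.2).card := by
          rw [← Finset.add_sum_erase T _ h0]
      _ = (T.biUnion fun v => located tree lam lev b v.1 v.2).card := by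
          rw [Finset.card_biUnion]
          intro v _ w _ hvw
          rw [Function.onFun, Finset.disjoint_left]
          intro u hu hu'
          simp only [located, Finset.mem_filter, Finset.mem_univ, true_and] at hu hu'
          have h1 : v.1 = w.1 := hu.2.1.symm.trans hu'.2.1
          refine hvw (Prod.ext h1 ?_)
          rw [← hu.2.2, ← hu'.2.2, h1]
      _ ≤ _ := by
          refine Finset.card_le_card fun u hu => ?_
          obtain ⟨v, hv, hu⟩ := Finset.mem_biUnion.1 hu
          simp only [located, Finset.mem_filter, Finset.mem_univ, true_and] at hu ⊢
          obtain ⟨hub, hul, hur⟩ := hu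
          refine ⟨hub, ?_⟩
          obtain ⟨h1, h2, h3⟩ := (memT v).1 hv
          set d := Nat.findGreatest
            (fun d => ∃ τ, lst u ≤ τ ∧ τ < cnt b ∧ τ % 2 ^ d = lam u % 2 ^ d) (D b) with hd
          show (d, lam u % 2 ^ d) ∈ T
          have hdD : d ≤ D b := Nat.findGreatest_le _
          refine (memT _).2 ⟨hdD, Nat.mod_lt _ (by positivity), fun e he hed => ?_⟩
          simp only at hed
          simp only [hmm _ _ _ hed]
          -- Down to the actual node of the block the nodes are full by membership in `T`. Between
          -- there and the ideal node they are full by the invariant, because the path was evicted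
          -- since the last access.
          rcases le_or_gt e v.1 with hev | hev
          · have := h3 e he hev
            rwa [← hur, hmm _ _ _ hev] at this
          · have hd0 : d ≠ 0 := by omega
            have hspec := Nat.findGreatest_of_ne_zero (P := fun d =>
              ∃ τ, lst u ≤ τ ∧ τ < cnt b ∧ τ % 2 ^ d = lam u % 2 ^ d) hd.symm hd0
            obtain ⟨τ, ht1, ht2, ht3⟩ := hspec
            have := h.full u e (by omega) (by rw [hub]; omega)
              ⟨τ, ht1, by rw [hub]; exact ht2, mod_pow_eq_of_le ht3 hed⟩
            rwa [hub] at this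

end Trees

/-! ### Enumeration of ancestor-closed sets -/

/-- The sets of nodes among the first `h` levels of the subtree of a node that are empty or contain
this node and are closed under taking ancestors in the subtree. -/
def subtrees : ℕ → ℕ → ℕ → Finset (Finset (ℕ × ℕ))
  | 0, _, _ => {∅}
  | h + 1, d, r => insert ∅ ((subtrees h (d + 1) r ×ˢ subtrees h (d + 1) (r + 2 ^ d)).image
      fun p => insert (d, r) (p.1 ∪ p.2))

theorem mem_subtrees {h d r : ℕ} (hr : r < 2 ^ d) {T : Finset (ℕ × ℕ)} (hT : T ∈ subtrees h d r)
    {v : ℕ × ℕ} (hv : v ∈ T) :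
    d ≤ v.1 ∧ v.1 < d + h ∧ v.2 % 2 ^ d = r ∧ v.2 < 2 ^ v.1 := by
  induction h generalizing d r T with
  | zero => simp [subtrees] at hT; simp [hT] at hv
  | succ h ih =>
    rw [subtrees, Finset.mem_insert, Finset.mem_image] at hT
    rcases hT with rfl | ⟨p, hp, rfl⟩
    · simp at hv
    · obtain ⟨hp1, hp2⟩ := Finset.mem_product.1 hp
      have hpow : 2 ^ (d + 1) = 2 ^ d * 2 := pow_succ 2 d
      have key : ∀ x : ℕ, x % 2 ^ (d + 1) % 2 ^ d = x % 2 ^ d := fun x =>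
        Nat.mod_mod_of_dvd _ (pow_dvd_pow 2 (Nat.le_succ d))
      rcases Finset.mem_insert.1 hv with rfl | hv
      · exact ⟨le_rfl, by simp, Nat.mod_eq_of_lt hr, hr⟩
      rcases Finset.mem_union.1 hv with hv | hv
      · obtain ⟨h1, h2, h3, h4⟩ := ih (by omega) hp1 hv
        refine ⟨by omega, by omega, ?_, h4⟩
        rw [← key, h3, Nat.mod_eq_of_lt hr]
      · obtain ⟨h1, h2, h3, h4⟩ := ih (by omega) hp2 hv
        refine ⟨by omega, by omega, ?_, h4⟩
        rw [← key, h3, Nat.add_mod_right, Nat.mod_eq_of_lt hr]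

/-- The sum for height `h + 1` is at most `1 + w x y`, with `x`, `y` the sums for the two children;
the bound `2` reproduces itself as `1 + (1/4) * 2 * 2 = 2`. -/
theorem sum_subtrees_le {w : ℝ} (hw0 : 0 ≤ w) (hw : w ≤ 1 / 4) (h d r : ℕ) (hr : r < 2 ^ d) :
    ∑ T ∈ subtrees h d r, w ^ T.card ≤ 2 := by
  induction h generalizing d r with
  | zero => simp [subtrees]
  | succ h ih =>
    have hpow : 2 ^ (d + 1) = 2 ^ d * 2 := pow_succ 2 d
    have i1 := ih (d + 1) r (by omega)
    have i2 := ih (d + 1) (r + 2 ^ d) (by omega)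
    have hn : ∀ d r, 0 ≤ ∑ T ∈ subtrees h d r, w ^ T.card := fun d r =>
      Finset.sum_nonneg fun _ _ => by positivity
    have step : ∑ T ∈ subtrees (h + 1) d r, w ^ T.card ≤ 1 + ∑ p ∈ subtrees h (d + 1) r ×ˢ
        subtrees h (d + 1) (r + 2 ^ d), w * (w ^ p.1.card * w ^ p.2.card) := by
      rw [subtrees]
      have hins : ∀ (a : Finset (ℕ × ℕ)) (s : Finset (Finset (ℕ × ℕ))),
          ∑ T ∈ insert a s, w ^ T.card ≤ w ^ a.card + ∑ T ∈ s, w ^ T.card := by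
        intro a s
        by_cases ha : a ∈ s
        · rw [Finset.insert_eq_of_mem ha]
          have : 0 ≤ w ^ a.card := by positivity
          linarith
        · rw [Finset.sum_insert ha]
      refine (hins _ _).trans (add_le_add (by simp) ?_)
      refine (Finset.sum_image_le_of_nonneg fun _ _ => by positivity).trans
        (le_of_eq (Finset.sum_congr rfl fun p hp => ?_))
      obtain ⟨hp1, hp2⟩ := Finset.mem_product.1 hp
      have hr' : r ≠ r + 2 ^ d := by
        have : 0 < 2 ^ d := by positivity
        omega
      rw [Finset.card_insert_of_notMem, Finset.card_union_of_disjoint, pow_succ', pow_add]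
      · refine Finset.disjoint_left.2 fun v hv hv' => hr' ?_
        have h1 := (mem_subtrees (by omega) hp1 hv).2.2.1
        have h2 := (mem_subtrees (by omega) hp2 hv').2.2.1
        exact h1.symm.trans h2
      · intro hv
        rcases Finset.mem_union.1 hv with hv | hv
        · have := (mem_subtrees (by omega) hp1 hv).1
          simp at this
        · have := (mem_subtrees (by omega) hp2 hv).1
          simp at this
    rw [← Finset.mul_sum, Finset.sum_product] at step
    simp only [← Finset.mul_sum, ← Finset.sum_mul] at step
    nlinarith [mul_le_mul i1 i2 (hn _ _) (by norm_num), mul_nonneg (hn (d+1) r) (hn (d+1) (r+2^d))]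

/-- The children of `(d, r)` are the residues `r` and `r + 2 ^ d` modulo `2 ^ (d + 1)`; without the
root of the subtree, closedness leaves nothing. -/
theorem filter_mem_subtrees {T : Finset (ℕ × ℕ)} (hT : AncestorClosed T)
    (hlt : ∀ v ∈ T, v.2 < 2 ^ v.1) (h d r : ℕ) (hr : r < 2 ^ d) (hh : ∀ v ∈ T, v.1 < d + h) :
    (T.filter fun v => d ≤ v.1 ∧ v.2 % 2 ^ d = r) ∈ subtrees h d r := by
  induction h generalizing d r with
  | zero =>
    rw [subtrees, Finset.mem_singleton, Finset.filter_eq_empty_iff]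
    intro v hv h
    have := hh v hv
    omega
  | succ h ih =>
    rw [subtrees, Finset.mem_insert, Finset.mem_image]
    have hpow : 2 ^ (d + 1) = 2 ^ d * 2 := pow_succ 2 d
    by_cases hmem : (d, r) ∈ T
    · right
      refine ⟨(T.filter fun v => d + 1 ≤ v.1 ∧ v.2 % 2 ^ (d + 1) = r,
        T.filter fun v => d + 1 ≤ v.1 ∧ v.2 % 2 ^ (d + 1) = r + 2 ^ d), Finset.mem_product.2 ⟨ih (d + 1) r (by omega) fun v hv => ?_,
        ih (d + 1) (r + 2 ^ d) (by omega) fun v hv => ?_⟩, ?_⟩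
      · have := hh v hv; omega
      · have := hh v hv; omega
      · ext v
        rw [Finset.mem_insert, Finset.mem_union, Finset.mem_filter, Finset.mem_filter,
          Finset.mem_filter]
        have key : v.2 % 2 ^ (d + 1) % 2 ^ d = v.2 % 2 ^ d :=
          Nat.mod_mod_of_dvd _ (pow_dvd_pow 2 (Nat.le_succ d))
        have hmlt : v.2 % 2 ^ (d + 1) < 2 ^ (d + 1) := Nat.mod_lt _ (by positivity)
        constructor
        · rintro (rfl | ⟨hv, h1, h2⟩ | ⟨hv, h1, h2⟩)
          · exact ⟨hmem, le_rfl, Nat.mod_eq_of_lt hr⟩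
          · exact ⟨hv, by omega, by rw [← key, h2, Nat.mod_eq_of_lt hr]⟩
          · exact ⟨hv, by omega, by rw [← key, h2, Nat.add_mod_right, Nat.mod_eq_of_lt hr]⟩
        · rintro ⟨hv, h1, h2⟩
          rcases h1.eq_or_lt with h1 | h1
          · left
            have := hlt v hv
            rw [← h1] at this
            rw [Nat.mod_eq_of_lt this] at h2
            exact Prod.ext h1.symm h2
          · right
            set y := v.2 % 2 ^ (d + 1) with hy
            rcases lt_or_ge y (2 ^ d) with hyl | hyl
            · left
              exact ⟨hv, h1, by rw [← h2, ← key, Nat.mod_eq_of_lt hyl]⟩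
            · right
              refine ⟨hv, h1, ?_⟩
              rw [← h2, ← key, Nat.mod_eq_sub_mod hyl, Nat.mod_eq_of_lt (by omega)]
              omega
    · left
      rw [Finset.filter_eq_empty_iff]
      rintro v hv ⟨h1, h2⟩
      have := hT v hv d h1
      rw [h2] at this
      exact hmem this

/-! ### Concentration -/

/-- Chernoff's bound in counting form: Markov's inequality for `θ ^ count`, whose sum over all
labellings factorizes over the blocks, and `1 + x ≤ exp x`. -/
theorem card_filter_mul_pow_le {U Λ : Type} [Fintype U] [DecidableEq U] [Fintype Λ]
    [DecidableEq Λ] [Nonempty Λ] (A : U → Finset Λ) {θ : ℝ} (hθ : 1 ≤ θ) (s : ℕ) :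
    ((Finset.univ.filter fun lam : U → Λ =>
        s ≤ (Finset.univ.filter fun u => lam u ∈ A u).card).card : ℝ) * θ ^ s ≤
      Fintype.card (U → Λ) *
        Real.exp ((θ - 1) * ((∑ u, (A u).card : ℕ) : ℝ) / Fintype.card Λ) := by
  have hΛ : (0 : ℝ) < Fintype.card Λ := by exact_mod_cast Fintype.card_pos
  calc _ = ∑ lam ∈ Finset.univ.filter fun lam : U → Λ =>
          s ≤ (Finset.univ.filter fun u => lam u ∈ A u).card, θ ^ s := by
        rw [Finset.sum_const, nsmul_eq_mul]
    _ ≤ ∑ lam ∈ Finset.univ.filter fun lam : U → Λ =>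
          s ≤ (Finset.univ.filter fun u => lam u ∈ A u).card,
            ∏ u, if lam u ∈ A u then θ else 1 := by
        refine Finset.sum_le_sum fun lam hlam => ?_
        rw [← Finset.prod_filter, Finset.prod_const]
        exact pow_le_pow_right₀ hθ (Finset.mem_filter.1 hlam).2
    _ ≤ ∑ lam : U → Λ, ∏ u, if lam u ∈ A u then θ else 1 := by
        refine Finset.sum_le_sum_of_subset_of_nonneg (Finset.filter_subset _ _) fun lam _ _ => ?_
        refine Finset.prod_nonneg fun u _ => ?_
        split_ifs <;> linarith
    _ = ∏ u, ∑ x : Λ, (if x ∈ A u then θ else 1) := by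
        rw [Finset.prod_univ_sum, Fintype.piFinset_univ]
    _ ≤ ∏ u : U, (Fintype.card Λ : ℝ) *
          Real.exp ((θ - 1) * (A u).card / Fintype.card Λ) := by
        refine Finset.prod_le_prod (fun u _ => Finset.sum_nonneg fun x _ => ?_) fun u _ => ?_
        · split_ifs <;> linarith
        · have h1 : ∑ x : Λ, (if x ∈ A u then θ else 1)
              = Fintype.card Λ + (θ - 1) * (A u).card := by
            have : ∀ x : Λ, (if x ∈ A u then θ else 1) = 1 + if x ∈ A u then θ - 1 else 0 := by
              intro x; split_ifs <;> ring
            simp_rw [this]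
            rw [Finset.sum_add_distrib, ← Finset.sum_filter]
            simp
            ring
          rw [h1]
          have h2 := Real.add_one_le_exp ((θ - 1) * (A u).card / Fintype.card Λ)
          calc (Fintype.card Λ : ℝ) + (θ - 1) * (A u).card
              = Fintype.card Λ * ((θ - 1) * (A u).card / Fintype.card Λ + 1) := by
                field_simp; ring
            _ ≤ _ := by gcongr
    _ = _ := by
        rw [Finset.prod_mul_distrib, ← Real.exp_sum, Finset.prod_const]
        congr 1
        · simp
        · congr 1
          push_cast
          rw [Finset.mul_sum, Finset.sum_div]

theorem exp_two_le : Real.exp 2 ≤ 8 := by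
  have h := Real.exp_one_lt_d9
  have : Real.exp 2 = Real.exp 1 * Real.exp 1 := by rw [← Real.exp_add]; norm_num
  rw [this]
  nlinarith [Real.exp_pos 1]

section Load

variable {U Λ : Type} [Fintype U] [DecidableEq U] [Fintype Λ] [DecidableEq Λ] [Nonempty Λ]

/-- The number of blocks whose ideal node is in a set of nodes. -/
def load (node : U → Λ → Option (ℕ × ℕ)) (T : Finset (ℕ × ℕ)) (lam : U → Λ) : ℕ :=
  (Finset.univ.filter fun u => ∃ v ∈ T, node u (lam u) = some v).card

/-- There is a nonempty ancestor-closed set of nodes of level less than `h` whose load exceeds its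
capacity by `R`, for nodes of capacity `5`; the root does not count. -/
def Overloaded (node : U → Λ → Option (ℕ × ℕ)) (h R : ℕ) (lam : U → Λ) : Prop :=
  ∃ T ∈ subtrees h 0 0, T.Nonempty ∧ R + 5 * (T.card - 1) ≤ load node T lam

open Classical in
-- A set of `t` nodes has expected load at most `2 t`. With `θ = 2` its probability of overload is
-- at most `exp (2 t) / 2 ^ (R + 5 (t - 1)) ≤ 32 * 4 ^ (-t) / 2 ^ R`. Capacity `5` thus yields the
-- weight `1 / 4` of `sum_subtrees_le`, and the union bound over the sets costs a factor `2`.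
theorem card_overloaded_mul_le (node : U → Λ → Option (ℕ × ℕ)) (h R : ℕ)
    (hnode : ∀ d r, d < h → r < 2 ^ d →
      ∑ u, (Finset.univ.filter fun x => node u x = some (d, r)).card ≤ 2 * Fintype.card Λ) :
    ((Finset.univ.filter fun lam : U → Λ => Overloaded node h R lam).card : ℝ) * 2 ^ R ≤
      64 * Fintype.card (U → Λ) := by
  have hΛ : (0 : ℝ) < Fintype.card Λ := by exact_mod_cast Fintype.card_pos
  have one : ∀ T ∈ subtrees h 0 0, T.Nonempty →
      ((Finset.univ.filter fun lam : U → Λ =>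
        R + 5 * (T.card - 1) ≤ load node T lam).card : ℝ) * 2 ^ R ≤
      32 * Fintype.card (U → Λ) * (1 / 4) ^ T.card := by
    intro T hT hne
    have h1 := card_filter_mul_pow_le (U := U) (Λ := Λ)
      (fun u => Finset.univ.filter fun x => ∃ v ∈ T, node u x = some v) (θ := 2) (by norm_num)
      (R + 5 * (T.card - 1))
    simp only [Finset.mem_filter, Finset.mem_univ, true_and] at h1
    have h2 : ∑ u, (Finset.univ.filter fun x => ∃ v ∈ T, node u x = some v).card
        ≤ T.card * (2 * Fintype.card Λ) := by
      calc _ ≤ ∑ u, ∑ v ∈ T, (Finset.univ.filter fun x => node u x = some v).card := by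
            refine Finset.sum_le_sum fun u _ => ?_
            refine le_trans (Finset.card_le_card ?_) Finset.card_biUnion_le
            intro x hx
            simpa using hx
        _ = ∑ v ∈ T, ∑ u, (Finset.univ.filter fun x => node u x = some v).card :=
            Finset.sum_comm
        _ ≤ ∑ v ∈ T, 2 * Fintype.card Λ := by
            refine Finset.sum_le_sum fun v hv => ?_
            have := mem_subtrees (by norm_num) hT hv
            exact hnode v.1 v.2 (by omega) this.2.2.2
        _ = _ := by rw [Finset.sum_const, smul_eq_mul]
    have h3 : Real.exp ((2 - 1) * ((∑ u, (Finset.univ.filter fun x =>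
        ∃ v ∈ T, node u x = some v).card : ℕ) : ℝ) / Fintype.card Λ) ≤ 8 ^ T.card := by
      calc _ ≤ Real.exp (T.card * 2) := by
            apply Real.exp_le_exp.2
            rw [div_le_iff₀ hΛ]
            have : ((∑ u, (Finset.univ.filter fun x =>
                ∃ v ∈ T, node u x = some v).card : ℕ) : ℝ) ≤
                (T.card * (2 * Fintype.card Λ) : ℕ) := by exact_mod_cast h2
            push_cast at this ⊢
            linarith
        _ = Real.exp 2 ^ T.card := by rw [← Real.exp_nat_mul]
        _ ≤ _ := pow_le_pow_left₀ (Real.exp_pos _).le exp_two_le _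
    obtain ⟨k, hk⟩ : ∃ k, T.card = k + 1 := ⟨T.card - 1, by have := hne.card_pos; omega⟩
    have h4 := h1.trans (mul_le_mul_of_nonneg_left h3 (by positivity))
    simp only [load, hk, Nat.add_sub_cancel] at h4 ⊢
    rw [pow_add, pow_mul, ← mul_assoc] at h4
    have h32 : (0 : ℝ) < (2 ^ 5) ^ k := by positivity
    refine le_of_mul_le_mul_right (h4.trans (le_of_eq ?_)) h32
    have e8 : (8 : ℝ) ^ (k + 1) = 8 * 8 ^ k := by ring
    have e4 : ((1 : ℝ) / 4) ^ (k + 1) * (2 ^ 5) ^ k = 1 / 4 * 8 ^ k := by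
      rw [pow_succ, mul_right_comm, ← mul_pow]
      norm_num
      ring
    rw [mul_assoc (32 * _), e4, e8]
    ring
  calc _ ≤ (∑ T ∈ subtrees h 0 0 with T.Nonempty, ((Finset.univ.filter fun lam : U → Λ =>
        R + 5 * (T.card - 1) ≤ load node T lam).card : ℝ)) * 2 ^ R := by
        gcongr
        norm_cast
        refine le_trans (Finset.card_le_card ?_) Finset.card_biUnion_le
        intro lam hlam
        obtain ⟨T, hT, hne, hle⟩ := (Finset.mem_filter.1 hlam).2
        refine Finset.mem_biUnion.2 ⟨T, Finset.mem_filter.2 ⟨hT, hne⟩, ?_⟩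
        exact Finset.mem_filter.2 ⟨Finset.mem_univ _, hle⟩
    _ ≤ ∑ T ∈ subtrees h 0 0 with T.Nonempty,
          32 * (Fintype.card (U → Λ) : ℝ) * (1 / 4) ^ T.card := by
        rw [Finset.sum_mul]
        refine Finset.sum_le_sum fun T hT => ?_
        obtain ⟨hT, hne⟩ := Finset.mem_filter.1 hT
        exact one T hT hne
    _ ≤ ∑ T ∈ subtrees h 0 0, 32 * (Fintype.card (U → Λ) : ℝ) * (1 / 4) ^ T.card :=
        Finset.sum_le_sum_of_subset_of_nonneg (Finset.filter_subset _ _) fun _ _ _ => by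
          positivity
    _ ≤ 32 * Fintype.card (U → Λ) * 2 := by
        rw [← Finset.mul_sum]
        gcongr
        exact sum_subtrees_le (by norm_num) le_rfl h 0 0 (by norm_num)
    _ = _ := by ring

end Load

/-! ### The ideal nodes -/

theorem exists_mod_eq (a x M : ℕ) (hM : 0 < M) : ∃ τ, a ≤ τ ∧ τ < a + M ∧ τ % M = x % M := by
  -- The offset is `x - a` modulo `M`, with `-a` written as `(M - 1) * a`.
  refine ⟨a + (x + (M - 1) * a) % M, Nat.le_add_right _ _,
    Nat.add_lt_add_left (Nat.mod_lt _ hM) _, ?_⟩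
  rw [Nat.add_mod_mod]
  obtain ⟨m, rfl⟩ : ∃ m, M = m + 1 := ⟨M - 1, by omega⟩
  have : a + (x + (m + 1 - 1) * a) = x + (m + 1) * a := by
    rw [Nat.add_sub_cancel]; ring
  rw [this, Nat.add_mul_mod_self_left]

theorem card_filter_mod_le (l d r : ℕ) (hd : d ≤ l) :
    (Finset.univ.filter fun x : Fin (2 ^ l) => x.val % 2 ^ d = r).card ≤ 2 ^ (l - d) := by
  have h : 2 ^ l = 2 ^ d * 2 ^ (l - d) := by rw [← pow_add]; congr 1; omega
  calc _ ≤ (Finset.range (2 ^ (l - d))).card := by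
        refine Finset.card_le_card_of_injOn (fun x => x.val / 2 ^ d) ?_ ?_
        · intro x _
          have := x.2.trans_eq h
          simpa using Nat.div_lt_of_lt_mul this
        · intro x hx y hy hxy
          simp only [Finset.coe_filter, Finset.mem_univ, true_and, Set.mem_ofPred_eq] at hx hy hxy
          apply Fin.ext
          rw [← Nat.div_add_mod x.val (2 ^ d), ← Nat.div_add_mod y.val (2 ^ d), hxy, hx, hy]
    _ = _ := Finset.card_range _

open Classical in
-- A window of `2 ^ (d + 1)` evictions visits every node of level `d + 1`, so the ideal node lies
-- deeper than `d`.
theorem card_idealNode_eq_zero {l D lst cnt d r : ℕ} (hd : d < D)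
    (h : lst + 2 ^ (d + 1) ≤ cnt) :
    (Finset.univ.filter fun x : Fin (2 ^ l) => idealNode D lst cnt x.val = (d, r)).card = 0 := by
  rw [Finset.card_eq_zero, Finset.filter_eq_empty_iff]
  intro x _ hx
  obtain ⟨τ, h1, h2, h3⟩ := exists_mod_eq lst x (2 ^ (d + 1)) (by positivity)
  have h4 := Nat.le_findGreatest
    (P := fun d => ∃ τ, lst ≤ τ ∧ τ < cnt ∧ τ % 2 ^ d = x.val % 2 ^ d) hd
    ⟨τ, h1, h2.trans_le h, h3⟩
  have h5 := congrArg Prod.fst hx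
  simp only [idealNode] at h5
  rw [h5] at h4
  exact absurd h4 (Nat.not_succ_le_self d)

theorem card_idealNode_le (l D lst cnt d r : ℕ) (hd : d ≤ l) :
    (Finset.univ.filter fun x : Fin (2 ^ l) => idealNode D lst cnt x.val = (d, r)).card
      ≤ 2 ^ (l - d) := by
  refine le_trans (Finset.card_le_card ?_) (card_filter_mod_le l d r hd)
  intro x hx
  simp only [Finset.mem_filter, Finset.mem_univ, true_and, idealNode, Prod.mk.injEq] at hx ⊢
  rw [← hx.2, hx.1]

section Tree

variable {U : Type} [Fintype U] (tree : U → Bool)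

/-- The times of the last accesses to the blocks are possible: blocks of the same tree that have
been accessed have been so at different times. -/
structure ValidTimes (l : ℕ) (lst : U → ℕ) (cnt : Bool → ℕ) : Prop where
  -- Counters start at `2 ^ l`: for a block that was never accessed, with time `0`, every path
  -- counts as evicted.
  le_cnt : ∀ b, 2 ^ l ≤ cnt b
  lst_le : ∀ u, lst u ≤ cnt (tree u)
  inj : ∀ u w, tree u = tree w → lst u = lst w → 0 < lst u → u = w

/-- The ideal nodes of the blocks of tree `b`. -/
noncomputable def idealNodes {l : ℕ} (D : ℕ) (lst : U → ℕ) (cnt : Bool → ℕ) (b : Bool) (u : U)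
    (x : Fin (2 ^ l)) : Option (ℕ × ℕ) :=
  if tree u = b then some (idealNode D (lst u) (cnt b) x) else none

variable {tree}

/-- The expected load of an inner node is at most `2`. Only blocks accessed during the last `2 ^ (d
+ 1)` evictions can have their ideal node at level `d`; access times within a tree are distinct, so
there are at most `2 ^ (d + 1)` of them, and each hits a given node with probability at most `2 ^
(-d)`. -/
theorem sum_card_idealNodes_le {l D : ℕ} (hD : D ≤ l) {lst : U → ℕ} {cnt : Bool → ℕ}
    (h : ValidTimes tree l lst cnt) (b : Bool) {d r : ℕ} (hd : d < D) :
    ∑ u, (Finset.univ.filter fun x : Fin (2 ^ l) =>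
      idealNodes tree D lst cnt b u x = some (d, r)).card ≤ 2 * 2 ^ l := by
  classical
  let V := Finset.univ.filter fun u => tree u = b ∧ cnt b < lst u + 2 ^ (d + 1)
  have hV : V.card ≤ 2 ^ (d + 1) := by
    -- As the counter is at least `2 ^ l ≥ 2 ^ (d + 1)`, recent access times are positive, which is
    -- what distinctness of the times requires.
    have hpos : ∀ u ∈ V, 0 < lst u ∧ lst u ∈ Finset.Ioc (cnt b - 2 ^ (d + 1)) (cnt b) := by
      intro u hu
      obtain ⟨h1, h2⟩ := (Finset.mem_filter.1 hu).2
      have h3 := h.le_cnt b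
      have h4 := h.lst_le u
      have h5 : 2 ^ (d + 1) ≤ 2 ^ l := Nat.pow_le_pow_right (by norm_num) (by omega)
      have h6 : 0 < 2 ^ (d + 1) := by positivity
      rw [h1] at h4
      rw [Finset.mem_Ioc]
      omega
    calc V.card ≤ (Finset.Ioc (cnt b - 2 ^ (d + 1)) (cnt b)).card := by
          refine Finset.card_le_card_of_injOn lst (fun u hu => (hpos u hu).2) ?_
          intro u hu w hw huw
          refine h.inj u w ?_ huw (hpos u hu).1
          rw [(Finset.mem_filter.1 hu).2.1, (Finset.mem_filter.1 hw).2.1]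
      _ ≤ _ := by
          rw [Nat.card_Ioc]
          generalize 2 ^ (d + 1) = M
          omega
  calc _ ≤ ∑ u, if u ∈ V then 2 ^ (l - d) else 0 := by
        refine Finset.sum_le_sum fun u _ => ?_
        by_cases hu : tree u = b
        · simp only [idealNodes, hu, if_true, Option.some.injEq]
          split_ifs with huV
          · exact card_idealNode_le l D _ _ d r (by omega)
          · refine (card_idealNode_eq_zero hd ?_).le
            by_contra! hlt
            exact huV (Finset.mem_filter.2 ⟨Finset.mem_univ _, hu, hlt⟩)
        · simp [idealNodes, hu]
    _ = V.card * 2 ^ (l - d) := by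
        rw [← Finset.sum_filter, Finset.sum_const, smul_eq_mul]
        congr 2
        ext u; simp
    _ ≤ 2 ^ (d + 1) * 2 ^ (l - d) := Nat.mul_le_mul_right _ hV
    _ = 2 * 2 ^ l := by
        rw [← pow_add, ← pow_succ']; congr 1; omega

theorem sum_card_idealNodes_leaf_le {l D : ℕ} (hD : D ≤ l) (lst : U → ℕ) (cnt : Bool → ℕ)
    (b : Bool) (r : ℕ) :
    ∑ u, (Finset.univ.filter fun x : Fin (2 ^ l) =>
      idealNodes tree D lst cnt b u x = some (D, r)).card ≤
        (Finset.univ.filter fun u => tree u = b).card * 2 ^ (l - D) := by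
  rw [← smul_eq_mul, ← Finset.sum_const, Finset.sum_filter]
  refine Finset.sum_le_sum fun u _ => ?_
  by_cases hu : tree u = b
  · simp only [idealNodes, hu, if_true, Option.some.injEq]
    exact card_idealNode_le l D _ _ D r hD
  · simp [idealNodes, hu]

variable {D : Bool → ℕ} {cap : Bool → ℕ → ℕ} {l : ℕ}

theorem Placed.overloaded {lam : U → Fin (2 ^ l)} {lev lst : U → ℕ} {cnt : Bool → ℕ}
    (h : Placed tree D cap (fun u => (lam u).val) lev lst cnt) (b : Bool) (hcap : ∀ d, cap b d = 5) :
    Overloaded (idealNodes tree (D b) lst cnt b) (D b + 1)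
      (located tree (fun u => (lam u).val) lev b 0 0).card lam := by
  obtain ⟨T, hT, h0, hlt, hle⟩ := h.exists_overfull b
  refine ⟨T, ?_, ⟨_, h0⟩, ?_⟩
  · have := filter_mem_subtrees hT (fun v hv => (hlt v hv).2) (D b + 1) 0 0 (by norm_num)
      fun v hv => by have := (hlt v hv).1; omega
    rwa [Finset.filter_true_of_mem fun v _ => ⟨Nat.zero_le _, by simp [Nat.mod_one]⟩] at this
  · simp only [hcap, Finset.sum_const, Finset.card_erase_of_mem h0, smul_eq_mul] at hle
    rw [mul_comm 5]
    refine hle.trans (Finset.card_le_card fun u hu => ?_)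
    rw [Finset.mem_filter] at hu ⊢
    exact ⟨hu.1, _, hu.2.2, by rw [idealNodes, if_pos hu.2.1]⟩

/-- A full leaf adds `K` to the capacity of the overfull set and, unless it overflows ideally, at
most `K` to its load. So the leaves can be dropped from the set and inner nodes of capacity `5`
remain. -/
theorem Placed.overloaded_or {lam : U → Fin (2 ^ l)} {lev lst : U → ℕ} {cnt : Bool → ℕ}
    (h : Placed tree D cap (fun u => (lam u).val) lev lst cnt) (b : Bool) (K : ℕ) (hD : 0 < D b)
    (hcap : ∀ d < D b, cap b d = 5) (hK : cap b (D b) = K) :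
    Overloaded (idealNodes tree (D b) lst cnt b) (D b)
      (located tree (fun u => (lam u).val) lev b 0 0).card lam ∨
    ∃ r < 2 ^ D b, K + 1 ≤ load (idealNodes tree (D b) lst cnt b) {(D b, r)} lam := by
  classical
  obtain ⟨T, hT, h0, hlt, hle⟩ := h.exists_overfull b
  rw [or_iff_not_imp_right]
  intro hleaf
  push Not at hleaf
  set node := idealNodes tree (D b) lst cnt b with hnode
  set T' := T.filter fun v => v.1 < D b with hT'
  set L := T.filter fun v => ¬ v.1 < D b with hL
  have h0' : (0, 0) ∈ T' := Finset.mem_filter.2 ⟨h0, hD⟩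
  have hLD : ∀ v ∈ L, v.1 = D b := fun v hv => by
    have h1 := (Finset.mem_filter.1 hv)
    have h2 := (hlt v h1.1).1
    have h3 := h1.2
    omega
  refine ⟨T', ?_, ⟨_, h0'⟩, ?_⟩
  · have hcl : AncestorClosed T' := fun v hv e he => by
      obtain ⟨h1, h2⟩ := Finset.mem_filter.1 hv
      exact Finset.mem_filter.2 ⟨hT v h1 e he, lt_of_le_of_lt he h2⟩
    have := filter_mem_subtrees hcl (fun v hv => (hlt v (Finset.mem_filter.1 hv).1).2) (D b) 0 0
      (by norm_num) fun v hv => by have := (Finset.mem_filter.1 hv).2; omega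
    rwa [Finset.filter_true_of_mem fun v _ => ⟨Nat.zero_le _, by simp [Nat.mod_one]⟩] at this
  · have hsum : ∑ v ∈ T.erase (0, 0), cap b v.1 = 5 * (T'.card - 1) + L.card * K := by
      rw [← Finset.sum_filter_add_sum_filter_not _ (fun v => v.1 < D b)]
      have e1 : (T.erase (0, 0)).filter (fun v => v.1 < D b) = T'.erase (0, 0) := by
        rw [hT', Finset.filter_erase]
      have e2 : (T.erase (0, 0)).filter (fun v => ¬ v.1 < D b) = L := by
        rw [Finset.filter_erase, ← hL, Finset.erase_eq_of_notMem]
        intro h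
        exact (Finset.mem_filter.1 h).2 hD
      rw [e1, e2, Finset.sum_congr (s₁ := T'.erase (0, 0)) rfl fun v hv => hcap v.1
        (Finset.mem_filter.1 (Finset.mem_of_mem_erase hv)).2,
        Finset.sum_congr (s₁ := L) rfl fun v hv => show cap b v.1 = K by rw [hLD v hv, hK]]
      simp only [Finset.sum_const, Finset.card_erase_of_mem h0', smul_eq_mul]
      ring
    have hload : (Finset.univ.filter fun u => tree u = b ∧
        idealNode (D b) (lst u) (cnt b) (lam u) ∈ T).card ≤ load node T' lam + L.card * K := by
      calc _ ≤ ((Finset.univ.filter fun u => ∃ v ∈ T', node u (lam u) = some v) ∪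
            L.biUnion fun w => Finset.univ.filter fun u =>
              ∃ v ∈ ({w} : Finset (ℕ × ℕ)), node u (lam u) = some v).card := by
            refine Finset.card_le_card fun u hu => ?_
            simp only [Finset.mem_filter, Finset.mem_univ, true_and] at hu
            have hn : node u (lam u) = some (idealNode (D b) (lst u) (cnt b) (lam u)) := by
              rw [hnode, idealNodes, if_pos hu.1]
            rw [Finset.mem_union]
            by_cases hv : (idealNode (D b) (lst u) (cnt b) (lam u)).1 < D b
            · left
              exact Finset.mem_filter.2 ⟨Finset.mem_univ _, _, Finset.mem_filter.2 ⟨hu.2, hv⟩, hn⟩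
            · right
              exact Finset.mem_biUnion.2 ⟨_, Finset.mem_filter.2 ⟨hu.2, hv⟩,
                Finset.mem_filter.2 ⟨Finset.mem_univ _, _, Finset.mem_singleton_self _, hn⟩⟩
        _ ≤ load node T' lam + ∑ w ∈ L, load node {w} lam :=
            (Finset.card_union_le _ _).trans (Nat.add_le_add_left Finset.card_biUnion_le _)
        _ ≤ _ := by
            refine Nat.add_le_add_left ?_ _
            rw [← smul_eq_mul, ← Finset.sum_const]
            refine Finset.sum_le_sum fun w hw => ?_
            have h1 := hLD w hw
            have h2 := (hlt w (Finset.mem_filter.1 hw).1).2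
            have := hleaf w.2 (by rwa [h1] at h2)
            rw [← h1] at this
            exact Nat.lt_succ_iff.1 this
    rw [hsum] at hle
    omega

open Classical in
-- Chernoff's bound for one leaf, whose expected load is at most the number of blocks divided by `2
-- ^ d`, and a union bound over the leaves. The parameter `θ` is tuned in `leaf_overflow_le`.
theorem card_leaf_overflow_mul_le [DecidableEq U] (lst : U → ℕ) (cnt : Bool → ℕ) (b : Bool)
    (K : ℕ) {θ : ℝ} (hθ : 1 ≤ θ) {d : ℕ} (hd : d ≤ l) :
    ((Finset.univ.filter fun lam : U → Fin (2 ^ l) => ∃ r < 2 ^ d,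
      K + 1 ≤ load (idealNodes tree d lst cnt b) {(d, r)} lam).card : ℝ) * θ ^ K ≤
    Fintype.card (U → Fin (2 ^ l)) * (2 ^ d *
      Real.exp ((θ - 1) * (Finset.univ.filter fun u => tree u = b).card / 2 ^ d)) := by
  have one : ∀ r ∈ Finset.range (2 ^ d), ((Finset.univ.filter fun lam : U → Fin (2 ^ l) =>
      K + 1 ≤ load (idealNodes tree d lst cnt b) {(d, r)} lam).card : ℝ) * θ ^ K ≤
      Fintype.card (U → Fin (2 ^ l)) *
        Real.exp ((θ - 1) * (Finset.univ.filter fun u => tree u = b).card / 2 ^ d) := by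
    intro r _
    have h1 := card_filter_mul_pow_le (U := U) (Λ := Fin (2 ^ l))
      (fun u => Finset.univ.filter fun x => idealNodes tree d lst cnt b u x = some (d, r)) hθ
      (K + 1)
    simp only [Finset.mem_filter, Finset.mem_univ, true_and] at h1
    refine le_trans ?_ (h1.trans (mul_le_mul_of_nonneg_left (Real.exp_le_exp.2 ?_)
      (by positivity)))
    · simp only [load, Finset.mem_singleton, exists_eq_left]
      gcongr
      exact Nat.le_succ K
    · have h2 := sum_card_idealNodes_leaf_le (tree := tree) hd lst cnt b r
      have h3 : ((2 : ℝ) ^ l) = 2 ^ d * 2 ^ (l - d) := by rw [← pow_add]; congr 1; omega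
      have h4 : ((∑ u, (Finset.univ.filter fun x : Fin (2 ^ l) =>
          idealNodes tree d lst cnt b u x = some (d, r)).card : ℕ) : ℝ) ≤
          (Finset.univ.filter fun u => tree u = b).card * 2 ^ (l - d) := by exact_mod_cast h2
      rw [Fintype.card_fin]
      push_cast at h4 ⊢
      rw [h3, div_le_div_iff₀ (by positivity) (by positivity)]
      have h5 := mul_le_mul_of_nonneg_left h4 (sub_nonneg.2 hθ)
      have h6 := mul_le_mul_of_nonneg_right h5 (by positivity : (0 : ℝ) ≤ 2 ^ d)
      linarith
  calc _ ≤ (∑ r ∈ Finset.range (2 ^ d), ((Finset.univ.filter fun lam : U → Fin (2 ^ l) =>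
      K + 1 ≤ load (idealNodes tree d lst cnt b) {(d, r)} lam).card : ℝ)) * θ ^ K := by
        gcongr
        norm_cast
        refine le_trans (Finset.card_le_card ?_) Finset.card_biUnion_le
        intro lam hlam
        obtain ⟨r, hr, hle⟩ := (Finset.mem_filter.1 hlam).2
        exact Finset.mem_biUnion.2 ⟨r, Finset.mem_range.2 hr,
          Finset.mem_filter.2 ⟨Finset.mem_univ _, hle⟩⟩
    _ ≤ ∑ r ∈ Finset.range (2 ^ d), (Fintype.card (U → Fin (2 ^ l)) : ℝ) *
        Real.exp ((θ - 1) * (Finset.univ.filter fun u => tree u = b).card / 2 ^ d) := by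
        rw [Finset.sum_mul]
        exact Finset.sum_le_sum one
    _ = _ := by
        rw [Finset.sum_const, Finset.card_range, nsmul_eq_mul]
        push_cast
        ring

end Tree

/-! ### Uniform labels -/

/-- The average of a function on a finite type. -/
noncomputable def average {A : Type} [Fintype A] (f : A → ENNReal) : ENNReal :=
  ∑ a, (Fintype.card A : ENNReal)⁻¹ * f a

section Average

variable {A A' : Type} [Fintype A] [Fintype A']

theorem average_mono {f f' : A → ENNReal} (h : ∀ a, f a ≤ f' a) : average f ≤ average f' :=
  Finset.sum_le_sum fun a _ => mul_le_mul_right (h a) _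

theorem average_add (f f' : A → ENNReal) :
    average (fun a => f a + f' a) = average f + average f' := by
  simp only [average, mul_add, Finset.sum_add_distrib]

theorem average_sum {ι : Type} (s : Finset ι) (f : ι → A → ENNReal) :
    average (fun a => ∑ i ∈ s, f i a) = ∑ i ∈ s, average (f i) := by
  simp only [average, Finset.mul_sum]
  exact Finset.sum_comm

theorem average_const [Nonempty A] (c : ENNReal) : average (fun _ : A => c) = c := by
  rw [average, Finset.sum_const, nsmul_eq_mul, ← mul_assoc, Finset.card_univ,
    ENNReal.mul_inv_cancel, one_mul]
  · simp
  · simp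

/-- Invariance of the uniform law on a product under bijections, the source of all independence
statements below. -/
theorem average_average_comp_equiv (φ : (A × A') ≃ (A × A')) (F : A × A' → ENNReal) :
    average (fun a => average fun a' => F (φ (a, a'))) =
      average fun a => average fun a' => F (a, a') := by
  simp only [average, Finset.mul_sum, ← mul_assoc]
  rw [← Fintype.sum_prod_type' (f := fun a a' => (Fintype.card A : ENNReal)⁻¹ *
      (Fintype.card A' : ENNReal)⁻¹ * F (φ (a, a'))),
    ← Fintype.sum_prod_type' (f := fun a a' => (Fintype.card A : ENNReal)⁻¹ *
      (Fintype.card A' : ENNReal)⁻¹ * F (a, a'))]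
  exact Equiv.sum_comp φ fun x => (Fintype.card A : ENNReal)⁻¹ *
    (Fintype.card A' : ENNReal)⁻¹ * F x

theorem uniform_bind_apply [Nonempty A] {γ : Type} (f : A → PMF γ) (z : γ) :
    ((PMF.uniformOfFintype A).bind f) z = average fun a => f a z := by
  rw [PMF.bind_apply, tsum_fintype]
  simp [average]

theorem uniform_bind_toOuterMeasure [Nonempty A] {γ : Type} (f : A → PMF γ) (s : Set γ) :
    ((PMF.uniformOfFintype A).bind f).toOuterMeasure s =
      average fun a => (f a).toOuterMeasure s := by
  rw [PMF.toOuterMeasure_bind_apply, tsum_fintype]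
  simp [average]

open Classical in
theorem average_indicator_le {P : A → Prop} {p : ℝ}
    (h : ((Finset.univ.filter P).card : ℝ) ≤ p * Fintype.card A) :
    average (fun a => if P a then 1 else 0) ≤ ENNReal.ofReal p := by
  rw [average, ← Finset.mul_sum, ← Finset.sum_filter, Finset.sum_const, nsmul_eq_mul, mul_one]
  rcases Nat.eq_zero_or_pos (Fintype.card A) with h0 | h0
  · have : Finset.univ.filter P = ∅ := by
      rw [← Finset.card_eq_zero]
      have := Finset.card_filter_le (Finset.univ : Finset A) P
      rw [Finset.card_univ] at this
      omega
    simp [this]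
  · have hA : (0 : ℝ) < Fintype.card A := by exact_mod_cast h0
    rw [mul_comm, ← div_eq_mul_inv]
    refine ENNReal.div_le_of_le_mul ?_
    rw [← ENNReal.ofReal_natCast, ← ENNReal.ofReal_natCast (Fintype.card A),
      ← ENNReal.ofReal_mul']
    · exact ENNReal.ofReal_le_ofReal h
    · exact hA.le

end Average

/-! ### Replacing labels by fresh ones. -/

section Override

variable {U Λ I : Type}

open Classical in
/-- Replaces the labels of the blocks `p i`, `i ∈ A`. -/
noncomputable def override (lam : U → Λ) (p : I → U) (A : Finset I) (ξ : I → Λ) : U → Λ :=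
  fun u => if h : ∃ i ∈ A, p i = u then ξ h.choose else lam u

theorem override_apply {p : I → U} (hp : Function.Injective p) (lam : U → Λ) {A : Finset I}
    (ξ : I → Λ) {i : I} (hi : i ∈ A) : override lam p A ξ (p i) = ξ i := by
  have h : ∃ j ∈ A, p j = p i := ⟨i, hi, rfl⟩
  rw [override, dif_pos h]
  exact congrArg ξ (hp h.choose_spec.2)

theorem override_of_notMem {p : I → U} (lam : U → Λ) {A : Finset I} (ξ : I → Λ) {u : U}
    (hu : ∀ i ∈ A, p i ≠ u) : override lam p A ξ u = lam u := by
  rw [override, dif_neg]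
  rintro ⟨i, hi, h⟩
  exact hu i hi h

open Classical in
/-- Exchanges the labels of the blocks `p i`, `i ∈ A`, with fresh ones. -/
noncomputable def exchange {p : I → U} (hp : Function.Injective p) (A : Finset I) :
    ((U → Λ) × (I → Λ)) ≃ ((U → Λ) × (I → Λ)) :=
  Function.Involutive.toPerm
    (fun x => (override x.1 p A x.2, fun i => if i ∈ A then x.1 (p i) else x.2 i)) <| by
  rintro ⟨lam, ξ⟩
  refine Prod.ext (funext fun u => ?_) (funext fun i => ?_)
  · by_cases h : ∃ i ∈ A, p i = u
    · obtain ⟨i, hi, rfl⟩ := h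
      simp only [override_apply hp _ _ hi, if_pos hi]
    · push Not at h
      simp only [override_of_notMem _ _ h]
  · by_cases h : i ∈ A
    · simp only [if_pos h, override_apply hp _ _ h]
    · simp only [if_neg h]

/-- The new labelling is the first component of the bijection `exchange`, hence uniform. It is
needed for arbitrary `A` since the stash must be controlled in the middle of an access. -/
theorem average_average_override [Fintype U] [DecidableEq U] [Fintype Λ] [Nonempty Λ] [Fintype I]
    [DecidableEq I] {p : I → U}
    (hp : Function.Injective p) (A : Finset I) (F : (U → Λ) → ENNReal) :
    average (fun lam => average fun ξ : I → Λ => F (override lam p A ξ)) = average F := by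
  have := average_average_comp_equiv (exchange (Λ := Λ) hp A) fun x => F x.1
  simp only [average_const] at this
  exact this

/-- Both components of the bijection together: the discarded labels are uniform and independent of
the labelling that remains. -/
theorem average_average_exchange [Fintype U] [DecidableEq U] [Fintype Λ] [Fintype I]
    [DecidableEq I] {p : I → U} (hp : Function.Injective p) (F : (U → Λ) → (I → Λ) → ENNReal) :
    average (fun lam => average fun ξ : I → Λ =>
        F (override lam p Finset.univ ξ) fun i => lam (p i)) =
      average fun lam => average fun ξ => F lam ξ := by
  have := average_average_comp_equiv (exchange (Λ := Λ) hp Finset.univ) fun x => F x.1 x.2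
  simpa [exchange] using this

end Override

/-! ### Simulators driven by uniform labels -/

/-- A description of a simulator in terms of uniform labels: an access reveals the labels of the
blocks on a path that depends on the logical address, and gives these blocks fresh labels.
`G` is the part of the state that is determined by the requests. -/
structure LabelModel {B N S : ℕ} (O : Simulator B N S) where
  U : Type
  Λ : Type
  I : Type
  St : Type
  G : Type
  Clock : Type
  [fintypeU : Fintype U]
  [decidableEqU : DecidableEq U]
  [fintypeΛ : Fintype Λ]
  [nonemptyΛ : Nonempty Λ]
  [fintypeI : Fintype I]
  [decidableEqI : DecidableEq I]
  Inv : G → St → Prop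
  lam : St → U → Λ
  permE : G → St → List Bool
  servE : St → Store S B
  db : St → Store N B
  path : Fin N → I → U
  path_inj : ∀ a, Function.Injective (path a)
  g₀ : G
  next : G → Request N B → G
  time : G → Clock
  tick : Clock → Clock
  init : Store N B → (U → Λ) → St
  addrs : Clock → (I → Λ) → List (Fin S)
  tempBits : ℕ
  permBits : ℕ → ℕ
  stages : ℕ
  -- An access passes through stages; before stage `k` exactly the labels in `changed k` have been
  -- renewed.
  changed : ℕ → Finset I
  -- Bad events depend on the labels and on data determined by the requests, so the uniform law of
  -- the labels bounds their probability.
  bad₀ : ℕ → (U → Λ) → Prop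
  bad : ℕ → G → Request N B → ℕ → (U → Λ) → Prop
  time_next : ∀ g r, time (next g r) = tick (time g)
  setup : ∀ D, O.setup D = (PMF.uniformOfFintype (U → Λ)).map fun l =>
    (permE g₀ (init D l), servE (init D l))
  inv_init : ∀ D l, Inv g₀ (init D l)
  lam_init : ∀ D l, lam (init D l) = l
  db_init : ∀ D l, db (init D l) = D
  bad_init : ∀ D l R, permBits R < (permE g₀ (init D l)).length → bad₀ R l
  access : ∀ g σ r, Inv g σ → ∃ (a : (I → Λ) → Access B S) (σ' : (I → Λ) → St),
    O.access (permE g σ) (servE σ) r = (PMF.uniformOfFintype (I → Λ)).map a ∧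
    ∀ ξ, Inv (next g r) (σ' ξ) ∧ (a ξ).perm = permE (next g r) (σ' ξ) ∧
      (a ξ).server = servE (σ' ξ) ∧ (a ξ).answer = some (db σ r.addr) ∧
      db (σ' ξ) = r.apply (db σ) ∧
      lam (σ' ξ) = override (lam σ) (path r.addr) Finset.univ ξ ∧
      (a ξ).addrs = addrs (time g) (fun i => lam σ (path r.addr i)) ∧
      (∀ m ∈ (a ξ).memories, m.temp.length ≤ tempBits) ∧
      (∀ m ∈ (a ξ).memories, ∀ R, permBits R < m.perm.length →
        ∃ k < stages, bad R g r k (override (lam σ) (path r.addr) (changed k) ξ))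

namespace LabelModel

attribute [instance] fintypeU decidableEqU fintypeΛ nonemptyΛ fintypeI decidableEqI

variable {B N S : ℕ} {O : Simulator B N S} (L : LabelModel O)

theorem answers {rs : List (Request N B)} {g : L.G} {σ : L.St} (h : L.Inv g σ)
    {as : List (Access B S)} (has : as ∈ (O.accesses rs (L.permE g σ) (L.servE σ)).support) :
    as.map Access.answer = (Simulator.rightAnswers (L.db σ) rs).map some := by
  induction rs generalizing g σ as with
  | nil =>
    simp only [Simulator.accesses, PMF.support_pure, Set.mem_singleton_iff] at has
    subst has; rfl
  | cons r rs ih =>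
    obtain ⟨a, σ', h1, h2⟩ := L.access g σ r h
    rw [Simulator.accesses, h1, PMF.mem_support_bind_iff] at has
    obtain ⟨x, hx, has⟩ := has
    obtain ⟨ξ, -, rfl⟩ := (PMF.mem_support_map_iff _ _ _).1 hx
    obtain ⟨as', has', rfl⟩ := (PMF.mem_support_map_iff _ _ _).1 has
    obtain ⟨i1, i2, i3, i4, i5, -⟩ := h2 ξ
    rw [i2, i3] at has'
    simp only [List.map_cons, Simulator.rightAnswers, i4, ih i1 has', i5]

theorem execution_eq (D : Store N B) (rs : List (Request N B)) :
    O.execution D rs = (PMF.uniformOfFintype (L.U → L.Λ)).bind fun l =>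
      (O.accesses rs (L.permE L.g₀ (L.init D l)) (L.servE (L.init D l))).map fun as =>
        (L.permE L.g₀ (L.init D l), as) := by
  rw [Simulator.execution, L.setup, PMF.bind_map]
  rfl

include L in
theorem correct : O.Correct := by
  intro D rs e he
  rw [L.execution_eq, PMF.mem_support_bind_iff] at he
  obtain ⟨l, -, he⟩ := he
  obtain ⟨as, has, rfl⟩ := (PMF.mem_support_map_iff _ _ _).1 he
  rw [L.answers (L.inv_init D l) has, L.db_init]

theorem accesses_bounds {rs : List (Request N B)} {g : L.G} {σ : L.St} (h : L.Inv g σ)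
    {as : List (Access B S)} (has : as ∈ (O.accesses rs (L.permE g σ) (L.servE σ)).support) :
    ∀ a ∈ as, (∃ t ρ, a.addrs = L.addrs t ρ) ∧ ∀ m ∈ a.memories, m.temp.length ≤ L.tempBits := by
  induction rs generalizing g σ as with
  | nil =>
    simp only [Simulator.accesses, PMF.support_pure, Set.mem_singleton_iff] at has
    subst has; simp
  | cons r rs ih =>
    obtain ⟨a, σ', h1, h2⟩ := L.access g σ r h
    rw [Simulator.accesses, h1, PMF.mem_support_bind_iff] at has
    obtain ⟨x, hx, has⟩ := has
    obtain ⟨ξ, -, rfl⟩ := (PMF.mem_support_map_iff _ _ _).1 hx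
    obtain ⟨as', has', rfl⟩ := (PMF.mem_support_map_iff _ _ _).1 has
    obtain ⟨i1, i2, i3, -, -, -, i7, i8, -⟩ := h2 ξ
    rw [i2, i3] at has'
    intro y hy
    rcases List.mem_cons.1 hy with rfl | hy
    · exact ⟨⟨_, _, i7⟩, i8⟩
    · exact ih i1 has' y hy

theorem execution_bounds {D : Store N B} {rs : List (Request N B)}
    {e : List Bool × List (Access B S)} (he : e ∈ (O.execution D rs).support) :
    ∀ a ∈ e.2, (∃ t ρ, a.addrs = L.addrs t ρ) ∧
      ∀ m ∈ a.memories, m.temp.length ≤ L.tempBits := by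
  rw [L.execution_eq, PMF.mem_support_bind_iff] at he
  obtain ⟨l, -, he⟩ := he
  obtain ⟨as, has, rfl⟩ := (PMF.mem_support_map_iff _ _ _).1 he
  exact L.accesses_bounds (L.inv_init D l) has

/-- The physical addresses, from the labels of the blocks. -/
noncomputable def revealed : List (Request N B) → L.Clock → (L.U → L.Λ) → PMF (List (List (Fin S)))
  | [], _, _ => PMF.pure []
  | r :: rs, t, l => (PMF.uniformOfFintype (L.I → L.Λ)).bind fun ξ =>
      (revealed rs (L.tick t) (override l (L.path r.addr) Finset.univ ξ)).map
        (L.addrs t (fun i => l (L.path r.addr i)) :: ·)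

/-- The physical addresses if all labels are fresh. -/
noncomputable def fresh : ℕ → L.Clock → PMF (List (List (Fin S)))
  | 0, _ => PMF.pure []
  | n + 1, t => (PMF.uniformOfFintype (L.I → L.Λ)).bind fun ξ =>
      (fresh n (L.tick t)).map (L.addrs t ξ :: ·)

theorem map_addrs_accesses (rs : List (Request N B)) {g : L.G} {σ : L.St} (h : L.Inv g σ) :
    (O.accesses rs (L.permE g σ) (L.servE σ)).map (List.map Access.addrs) =
      L.revealed rs (L.time g) (L.lam σ) := by
  induction rs generalizing g σ with
  | nil => simp [Simulator.accesses, revealed, PMF.pure_map]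
  | cons r rs ih =>
    obtain ⟨a, σ', h1, h2⟩ := L.access g σ r h
    rw [Simulator.accesses, h1, PMF.map_bind, PMF.bind_map, revealed]
    congr 1
    funext ξ
    obtain ⟨i1, i2, i3, -, -, i6, i7, -⟩ := h2 ξ
    rw [Function.comp, i2, i3, PMF.map_comp, ← i6, ← L.time_next g r, ← ih i1, PMF.map_comp]
    congr 1
    funext as
    simp [i7]

/-- By the exchange, the revealed labels may be taken as fresh coins while the labelling stays
uniform and independent of them; thus the logical addresses disappear. -/
theorem uniform_bind_revealed (rs : List (Request N B)) (t : L.Clock) :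
    (PMF.uniformOfFintype (L.U → L.Λ)).bind (L.revealed rs t) = L.fresh rs.length t := by
  induction rs generalizing t with
  | nil => simp [revealed, fresh, PMF.bind_const]
  | cons r rs ih =>
    ext z
    rw [uniform_bind_apply, List.length_cons, fresh, uniform_bind_apply]
    simp only [revealed, uniform_bind_apply]
    have := average_average_exchange (Λ := L.Λ) (L.path_inj r.addr) fun l ξ =>
      ((L.revealed rs (L.tick t) l).map (L.addrs t ξ :: ·)) z
    rw [this]
    have comm : ∀ F : (L.U → L.Λ) → (L.I → L.Λ) → ENNReal,
        (average fun l => average fun ξ => F l ξ) = average fun ξ => average fun l => F l ξ := by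
      intro F
      simp only [average, Finset.mul_sum]
      rw [Finset.sum_comm]
      refine Finset.sum_congr rfl fun _ _ => Finset.sum_congr rfl fun _ _ => ?_
      ring
    rw [comm]
    congr 1
    funext ξ
    rw [← uniform_bind_apply, ← PMF.map_bind, ih]

include L in
theorem secure : O.Secure := by
  have key : ∀ D rs, (O.execution D rs).map (fun e => e.2.map Access.addrs) =
      L.fresh rs.length (L.time L.g₀) := by
    intro D rs
    rw [L.execution_eq, PMF.map_bind, ← uniform_bind_revealed]
    congr 1
    funext l
    rw [PMF.map_comp]
    have := L.map_addrs_accesses rs (L.inv_init D l)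
    rw [L.lam_init] at this
    exact this
  intro D D' rs rs' h
  rw [key, key, h]

open Classical in
/-- A bound for the probability of an overflow, from the labels of the blocks. -/
noncomputable def risk (R : ℕ) : List (Request N B) → L.G → (L.U → L.Λ) → ENNReal
  | [], _, _ => 0
  | r :: rs, g, l => average fun ξ : L.I → L.Λ =>
      ∑ k ∈ Finset.range L.stages,
        (if L.bad R g r k (override l (L.path r.addr) (L.changed k) ξ) then 1 else 0) +
      risk R rs (L.next g r) (override l (L.path r.addr) Finset.univ ξ)

/-- If a stage of the first access is bad, the bound is already at least `1`; otherwise an overflow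
can only come from later accesses. -/
theorem toOuterMeasure_accesses_le (R : ℕ) (rs : List (Request N B)) {g : L.G} {σ : L.St}
    (h : L.Inv g σ) :
    (O.accesses rs (L.permE g σ) (L.servE σ)).toOuterMeasure
      {as | ∃ a ∈ as, ∃ m ∈ a.memories, L.permBits R < m.perm.length} ≤
        L.risk R rs g (L.lam σ) := by
  classical
  induction rs generalizing g σ with
  | nil =>
    rw [Simulator.accesses, PMF.toOuterMeasure_pure_apply, if_neg (by simp)]
    exact zero_le
  | cons r rs ih =>
    obtain ⟨a, σ', h1, h2⟩ := L.access g σ r h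
    rw [Simulator.accesses, h1, PMF.bind_map, uniform_bind_toOuterMeasure, risk]
    refine average_mono fun ξ => ?_
    obtain ⟨i1, i2, i3, -, -, i6, -, -, i9⟩ := h2 ξ
    rw [Function.comp, i2, i3, PMF.toOuterMeasure_map_apply, ← i6]
    by_cases hb : ∃ k < L.stages, L.bad R g r k (override (L.lam σ) (L.path r.addr) (L.changed k) ξ)
    · obtain ⟨k, hk, hb⟩ := hb
      refine le_add_right (le_trans ?_ (Finset.single_le_sum (fun _ _ => zero_le)
        (Finset.mem_range.2 hk)))
      rw [if_pos hb]
      exact (MeasureTheory.measure_mono (Set.subset_univ _)).trans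
        ((PMF.toOuterMeasure_apply _ _).trans_le (by simp [PMF.tsum_coe]))
    · refine le_add_left (le_trans ((PMF.toOuterMeasure _).mono ?_) (ih i1))
      rintro as ⟨y, hy, m, hm, hR⟩
      rcases List.mem_cons.1 hy with rfl | hy
      · exact absurd (i9 m hm R hR) hb
      · exact ⟨y, hy, m, hm, hR⟩

open Classical in
-- For fixed requests the labelling is uniform at every stage, so each stage contributes at most
-- `p`, without conditioning on the past.
theorem average_risk_le (R : ℕ) (p : ENNReal) (Valid : L.G → Prop)
    (hnext : ∀ g r, Valid g → Valid (L.next g r))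
    (hbad : ∀ g r k, Valid g → average (fun l => if L.bad R g r k l then 1 else 0) ≤ p)
    (rs : List (Request N B)) (g : L.G) (hg : Valid g) :
    average (L.risk R rs g) ≤ rs.length * (L.stages * p) := by
  induction rs generalizing g with
  | nil =>
    have : L.risk R [] g = fun _ => 0 := by funext; rfl
    rw [this, average_const]
    exact zero_le
  | cons r rs ih =>
    have e1 : average (L.risk R (r :: rs) g) =
        ∑ k ∈ Finset.range L.stages,
          average (fun l => if L.bad R g r k l then (1 : ENNReal) else 0) +
        average (L.risk R rs (L.next g r)) := by
      simp only [risk, average_add, average_sum]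
      congr 1
      · refine Finset.sum_congr rfl fun k _ => ?_
        exact average_average_override (L.path_inj r.addr) (L.changed k)
          fun l => if L.bad R g r k l then (1 : ENNReal) else 0
      · exact average_average_override (L.path_inj r.addr) Finset.univ
          (L.risk R rs (L.next g r))
    rw [e1]
    calc _ ≤ ∑ k ∈ Finset.range L.stages, p + rs.length * (L.stages * p) :=
          add_le_add (Finset.sum_le_sum fun k _ => hbad g r k hg) (ih _ (hnext g r hg))
      _ = _ := by
          rw [Finset.sum_const, Finset.card_range, nsmul_eq_mul, List.length_cons]
          push_cast
          ring

open Classical in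
theorem toOuterMeasure_execution_le (R : ℕ) (p : ENNReal) (Valid : L.G → Prop)
    (hg : Valid L.g₀) (hnext : ∀ g r, Valid g → Valid (L.next g r))
    (hbad₀ : average (fun l => if L.bad₀ R l then 1 else 0) ≤ p)
    (hbad : ∀ g r k, Valid g → average (fun l => if L.bad R g r k l then 1 else 0) ≤ p)
    (D : Store N B) (rs : List (Request N B)) :
    (O.execution D rs).toOuterMeasure
      {e | L.permBits R < e.1.length ∨
        ∃ a ∈ e.2, ∃ m ∈ a.memories, L.permBits R < m.perm.length} ≤
      p + rs.length * (L.stages * p) := by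
  rw [L.execution_eq, uniform_bind_toOuterMeasure]
  calc _ ≤ average (fun l => (if L.bad₀ R l then (1 : ENNReal) else 0) + L.risk R rs L.g₀ l) := by
        refine average_mono fun l => ?_
        rw [PMF.toOuterMeasure_map_apply]
        by_cases hb : L.bad₀ R l
        · rw [if_pos hb]
          refine le_add_right ?_
          exact (MeasureTheory.measure_mono (Set.subset_univ _)).trans
            ((PMF.toOuterMeasure_apply _ _).trans_le (by simp [PMF.tsum_coe]))
        · refine le_add_left ?_
          have := L.toOuterMeasure_accesses_le R rs (L.inv_init D l)
          rw [L.lam_init] at this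
          refine le_trans ((PMF.toOuterMeasure _).mono ?_) this
          rintro as (h | h)
          · exact absurd (L.bad_init D l R h) hb
          · exact h
    _ ≤ _ := by
        rw [average_add]
        exact add_le_add hbad₀ (L.average_risk_le R p Valid hnext hbad rs L.g₀ hg)

end LabelModel

/-! ### The blocks of the database and of the position map -/

/-- The blocks: those at height `0` are the blocks of the database, and those at height `i + 1`
hold the labels of those at height `i`, `β` of them per block. -/
def TrieBlock (N β h : ℕ) : Type :=
  {p : Fin (h + 1) × Fin N // p.2.val * β ^ p.1.val < N}

namespace TrieBlock

variable {N β h : ℕ}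

instance : Fintype (TrieBlock N β h) := by unfold TrieBlock; infer_instance

instance : DecidableEq (TrieBlock N β h) := by unfold TrieBlock; infer_instance

/-- The height of a block. -/
def height (u : TrieBlock N β h) : ℕ := u.1.1

/-- The number of a block among those of the same height. -/
def index (u : TrieBlock N β h) : ℕ := u.1.2

theorem height_le (u : TrieBlock N β h) : u.height ≤ h := Nat.lt_succ_iff.1 u.1.1.2

theorem index_mul_lt (u : TrieBlock N β h) : u.index * β ^ u.height < N := u.2

theorem ext' {u w : TrieBlock N β h} (h1 : u.height = w.height) (h2 : u.index = w.index) :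
    u = w := Subtype.ext (Prod.ext (Fin.ext h1) (Fin.ext h2))

/-- The tree in which a block is stored: `true` for the blocks of the database, `false` for those
of the position map. -/
def tree (u : TrieBlock N β h) : Bool := decide (u.height = 0)

/-- The block at height `i` above a block of the database. -/
def path (β h : ℕ) (a : Fin N) (i : Fin (h + 1)) : TrieBlock N β h :=
  ⟨(i, ⟨a / β ^ i.val, (Nat.div_le_self _ _).trans_lt a.2⟩), (Nat.div_mul_le_self _ _).trans_lt a.2⟩

@[simp] theorem height_path (a : Fin N) (i : Fin (h + 1)) : (path β h a i).height = i := rfl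

@[simp] theorem index_path (a : Fin N) (i : Fin (h + 1)) : (path β h a i).index = a / β ^ i.val :=
  rfl

theorem path_injective (a : Fin N) : Function.Injective (path β h a) := fun i j hij => by
  have := congrArg height hij
  exact Fin.ext this

/-- Since `N ≤ β ^ h` there is just one block at height `h`; the user needs to keep only its label.
-/
theorem path_last (hN : N ≤ β ^ h) (a a' : Fin N) :
    path β h a (Fin.last h) = path β h a' (Fin.last h) := by
  refine ext' rfl ?_
  simp only [index_path, Fin.val_last]
  rw [Nat.div_eq_of_lt (a.2.trans_le hN), Nat.div_eq_of_lt (a'.2.trans_le hN)]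

theorem eq_path_last (hN : N ≤ β ^ h) (a : Fin N) {u : TrieBlock N β h} (hu : h ≤ u.height) :
    u = path β h a (Fin.last h) := by
  have h1 : u.height = h := le_antisymm u.height_le hu
  refine ext' (by simpa using h1) ?_
  have h2 := u.index_mul_lt
  rw [h1] at h2
  have h3 : u.index = 0 := by
    by_contra h0
    have : 1 * β ^ h ≤ u.index * β ^ h := Nat.mul_le_mul_right _ (Nat.one_le_iff_ne_zero.2 h0)
    omega
  rw [h3, index_path, Fin.val_last, Nat.div_eq_of_lt (a.2.trans_le hN)]

theorem path_zero_injective : Function.Injective fun a : Fin N => path β h a 0 := fun a a' haa => by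
  have := congrArg index haa
  simpa [Fin.ext_iff] using this

/-- The place of the label of a block in the block above it. -/
def slot (u : TrieBlock N β h) : ℕ := u.index % β

/-- `w` is the block above `u`. -/
def IsParent (w u : TrieBlock N β h) : Prop := w.height = u.height + 1 ∧ w.index = u.index / β

theorem isParent_path (a : Fin N) {i j : Fin (h + 1)} (hij : j.val = i.val + 1) :
    IsParent (path β h a j) (path β h a i) := by
  refine ⟨by simpa using hij, ?_⟩
  rw [index_path, index_path, hij, pow_succ, Nat.div_div_eq_div_mul]

theorem IsParent.unique {w w' u : TrieBlock N β h} (h1 : IsParent w u) (h2 : IsParent w' u) :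
    w = w' := ext' (h1.1.trans h2.1.symm) (h1.2.trans h2.2.symm)

/-- Parent and slot are the quotient and the remainder of the index modulo `β`. -/
theorem IsParent.child_unique {w u u' : TrieBlock N β h} (h1 : IsParent w u)
    (h2 : IsParent w u') (h3 : u.slot = u'.slot) : u = u' := by
  refine ext' ?_ ?_
  · have := h1.1.symm.trans h2.1
    omega
  · have h4 := h1.2.symm.trans h2.2
    rw [← Nat.div_add_mod u.index β, ← Nat.div_add_mod u'.index β, h4]
    unfold slot at h3
    rw [h3]

theorem slot_lt (hβ : 0 < β) (u : TrieBlock N β h) : u.slot < β := Nat.mod_lt _ hβ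

end TrieBlock

/-- A block with its number and its label, as it is stored. -/
abbrev Entry (B N l β h : ℕ) : Type := TrieBlock N β h × Fin (2 ^ l) × Block B

/-! ### The scheme -/

/-- The parameters and the encodings of a scheme for a database of `N` blocks on a server of `S`
blocks. Labels have `l` bits, `D b` is the depth of tree `b`, the leaves of the data tree hold `K`
blocks and the other nodes `5` blocks, `ncell b d` cells are used for a node of tree `b` at level
`d`, `get` and `put` give the labels in a block, `addr` is the address of a cell of a node, and
`enc` and `dec` are the encoding of the contents of nodes. -/
structure Scheme (B N S : ℕ) where
  l : ℕ
  h : ℕ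
  β : ℕ
  K : ℕ
  D : Bool → ℕ
  ncell : Bool → ℕ → ℕ
  N_pos : 0 < N
  β_pos : 0 < β
  le_pow : N ≤ β ^ h
  D_pos : ∀ b, 0 < D b
  D_le : ∀ b, D b ≤ l
  ncell_pos : ∀ b d, 0 < ncell b d
  get : Block B → ℕ → Fin (2 ^ l)
  put : (ℕ → Fin (2 ^ l)) → Block B
  get_put : ∀ f, ∀ s < β, get (put f) s = f s
  addr : (Σ _ : Bool, Σ _ : ℕ, ℕ × ℕ) → Fin S
  addr_inj : Set.InjOn addr ((Finset.univ : Finset Bool).sigma fun b =>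
    (Finset.Icc 1 (D b)).sigma fun d => Finset.range (2 ^ d) ×ˢ Finset.range (ncell b d))
  enc : Bool → ℕ → Finset (Entry B N l β h) → ℕ → Block B
  dec : Bool → ℕ → (ℕ → Block B) → Finset (Entry B N l β h)
  dec_enc : ∀ (b : Bool) (d : ℕ) (E : Finset (Entry B N l β h)) (v : ℕ → Block B),
    E.card ≤ (if b = true ∧ d = D true then K else 5) →
    (∀ c < ncell b d, v c = enc b d E c) → dec b d v = E

namespace Scheme

open TrieBlock

variable {B N S : ℕ} (Q : Scheme B N S)

/-- The capacity of a node. -/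
def cap (b : Bool) (d : ℕ) : ℕ := if b = true ∧ d = Q.D true then Q.K else 5

/-- The labels. -/
abbrev Lab : Type := Fin (2 ^ Q.l)

/-- The blocks. -/
abbrev U : Type := TrieBlock N Q.β Q.h

/-- The stored blocks. -/
abbrev Ent : Type := Entry B N Q.l Q.β Q.h

/-- The labels, the contents and the levels of the blocks. -/
structure State where
  lam : Q.U → Q.Lab
  val : Q.U → Block B
  lev : Q.U → ℕ

variable {Q}

/-- A block as it is stored. -/
def State.entry (σ : Q.State) (u : Q.U) : Q.Ent := (u, σ.lam u, σ.val u)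

theorem State.entry_injective (σ : Q.State) : Function.Injective σ.entry := fun _ _ h =>
  congrArg Prod.fst h

/-- The labels as numbers. -/
def State.labels (σ : Q.State) (u : Q.U) : ℕ := (σ.lam u).val

/-- The content of a node. -/
def State.node (σ : Q.State) (b : Bool) (d r : ℕ) : Finset Q.Ent :=
  (located tree σ.labels σ.lev b d r).image σ.entry

/-- The content of the stash. -/
def State.stash (σ : Q.State) : Finset Q.Ent :=
  (Finset.univ.filter fun u => σ.lev u = 0).image σ.entry

variable (Q)

open Classical in
/-- A server with given contents of nodes. -/
noncomputable def store (E : Bool → ℕ → ℕ → Finset Q.Ent) : Store S B := fun a =>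
  if h : ∃ x ∈ (Finset.univ : Finset Bool).sigma fun b =>
      (Finset.Icc 1 (Q.D b)).sigma fun d => Finset.range (2 ^ d) ×ˢ Finset.range (Q.ncell b d),
      Q.addr x = a
  then Q.enc h.choose.1 h.choose.2.1 (E h.choose.1 h.choose.2.1 h.choose.2.2.1) h.choose.2.2.2
  else fun _ => false

theorem store_addr (E : Bool → ℕ → ℕ → Finset Q.Ent) {b : Bool} {d r c : ℕ} (hd : 1 ≤ d)
    (hdD : d ≤ Q.D b) (hr : r < 2 ^ d) (hc : c < Q.ncell b d) :
    Q.store E (Q.addr ⟨b, d, (r, c)⟩) = Q.enc b d (E b d r) c := by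
  have hx : (⟨b, d, (r, c)⟩ : Σ _ : Bool, Σ _ : ℕ, ℕ × ℕ) ∈ (Finset.univ : Finset Bool).sigma
      fun b => (Finset.Icc 1 (Q.D b)).sigma fun d =>
        Finset.range (2 ^ d) ×ˢ Finset.range (Q.ncell b d) := by
    simp [hd, hdD, hr, hc]
  have h : ∃ x ∈ (Finset.univ : Finset Bool).sigma fun b =>
      (Finset.Icc 1 (Q.D b)).sigma fun d => Finset.range (2 ^ d) ×ˢ Finset.range (Q.ncell b d),
      Q.addr x = Q.addr ⟨b, d, (r, c)⟩ := ⟨_, hx, rfl⟩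
  have h2 : h.choose = ⟨b, d, (r, c)⟩ := Q.addr_inj h.choose_spec.1 hx h.choose_spec.2
  rw [store, dif_pos h, h2]

/-- The cells of the nodes on a path. -/
noncomputable def pathCells (b : Bool) (P : ℕ) : List (Fin S) :=
  (((Finset.Icc 1 (Q.D b)).sigma fun d => Finset.range (Q.ncell b d)).toList).map fun x =>
    Q.addr ⟨b, x.1, (P % 2 ^ x.1, x.2)⟩

theorem mem_pathCells {b : Bool} {P : ℕ} {a : Fin S} : a ∈ Q.pathCells b P ↔
    ∃ d c, (1 ≤ d ∧ d ≤ Q.D b) ∧ c < Q.ncell b d ∧ Q.addr ⟨b, d, (P % 2 ^ d, c)⟩ = a := by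
  simp only [pathCells, List.mem_map, Finset.mem_toList, Finset.mem_sigma, Finset.mem_Icc,
    Finset.mem_range, Sigma.exists, and_assoc]

theorem length_pathCells (b : Bool) (P : ℕ) :
    (Q.pathCells b P).length = ∑ d ∈ Finset.Icc 1 (Q.D b), Q.ncell b d := by
  simp [pathCells]

theorem pathCells_ne_nil (b : Bool) (P : ℕ) : Q.pathCells b P ≠ [] := by
  have := (Q.mem_pathCells (b := b) (P := P)).2
    ⟨1, 0, ⟨le_rfl, Q.D_pos b⟩, Q.ncell_pos b 1, rfl⟩
  exact List.ne_nil_of_mem this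

/-- The contents of the nodes on a path, from the contents of their cells. -/
def readPath (view : Store S B) (b : Bool) (P : ℕ) : Finset Q.Ent :=
  (Finset.Icc 1 (Q.D b)).biUnion fun d =>
    Q.dec b d fun c => view (Q.addr ⟨b, d, (P % 2 ^ d, c)⟩)

/-- The new levels of the blocks on a path. -/
noncomputable def placement (E : Finset Q.Ent) (b : Bool) (P : ℕ) : Q.Ent → ℕ :=
  (exists_isGreedy E (fun e => commonDepth (Q.D b) e.2.1.val P) (fun e d => e.2.1.val % 2 ^ d)
    fun d _ => Q.cap b d).choose

theorem placement_spec (E : Finset Q.Ent) (b : Bool) (P : ℕ) :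
    IsGreedy E (fun e => commonDepth (Q.D b) e.2.1.val P) (fun e d => e.2.1.val % 2 ^ d)
      (fun d _ => Q.cap b d) (Q.placement E b P) :=
  (exists_isGreedy E (fun e => commonDepth (Q.D b) e.2.1.val P) (fun e d => e.2.1.val % 2 ^ d)
    fun d _ => Q.cap b d).choose_spec

end Scheme

/-- The algorithm packs stored entries, whereas the invariant speaks of blocks. -/
theorem IsGreedy.of_image {α α' ν : Type} [DecidableEq ν] [DecidableEq α] {V : Finset α'}
    {f : α' → α} (hf : Function.Injective f) {t : α → ℕ} {key : α → ℕ → ν} {cap : ℕ → ν → ℕ}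
    {loc : α → ℕ} (h : IsGreedy (V.image f) t key cap loc) :
    IsGreedy V (fun x => t (f x)) (fun x => key (f x)) cap fun x => loc (f x) := by
  have hc : ∀ d v, ((V.image f).filter fun e => loc e = d ∧ key e d = v).card =
      (V.filter fun x => loc (f x) = d ∧ key (f x) d = v).card := by
    intro d v
    rw [Finset.filter_image, Finset.card_image_of_injective _ hf]
  refine ⟨fun x hx => h.le _ (Finset.mem_image_of_mem f hx), fun d v hd => ?_,
    fun x hx d h1 h2 => ?_⟩
  · rw [← hc]; exact h.card_le d v hd
  · rw [← hc]; exact h.full _ (Finset.mem_image_of_mem f hx) d h1 h2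

/-! ### Repacking and relabelling: their effect on nodes, stash and server. -/

namespace Scheme

open TrieBlock

variable {B N S : ℕ} {Q : Scheme B N S}

namespace State

/-- The blocks on a path, including the stash, as they are stored. -/
def onPath (σ : Q.State) (b : Bool) (P : ℕ) : Finset Q.Ent :=
  (visible tree σ.labels σ.lev b P).image σ.entry

/-- Blocks are moved as deep as possible on a path. -/
noncomputable def repack (σ : Q.State) (b : Bool) (P : ℕ) : Q.State where
  lam := σ.lam
  val := σ.val
  lev u := if u ∈ visible tree σ.labels σ.lev b P
    then Q.placement (σ.onPath b P) b P (σ.entry u) else σ.lev u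

variable (σ : Q.State) (b : Bool) (P : ℕ)

theorem mem_visible {u : Q.U} : u ∈ visible tree σ.labels σ.lev b P ↔
    tree u = b ∧ σ.labels u % 2 ^ σ.lev u = P % 2 ^ σ.lev u := by simp [visible]

theorem placement_spec :
    IsGreedy (visible tree σ.labels σ.lev b P)
      (fun u => commonDepth (Q.D b) (σ.labels u) P) (fun u d => σ.labels u % 2 ^ d)
      (fun d _ => Q.cap b d) fun u => Q.placement (σ.onPath b P) b P (σ.entry u) :=
  (Q.placement_spec (σ.onPath b P) b P).of_image σ.entry_injective

theorem placed_repack {lst : Q.U → ℕ} {cnt : Bool → ℕ}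
    (hle : ∀ u, σ.lev u ≤ Q.D (tree u))
    (hcard : ∀ b d r, 1 ≤ d → (located tree σ.labels σ.lev b d r).card ≤ Q.cap b d)
    (hfull : ∀ u d, σ.lev u < d → d ≤ Q.D (tree u) → Evicted tree σ.labels lst cnt u d →
      ¬ (tree u = b ∧ σ.labels u % 2 ^ d = P % 2 ^ d) →
      Q.cap (tree u) d ≤ (located tree σ.labels σ.lev (tree u) d (σ.labels u % 2 ^ d)).card) :
    Placed tree Q.D Q.cap (σ.repack b P).labels (σ.repack b P).lev lst cnt :=
  Placed.repack hle hcard hfull (σ.placement_spec b P)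
    (fun u hu => by simp only [repack, if_pos hu]) (fun u hu => by simp only [repack, if_neg hu])

theorem mod_lev_repack {u : Q.U} (hu : u ∈ visible tree σ.labels σ.lev b P) :
    σ.labels u % 2 ^ (σ.repack b P).lev u = P % 2 ^ (σ.repack b P).lev u := by
  simp only [repack, if_pos hu]
  exact mod_pow_eq_of_le (mod_commonDepth (Q.D b) (σ.labels u) P)
    ((σ.placement_spec b P).le u hu)

theorem node_repack_on (d : ℕ) : (σ.repack b P).node b d (P % 2 ^ d) =
    (σ.onPath b P).filter fun e => Q.placement (σ.onPath b P) b P e = d := by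
  rw [onPath, Finset.filter_image]
  refine congrArg (Finset.image σ.entry) ?_
  ext u
  simp only [located, Finset.mem_filter, Finset.mem_univ, true_and]
  constructor
  · rintro ⟨h1, h2, h3⟩
    have h3' : σ.labels u % 2 ^ d = P % 2 ^ d := h3
    have hu : u ∈ visible tree σ.labels σ.lev b P := by
      by_contra hu
      simp only [repack, if_neg hu] at h2
      exact hu ((σ.mem_visible b P).2 ⟨h1, by rw [h2, h3']⟩)
    simp only [repack, if_pos hu] at h2
    exact ⟨hu, h2⟩
  · rintro ⟨hu, h2⟩
    have h3 := σ.mod_lev_repack b P hu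
    have h4 : (σ.repack b P).lev u = d := by simp only [repack, if_pos hu]; exact h2
    exact ⟨((σ.mem_visible b P).1 hu).1, h4, by rw [h4] at h3; exact h3⟩

theorem node_repack_off {b' : Bool} {d r : ℕ} (hoff : ¬ (b' = b ∧ r = P % 2 ^ d)) :
    (σ.repack b P).node b' d r = σ.node b' d r := by
  refine congrArg (Finset.image σ.entry) ?_
  ext u
  simp only [located, Finset.mem_filter, Finset.mem_univ, true_and]
  by_cases hu : u ∈ visible tree σ.labels σ.lev b P
  · obtain ⟨h1, h2⟩ := (σ.mem_visible b P).1 hu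
    have h3 := σ.mod_lev_repack b P hu
    constructor
    · rintro ⟨h4, h5, h6⟩
      rw [h5] at h3
      exact absurd ⟨by rw [← h4, h1], by rw [← h6]; exact h3⟩ hoff
    · rintro ⟨h4, h5, h6⟩
      rw [h5] at h2
      exact absurd ⟨by rw [← h4, h1], by rw [← h6]; exact h2⟩ hoff
  · simp only [repack, if_neg hu]
    rfl

theorem stash_repack : (σ.repack b P).stash =
    σ.stash.filter (fun e => tree e.1 ≠ b) ∪
      (σ.onPath b P).filter fun e => Q.placement (σ.onPath b P) b P e = 0 := by
  ext e
  rw [Finset.mem_union, Finset.mem_filter, Finset.mem_filter]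
  constructor
  · intro he
    obtain ⟨u, hu, rfl⟩ := Finset.mem_image.1 he
    have h0 := (Finset.mem_filter.1 hu).2
    by_cases hv : u ∈ visible tree σ.labels σ.lev b P
    · simp only [repack, if_pos hv] at h0
      exact Or.inr ⟨Finset.mem_image_of_mem _ hv, h0⟩
    · simp only [repack, if_neg hv] at h0
      refine Or.inl ⟨Finset.mem_image_of_mem _ (Finset.mem_filter.2 ⟨Finset.mem_univ _, h0⟩),
        fun h1 => hv ((σ.mem_visible b P).2 ⟨h1, ?_⟩)⟩
      simp [h0, Nat.mod_one]
  · rintro (⟨he, h1⟩ | ⟨he, h1⟩)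
    · obtain ⟨u, hu, rfl⟩ := Finset.mem_image.1 he
      have h0 := (Finset.mem_filter.1 hu).2
      have hv : u ∉ visible tree σ.labels σ.lev b P := fun hv =>
        h1 ((σ.mem_visible b P).1 hv).1
      refine Finset.mem_image.2 ⟨u, Finset.mem_filter.2 ⟨Finset.mem_univ _, ?_⟩, rfl⟩
      simp only [repack, if_neg hv, h0]
    · obtain ⟨u, hv, rfl⟩ := Finset.mem_image.1 he
      refine Finset.mem_image.2 ⟨u, Finset.mem_filter.2 ⟨Finset.mem_univ _, ?_⟩, rfl⟩
      simp only [repack, if_pos hv, h1]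

theorem onPath_eq (hle : ∀ u, σ.lev u ≤ Q.D (tree u)) : σ.onPath b P =
    σ.stash.filter (fun e => tree e.1 = b) ∪
      (Finset.Icc 1 (Q.D b)).biUnion fun d => σ.node b d (P % 2 ^ d) := by
  ext e
  simp only [onPath, stash, node, Finset.mem_union, Finset.mem_filter, Finset.mem_biUnion,
    Finset.mem_image, Finset.mem_Icc, mem_visible, located, Finset.mem_univ, true_and]
  constructor
  · rintro ⟨u, ⟨h1, h2⟩, rfl⟩
    rcases Nat.eq_zero_or_pos (σ.lev u) with h0 | h0
    · exact Or.inl ⟨⟨u, h0, rfl⟩, h1⟩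
    · exact Or.inr ⟨σ.lev u, ⟨h0, by rw [← h1]; exact hle u⟩, u, ⟨h1, rfl, h2⟩, rfl⟩
  · rintro (⟨⟨u, h0, rfl⟩, h1⟩ | ⟨d, _, u, ⟨h1, h2, h3⟩, rfl⟩)
    · exact ⟨u, ⟨h1, by simp [h0, Nat.mod_one]⟩, rfl⟩
    · exact ⟨u, ⟨h1, by rw [h2, h3]⟩, rfl⟩

/-- Nodes within their capacities decode correctly, so stash and server together reveal exactly the
blocks on the path. -/
theorem readPath_store (hle : ∀ u, σ.lev u ≤ Q.D (tree u))
    (hcard : ∀ b d r, 1 ≤ d → (located tree σ.labels σ.lev b d r).card ≤ Q.cap b d)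
    {view : Store S B} (hview : ∀ a ∈ Q.pathCells b P, view a = Q.store σ.node a) :
    σ.stash.filter (fun e => tree e.1 = b) ∪ Q.readPath view b P = σ.onPath b P := by
  rw [onPath_eq σ b P hle]
  congr 1
  refine Finset.biUnion_congr rfl fun d hd => ?_
  rw [Finset.mem_Icc] at hd
  refine Q.dec_enc b d _ _ (Finset.card_image_le.trans (hcard b d _ hd.1)) fun c hc => ?_
  rw [hview _ (Q.mem_pathCells.2 ⟨d, c, hd, hc, rfl⟩),
    Q.store_addr _ hd.1 hd.2 (Nat.mod_lt _ (by positivity)) hc]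

open Classical in
-- The server still represents `σ₀` when the path is rewritten. An accessed block has meanwhile left
-- its node, but this node is on the path, so agreement off the path suffices.
theorem store_repack {s : Store S B} {σ₀ : Q.State} (hs : s = Q.store σ₀.node)
    (hoff : ∀ b' d r, 1 ≤ d → ¬ (b' = b ∧ r = P % 2 ^ d) → σ.node b' d r = σ₀.node b' d r) :
    (fun a => if a ∈ Q.pathCells b P then
      Q.store (fun _ d _ => (σ.onPath b P).filter fun e =>
        Q.placement (σ.onPath b P) b P e = d) a else s a) = Q.store (σ.repack b P).node := by
  subst hs
  funext a
  by_cases hx : ∃ x ∈ (Finset.univ : Finset Bool).sigma fun b =>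
      (Finset.Icc 1 (Q.D b)).sigma fun d => Finset.range (2 ^ d) ×ˢ Finset.range (Q.ncell b d),
      Q.addr x = a
  · obtain ⟨⟨b', d, r, c⟩, hx, rfl⟩ := hx
    have hx' := hx
    simp only [Finset.mem_sigma, Finset.mem_univ, true_and, Finset.mem_Icc, Finset.mem_product,
      Finset.mem_range] at hx'
    obtain ⟨⟨hd, hdD⟩, hr, hc⟩ := hx'
    rw [Q.store_addr _ hd hdD hr hc, Q.store_addr _ hd hdD hr hc, Q.store_addr _ hd hdD hr hc]
    by_cases hon : b' = b ∧ r = P % 2 ^ d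
    · obtain ⟨rfl, rfl⟩ := hon
      rw [if_pos (Q.mem_pathCells.2 ⟨d, c, ⟨hd, hdD⟩, hc, rfl⟩), node_repack_on]
    · rw [if_neg, node_repack_off _ _ _ hon, hoff _ _ _ hd hon]
      intro hmem
      obtain ⟨d', c', hd', hc', h'⟩ := Q.mem_pathCells.1 hmem
      have hy : (⟨b, d', (P % 2 ^ d', c')⟩ : Σ _ : Bool, Σ _ : ℕ, ℕ × ℕ) ∈
          (Finset.univ : Finset Bool).sigma fun b => (Finset.Icc 1 (Q.D b)).sigma fun d =>
            Finset.range (2 ^ d) ×ˢ Finset.range (Q.ncell b d) := by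
        simp [hd', hc', Nat.mod_lt]
      have := Q.addr_inj hy hx h'
      simp only [Sigma.mk.injEq, heq_eq_eq, Prod.mk.injEq] at this
      obtain ⟨rfl, rfl, h3, -⟩ := this
      exact hon ⟨rfl, h3.symm⟩
  · have h0 : ∀ E, Q.store E a = fun _ => false := fun E => by rw [store, dif_neg hx]
    rw [h0, h0, h0, ite_self]

/-- A block gets a new label and a new content and is moved to the stash. -/
def modify (u : Q.U) (x : Q.Lab) (v : Block B) : Q.State where
  lam := Function.update σ.lam u x
  val := Function.update σ.val u v
  lev := Function.update σ.lev u 0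

variable (u : Q.U) (x : Q.Lab) (v : Block B)

theorem entry_modify {w : Q.U} (hw : w ≠ u) : (σ.modify u x v).entry w = σ.entry w := by
  simp [entry, modify, hw]

theorem located_modify_subset {b' : Bool} {d r : ℕ} (hd : 1 ≤ d) :
    located tree (σ.modify u x v).labels (σ.modify u x v).lev b' d r ⊆
      located tree σ.labels σ.lev b' d r := by
  intro w
  simp only [located, Finset.mem_filter, Finset.mem_univ, true_and]
  rintro ⟨h1, h2, h3⟩
  by_cases hw : w = u
  · subst hw
    simp only [modify, Function.update_self] at h2
    omega
  · simp only [modify, labels, Function.update_of_ne hw] at h2 h3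
    exact ⟨h1, h2, h3⟩

theorem located_modify {b' : Bool} {d r : ℕ} (hd : 1 ≤ d)
    (hoff : ¬ (b' = tree u ∧ r = σ.labels u % 2 ^ d)) :
    located tree (σ.modify u x v).labels (σ.modify u x v).lev b' d r =
      located tree σ.labels σ.lev b' d r := by
  refine (σ.located_modify_subset u x v hd).antisymm fun w => ?_
  simp only [located, Finset.mem_filter, Finset.mem_univ, true_and]
  rintro ⟨h1, h2, h3⟩
  have hw : w ≠ u := by
    rintro rfl
    exact hoff ⟨h1.symm, h3.symm⟩
  simp only [modify, labels, Function.update_of_ne hw]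
  exact ⟨h1, h2, h3⟩

theorem node_modify {b' : Bool} {d r : ℕ} (hd : 1 ≤ d)
    (hoff : ¬ (b' = tree u ∧ r = σ.labels u % 2 ^ d)) :
    (σ.modify u x v).node b' d r = σ.node b' d r := by
  rw [node, node, σ.located_modify u x v hd hoff]
  refine Finset.image_congr fun w hw => ?_
  refine σ.entry_modify u x v ?_
  rintro rfl
  simp only [located, Finset.coe_filter, Finset.mem_univ, true_and, Set.mem_ofPred_eq] at hw
  exact hoff ⟨hw.1.symm, hw.2.2.symm⟩

theorem stash_modify_filter :
    (σ.modify u x v).stash.filter (fun e => tree e.1 ≠ tree u) =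
      σ.stash.filter fun e => tree e.1 ≠ tree u := by
  rw [stash, stash, Finset.filter_image, Finset.filter_image]
  ext e
  simp only [Finset.mem_image, Finset.mem_filter, Finset.mem_univ, true_and]
  constructor
  · rintro ⟨w, ⟨h1, h2⟩, rfl⟩
    have hw : w ≠ u := by rintro rfl; exact h2 rfl
    simp only [modify, Function.update_of_ne hw] at h1
    exact ⟨w, ⟨h1, h2⟩, (σ.entry_modify u x v hw).symm⟩
  · rintro ⟨w, ⟨h1, h2⟩, rfl⟩
    have hw : w ≠ u := by rintro rfl; exact h2 rfl
    exact ⟨w, ⟨by simpa only [modify, Function.update_of_ne hw] using h1, h2⟩,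
      σ.entry_modify u x v hw⟩

theorem onPath_modify : (σ.modify u x v).onPath (tree u) P =
    insert (u, x, v) ((σ.onPath (tree u) P).filter fun e => e.1 ≠ u) := by
  ext e
  simp only [onPath, Finset.mem_insert, Finset.mem_filter, Finset.mem_image, mem_visible]
  constructor
  · rintro ⟨w, ⟨h1, h2⟩, rfl⟩
    by_cases hw : w = u
    · subst hw
      left
      simp [entry, modify]
    · right
      simp only [modify, labels, Function.update_of_ne hw] at h2
      exact ⟨⟨w, ⟨h1, h2⟩, (σ.entry_modify u x v hw).symm⟩, by simpa [entry] using hw⟩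
  · rintro (rfl | ⟨⟨w, ⟨h1, h2⟩, rfl⟩, hw⟩)
    · exact ⟨u, ⟨rfl, by simp [modify, Nat.mod_one]⟩, by simp [entry, modify]⟩
    · have hw' : w ≠ u := by simpa [entry] using hw
      exact ⟨w, ⟨h1, by simpa only [modify, labels, Function.update_of_ne hw'] using h2⟩,
        σ.entry_modify u x v hw'⟩

/-- The invariant after an access to a block. -/
theorem placed_modify_repack {lst : Q.U → ℕ} {cnt : Bool → ℕ}
    (h : Placed tree Q.D Q.cap σ.labels σ.lev lst cnt) :
    Placed tree Q.D Q.cap ((σ.modify u x v).repack (tree u) (σ.labels u)).labels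
      ((σ.modify u x v).repack (tree u) (σ.labels u)).lev
      (Function.update lst u (cnt (tree u))) cnt := by
  refine placed_repack _ _ _ (fun w => ?_) (fun b d r hd => ?_) fun w d hd hdD hev hoff => ?_
  · by_cases hw : w = u
    · subst hw; simp [modify]
    · simpa [modify, hw] using h.le w
  · exact (Finset.card_le_card (σ.located_modify_subset u x v hd)).trans (h.card_le b d r hd)
  · by_cases hw : w = u
    · subst hw
      -- The last access to this block is now, so no eviction has followed it.
      obtain ⟨τ, h1, h2, -⟩ := hev
      rw [Function.update_self] at h1
      omega
    · have e1 : (σ.modify u x v).labels w = σ.labels w := by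
        simp [labels, modify, hw]
      have e2 : (σ.modify u x v).lev w = σ.lev w := by simp [modify, hw]
      rw [e1] at hoff ⊢
      rw [e2] at hd
      rw [σ.located_modify u x v (by omega) hoff]
      refine h.full w d hd hdD ?_
      obtain ⟨τ, h1, h2, h3⟩ := hev
      rw [Function.update_of_ne hw] at h1
      rw [e1] at h3
      exact ⟨τ, h1, h2, h3⟩

/-- The invariant after an eviction. -/
theorem placed_evict {lst : Q.U → ℕ} {cnt : Bool → ℕ}
    (h : Placed tree Q.D Q.cap σ.labels σ.lev lst cnt) :
    Placed tree Q.D Q.cap (σ.repack b (cnt b % 2 ^ Q.l)).labels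
      (σ.repack b (cnt b % 2 ^ Q.l)).lev lst (Function.update cnt b (cnt b + 1)) := by
  refine placed_repack _ _ _ h.le h.card_le fun w d hd hdD hev hoff => h.full w d hd hdD ?_
  obtain ⟨τ, h1, h2, h3⟩ := hev
  refine ⟨τ, h1, ?_, h3⟩
  by_cases hb : tree w = b
  · rw [hb, Function.update_self] at h2
    rw [hb]
    -- The only new eviction is that of the path being repacked, and its nodes are excluded by
    -- `hoff`.
    rcases Nat.lt_succ_iff_lt_or_eq.1 h2 with h2 | rfl
    · exact h2
    · refine absurd ⟨hb, ?_⟩ hoff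
      rw [Nat.mod_mod_of_dvd _ (pow_dvd_pow 2 (hdD.trans (Q.D_le _))), h3]
  · rwa [Function.update_of_ne hb] at h2

end State

end Scheme

/-! ### The user algorithm and the invariant of its rounds. -/

namespace Scheme

open TrieBlock

variable {B N S : ℕ} (Q : Scheme B N S)

/-- The permanent memory: the label of the topmost block, the eviction counters, the stash. -/
structure PermState where
  root : Q.Lab
  cnt : Bool → Q.Lab
  stash : Finset Q.Ent

/-- The temporary memory between two rounds: the request, the new labels, the number of the round,
the label of the next block, the answer. -/
structure TempState where
  req : Request N B
  coins : Fin (Q.h + 1) → Q.Lab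
  round : Fin (2 * Q.h + 3)
  label : Q.Lab
  answer : Block B

/-- A number as a label. -/
def toLab (x : ℕ) : Q.Lab := ⟨x % 2 ^ Q.l, Nat.mod_lt _ (by positivity)⟩

/-- The height of the block that is accessed in a round. -/
def levelAt (j : ℕ) : Fin (Q.h + 1) := ⟨Q.h - j / 2, by omega⟩

/-- The tree that is accessed in a round. -/
def treeAt (j : ℕ) : Bool := decide (Q.h - j / 2 = 0)

theorem tree_path_levelAt (a : Fin N) (j : ℕ) :
    tree (path Q.β Q.h a (Q.levelAt j)) = Q.treeAt j := rfl

variable {Q}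

/-- The leaf of the path that is accessed in a round. In the rounds with an even number, a block is
accessed, in the other rounds blocks are evicted along a path that is independent of the labels. -/
def leafAt (p : Q.PermState) (t : Q.TempState) : ℕ :=
  if t.round.val % 2 = 0 then t.label.val else (p.cnt (Q.treeAt t.round)).val

/-- The block that is accessed in a round. -/
def TempState.block (t : Q.TempState) : Q.U := path Q.β Q.h t.req.addr (Q.levelAt t.round)

/-- The block that is accessed in the round after the next. -/
def TempState.child (t : Q.TempState) : Q.U := path Q.β Q.h t.req.addr (Q.levelAt (t.round + 2))

/-- The new content of the accessed block. -/
def TempState.newVal (t : Q.TempState) (v : Block B) : Block B :=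
  if Q.treeAt t.round then (match t.req.op with
    | Op.read => v
    | Op.write => t.req.val)
  -- The parent records the coin that its child receives as label two rounds later.
  else Q.put (Function.update (Q.get v) t.child.slot (t.coins (Q.levelAt (t.round + 2))))

/-- The temporary memory after a round. -/
def TempState.advance (t : Q.TempState) (v : Block B) : Q.TempState :=
  { t with
    -- The remainder only keeps the number in its type; an access ends before it wraps around.
    round := ⟨(t.round + 1) % (2 * Q.h + 3), Nat.mod_lt _ (by omega)⟩
    -- Here `v` is the content before the update, so the old label of the child is obtained.
    label := if t.round.val % 2 = 0 ∧ Q.treeAt t.round = false then Q.get v t.child.slot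
      else t.label
    answer := if t.round.val % 2 = 0 ∧ Q.treeAt t.round = true then v else t.answer }

open Classical in
/-- The content of a block among some stored blocks. -/
noncomputable def lookup (E : Finset Q.Ent) (u : Q.U) : Block B :=
  if h : ∃ v x, (u, x, v) ∈ E then h.choose else fun _ => false

/-- The blocks on the path that is accessed in a round, before the access. -/
def TempState.before (p : Q.PermState) (t : Q.TempState) (view : Store S B) : Finset Q.Ent :=
  p.stash.filter (fun e => tree e.1 = Q.treeAt t.round) ∪
    Q.readPath view (Q.treeAt t.round) (leafAt p t)

/-- The blocks on the path that is accessed in a round, with their new labels and contents. -/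
noncomputable def TempState.after (t : Q.TempState) (E : Finset Q.Ent) : Finset Q.Ent :=
  if t.round.val % 2 = 0 then
    insert (t.block, t.coins (Q.levelAt t.round), t.newVal (lookup E t.block))
      (E.filter fun e => e.1 ≠ t.block)
  else E

variable (Q)

instance : Nonempty Q.PermState := ⟨⟨Q.toLab 0, fun _ => Q.toLab 0, ∅⟩⟩

instance : Nonempty Q.TempState :=
  ⟨⟨⟨Op.read, ⟨0, Q.N_pos⟩, fun _ => false⟩, fun _ => Q.toLab 0, 0, Q.toLab 0, fun _ => false⟩⟩

instance : Nonempty Q.Lab := ⟨Q.toLab 0⟩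

/-- The user algorithm. -/
noncomputable def machine : Machine B N S where
  Perm := Q.PermState
  Temp := Q.TempState
  Coin := Fin (Q.h + 1) → Q.Lab
  -- The top block has no parent, so its new label is recorded here, and its old label becomes the
  -- first path to read.
  start p r ξ := ({ p with root := ξ (Fin.last _) }, ⟨r, ξ, 0, p.root, fun _ => false⟩)
  done t := if t.round.val = 2 * Q.h + 2 then some t.answer else none
  cells p t := Q.pathCells (Q.treeAt t.round) (leafAt p t)
  upd p t view :=
    let b := Q.treeAt t.round
    let E := t.before p view
    let E' := t.after E
    let loc := Q.placement E' b (leafAt p t)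
    (⟨p.root,
      if t.round.val % 2 = 0 then p.cnt else Function.update p.cnt b (Q.toLab ((p.cnt b).val + 1)),
      p.stash.filter (fun e => tree e.1 ≠ b) ∪ E'.filter fun e => loc e = 0⟩,
      t.advance (lookup E t.block),
      Q.store fun _ d _ => E'.filter fun e => loc e = d)

/-- The times of the evictions and of the last accesses to the blocks. -/
structure Times where
  cnt : Bool → ℕ
  lst : Q.U → ℕ

variable {Q}

/-- The eviction counters during an access. -/
def cntAt (Q : Scheme B N S) (c : Bool → ℕ) : ℕ → Bool → ℕ
  | 0 => c
  | j + 1 => if j % 2 = 0 then Q.cntAt c j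
      else Function.update (Q.cntAt c j) (Q.treeAt j) (Q.cntAt c j (Q.treeAt j) + 1)

/-- The times of the last accesses during an access. -/
def Times.lstAt (g : Q.Times) (a : Fin N) : ℕ → Q.U → ℕ
  | 0 => g.lst
  | j + 1 => if j % 2 = 0 then Function.update (g.lstAt a j) (path Q.β Q.h a (Q.levelAt j))
        (Q.cntAt g.cnt j (Q.treeAt j))
      else g.lstAt a j

variable (Q)

/-- The heights at which blocks have been relabelled before a round. -/
def changed (j : ℕ) : Finset (Fin (Q.h + 1)) :=
  Finset.univ.filter fun i => Q.h + 1 ≤ i.val + (j + 1) / 2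

/-- The heights of the blocks whose new labels have been recorded before a round. -/
def recorded (j : ℕ) : Finset (Fin (Q.h + 1)) :=
  Finset.univ.filter fun i => Q.h ≤ i.val + (j + 1) / 2

/-- The blocks hold given labels of the blocks below them. -/
structure Linked (root : Q.Lab) (val : Q.U → Block B) (lab : Q.U → Q.Lab) : Prop where
  root_eq : ∀ u : Q.U, u.height = Q.h → root = lab u
  get_eq : ∀ w u : Q.U, IsParent w u → Q.get (val w) u.slot = lab u

variable {Q}

/-- The permanent memory in a given state. -/
def State.perm (σ : Q.State) (root : Q.Lab) (cnt : Bool → ℕ) : Q.PermState :=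
  ⟨root, fun b => Q.toLab (cnt b), σ.stash⟩

/-- The database. -/
def State.db (σ : Q.State) : Store N B := fun a => σ.val (path Q.β Q.h a 0)

/-- The situation before round `j` of an access that began in state `σ₀`. -/
structure Stage (g : Q.Times) (σ₀ : Q.State) (r : Request N B) (ξ : Fin (Q.h + 1) → Q.Lab) (j : ℕ)
    (x : Q.PermState × Q.TempState × Store S B) (σ : Q.State) : Prop where
  perm : x.1 = σ.perm (ξ (Fin.last _)) (Q.cntAt g.cnt j)
  store : x.2.2 = Q.store σ.node
  req : x.2.1.req = r
  coins : x.2.1.coins = ξ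
  round : x.2.1.round.val = j
  -- During an eviction round the label kept is already that of the next block; after the data block
  -- there is none.
  label : (j + 1) / 2 ≤ Q.h →
    x.2.1.label = σ₀.lam (path Q.β Q.h r.addr (Q.levelAt (j + 1)))
  placed : Placed tree Q.D Q.cap σ.labels σ.lev (g.lstAt r.addr j) (Q.cntAt g.cnt j)
  lam : σ.lam = override σ₀.lam (path Q.β Q.h r.addr) (Q.changed j) ξ
  -- New labels are recorded in the parent before the child is accessed, so `recorded` runs one
  -- height ahead of `changed`.
  linked : Q.Linked (ξ (Fin.last _)) σ.val
    (override σ₀.lam (path Q.β Q.h r.addr) (Q.recorded j) ξ)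
  -- Round `2 * Q.h` accesses the data block; a write takes effect there.
  db : σ.db = if j ≤ 2 * Q.h then σ₀.db else r.apply σ₀.db
  answer : 2 * Q.h < j → x.2.1.answer = σ₀.db r.addr

theorem lookup_onPath (σ : Q.State) {b : Bool} {P : ℕ} {u : Q.U}
    (hu : u ∈ visible tree σ.labels σ.lev b P) : lookup (σ.onPath b P) u = σ.val u := by
  have h : ∃ v x, (u, x, v) ∈ σ.onPath b P :=
    ⟨σ.val u, σ.lam u, Finset.mem_image_of_mem σ.entry hu⟩
  rw [lookup, dif_pos h]
  obtain ⟨x, hx⟩ := h.choose_spec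
  obtain ⟨w, -, hw⟩ := Finset.mem_image.1 hx
  simp only [State.entry, Prod.mk.injEq] at hw
  rw [← hw.2.2, hw.1]

section Rounds

variable {g : Q.Times} {σ₀ σ : Q.State} {r : Request N B} {ξ : Fin (Q.h + 1) → Q.Lab} {j : ℕ}
  {x : Q.PermState × Q.TempState × Store S B}

theorem Stage.before_eq (h : Stage g σ₀ r ξ j x σ) :
    TempState.before x.1 x.2.1 (fun c => if c ∈ Q.pathCells (Q.treeAt x.2.1.round) (leafAt x.1 x.2.1)
      then x.2.2 c else fun _ => false) =
    σ.onPath (Q.treeAt j) (leafAt x.1 x.2.1) := by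
  rw [TempState.before, h.perm, h.round]
  refine σ.readPath_store _ _ h.placed.le h.placed.card_le fun a ha => ?_
  rw [if_pos ha, h.store]

/-- A round in which blocks are evicted. -/
theorem Stage.evict (h : Stage g σ₀ r ξ j x σ) (hj : j % 2 = 1) :
    Stage g σ₀ r ξ (j + 1) (Q.machine.round x)
      (σ.repack (Q.treeAt j) (Q.cntAt g.cnt j (Q.treeAt j) % 2 ^ Q.l)) := by
  have hround := h.round
  have hodd : ¬ x.2.1.round.val % 2 = 0 := by rw [hround]; omega
  have hleaf : leafAt x.1 x.2.1 = Q.cntAt g.cnt j (Q.treeAt j) % 2 ^ Q.l := by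
    rw [leafAt, if_neg hodd, h.perm, hround]; rfl
  have hb := h.before_eq
  rw [hleaf] at hb
  have ha : x.2.1.after (σ.onPath (Q.treeAt j) (Q.cntAt g.cnt j (Q.treeAt j) % 2 ^ Q.l)) =
      σ.onPath (Q.treeAt j) (Q.cntAt g.cnt j (Q.treeAt j) % 2 ^ Q.l) := by
    rw [TempState.after, if_neg hodd]
  have hcnt : Q.cntAt g.cnt (j + 1) = Function.update (Q.cntAt g.cnt j) (Q.treeAt j)
      (Q.cntAt g.cnt j (Q.treeAt j) + 1) := by
    rw [cntAt, if_neg (by omega)]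
  have hlst : g.lstAt r.addr (j + 1) = g.lstAt r.addr j := by
    rw [Times.lstAt, if_neg (by omega)]
  have hhalf : (j + 1 + 1) / 2 = (j + 1) / 2 := by omega
  have hlevel : Q.levelAt (j + 1 + 1) = Q.levelAt (j + 1) := by
    rw [levelAt, levelAt]; simp only [hhalf]
  have hadv : (Q.machine.round x).2.1 = x.2.1.advance (lookup
      (σ.onPath (Q.treeAt j) (Q.cntAt g.cnt j (Q.treeAt j) % 2 ^ Q.l)) x.2.1.block) := by
    simp only [Machine.round, machine, hleaf, hb]
  constructor
  · simp only [Machine.round, machine, hleaf, hb, ha, if_neg hodd]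
    rw [State.perm, State.stash_repack, hcnt, h.perm, hround]
    simp only [State.perm, PermState.mk.injEq, and_true, true_and]
    funext b
    by_cases hbb : b = Q.treeAt j
    · subst hbb
      simp [toLab, Nat.mod_add_mod]
    · simp [Function.update_of_ne hbb]
  · simp only [Machine.round, machine, hleaf, hb, ha]
    rw [hround]
    exact σ.store_repack _ _ h.store fun _ _ _ _ _ => rfl
  · rw [hadv]; exact h.req
  · rw [hadv]; exact h.coins
  · rw [hadv, TempState.advance]
    simp only [hround]
    exact Nat.mod_eq_of_lt (by omega)
  · rw [hadv, TempState.advance, hhalf, hlevel]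
    simp only [hodd, false_and, if_false]
    exact h.label
  · rw [hlst, hcnt]
    exact σ.placed_evict _ h.placed
  · rw [changed, hhalf]; exact h.lam
  · rw [recorded, hhalf]; exact h.linked
  · have e : (j + 1 ≤ 2 * Q.h) = (j ≤ 2 * Q.h) := by
      apply propext; omega
    simp only [e]
    exact h.db
  · intro hlt
    rw [hadv, TempState.advance]
    simp only [hodd, false_and, if_false]
    exact h.answer (by omega)

theorem override_insert {U Λ I : Type} [DecidableEq U] [DecidableEq I] {p : I → U}
    (hp : Function.Injective p) (l : U → Λ) (A : Finset I) (ξ : I → Λ) (i : I) :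
    override l p (insert i A) ξ = Function.update (override l p A ξ) (p i) (ξ i) := by
  funext u
  by_cases hu : u = p i
  · subst hu
    rw [Function.update_self, override_apply hp _ _ (Finset.mem_insert_self _ _)]
  · rw [Function.update_of_ne hu]
    by_cases h : ∃ i' ∈ A, p i' = u
    · obtain ⟨i', hi', rfl⟩ := h
      rw [override_apply hp _ _ hi', override_apply hp _ _ (Finset.mem_insert_of_mem hi')]
    · push Not at h
      rw [override_of_notMem _ _ h, override_of_notMem]
      intro i' hi'
      rcases Finset.mem_insert.1 hi' with rfl | hi'
      · exact fun h' => hu h'.symm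
      · exact h i' hi'

/-- A round in which a block is accessed. -/
theorem Stage.access (h : Stage g σ₀ r ξ j x σ) (hj : j % 2 = 0) (hjh : j < 2 * Q.h + 2) :
    ∃ v, Stage g σ₀ r ξ (j + 1) (Q.machine.round x)
      ((σ.modify (path Q.β Q.h r.addr (Q.levelAt j)) (ξ (Q.levelAt j)) v).repack (Q.treeAt j)
        (σ.labels (path Q.β Q.h r.addr (Q.levelAt j)))) := by
  have hround := h.round
  have hreq := h.req
  have hcoins := h.coins
  have hev : x.2.1.round.val % 2 = 0 := by rw [hround]; exact hj
  have hinj := path_injective (β := Q.β) (h := Q.h) r.addr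
  set u := path Q.β Q.h r.addr (Q.levelAt j) with hu
  have hlev : (Q.levelAt j).val = Q.h - j / 2 := rfl
  have hblock : x.2.1.block = u := by rw [TempState.block, hreq, hround]
  have hchild : x.2.1.child = path Q.β Q.h r.addr (Q.levelAt (j + 2)) := by
    rw [TempState.child, hreq, hround]
  have hlab : x.2.1.label = σ.lam u := by
    -- The block still has its original label, since only blocks of greater height have been
    -- relabelled.
    rw [h.label (by omega), h.lam]
    have : Q.levelAt (j + 1) = Q.levelAt j := Fin.ext (by simp only [levelAt]; omega)
    rw [this, override_of_notMem]
    intro i hi hiu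
    have := hinj hiu
    subst this
    rw [changed, Finset.mem_filter] at hi
    omega
  have hleaf : leafAt x.1 x.2.1 = σ.labels u := by
    rw [leafAt, if_pos hev, hlab]; rfl
  have hb := h.before_eq
  rw [hleaf] at hb
  have hvis : u ∈ visible tree σ.labels σ.lev (Q.treeAt j) (σ.labels u) :=
    (σ.mem_visible _ _).2 ⟨rfl, rfl⟩
  have hlook : lookup (σ.onPath (Q.treeAt j) (σ.labels u)) u = σ.val u := lookup_onPath σ hvis
  set v := x.2.1.newVal (σ.val u) with hv
  refine ⟨v, ?_⟩
  set σ₁ := σ.modify u (ξ (Q.levelAt j)) v with hσ₁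
  have ha : x.2.1.after (σ.onPath (Q.treeAt j) (σ.labels u)) =
      σ₁.onPath (Q.treeAt j) (σ.labels u) := by
    rw [TempState.after, if_pos hev, hblock, hlook, ← hv, hcoins, hround]
    exact (σ.onPath_modify (σ.labels u) u (ξ (Q.levelAt j)) v).symm
  have hcnt : Q.cntAt g.cnt (j + 1) = Q.cntAt g.cnt j := by rw [cntAt, if_pos hj]
  have hlst : g.lstAt r.addr (j + 1) = Function.update (g.lstAt r.addr j) u
      (Q.cntAt g.cnt j (Q.treeAt j)) := by
    rw [Times.lstAt, if_pos hj]
  have hadv : (Q.machine.round x).2.1 = x.2.1.advance (σ.val u) := by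
    simp only [Machine.round, machine, hleaf, hb, hblock, hlook]
  have hchanged : Q.changed (j + 1) = insert (Q.levelAt j) (Q.changed j) := by
    ext i
    simp only [changed, Finset.mem_filter, Finset.mem_univ, true_and, Finset.mem_insert,
      Fin.ext_iff, hlev]
    omega
  have hσ₁lam : σ₁.lam = override σ₀.lam (path Q.β Q.h r.addr) (Q.changed (j + 1)) ξ := by
    rw [hchanged, override_insert hinj, ← h.lam]; rfl
  have htree : Q.treeAt j = true ↔ j = 2 * Q.h := by
    simp only [treeAt, decide_eq_true_eq]; omega
  have hheight : u.height = Q.h - j / 2 := rfl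
  have hval : ∀ w : Q.U, w ≠ u → σ₁.val w = σ.val w := fun w hw => by
    simp [hσ₁, State.modify, hw]
  have hval' : σ₁.val u = v := by simp [hσ₁, State.modify]
  have hdb0 : σ.val (path Q.β Q.h r.addr 0) = σ₀.db r.addr := by
    have := congrFun h.db r.addr
    rw [if_pos (by omega)] at this
    exact this
  constructor
  · simp only [Machine.round, machine, hleaf, hb, ha, if_pos hev]
    rw [State.perm, State.stash_repack, hcnt, h.perm, hround]
    simp only [State.perm, PermState.mk.injEq, true_and]
    rw [hσ₁, ← Q.tree_path_levelAt r.addr j, ← hu, σ.stash_modify_filter]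
  · simp only [Machine.round, machine, hleaf, hb, ha]
    rw [hround]
    exact σ₁.store_repack _ _ h.store fun b' d r' hd hoff => σ.node_modify _ _ _ hd hoff
  · rw [hadv]; exact h.req
  · rw [hadv]; exact h.coins
  · rw [hadv, TempState.advance]
    simp only [hround]
    exact Nat.mod_eq_of_lt (by omega)
  · intro hlt
    have hf : Q.treeAt j = false := by
      rw [← Bool.not_eq_true, htree]; omega
    have hf' : Q.treeAt x.2.1.round = false := by rw [hround]; exact hf
    rw [hadv, TempState.advance]
    simp only [hev, hf', and_self, if_true, hchild]
    have hp : IsParent u (path Q.β Q.h r.addr (Q.levelAt (j + 2))) :=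
      isParent_path r.addr (by simp only [levelAt]; omega)
    -- The new label of the child is not yet recorded, so its slot still holds the original one.
    rw [h.linked.get_eq _ _ hp, override_of_notMem]
    intro i hi hiu
    have := hinj hiu
    subst this
    simp only [recorded, Finset.mem_filter, levelAt] at hi
    omega
  · rw [hlst, hcnt]
    exact σ.placed_modify_repack u (ξ (Q.levelAt j)) v h.placed
  · exact hσ₁lam
  -- The data block holds no labels; in every other access round exactly one slot of `u` changes,
  -- that of the child `c₀`.
  · by_cases ht : Q.treeAt j = true
    · have hj2 := htree.1 ht
      have hr : Q.recorded (j + 1) = Q.recorded j := by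
        ext i
        simp only [recorded, Finset.mem_filter, Finset.mem_univ, true_and]
        omega
      rw [hr]
      refine ⟨h.linked.root_eq, fun w c hwc => ?_⟩
      rw [← h.linked.get_eq w c hwc]
      have hw : w ≠ u := by
        rintro rfl
        have := hwc.1
        omega
      exact congrArg (fun y => Q.get y c.slot) (hval w hw)
    · have hj2 : j ≠ 2 * Q.h := fun h' => ht (htree.2 h')
      rw [Bool.not_eq_true] at ht
      have ht' : Q.treeAt x.2.1.round = false := by rw [hround]; exact ht
      set c₀ := path Q.β Q.h r.addr (Q.levelAt (j + 2)) with hc₀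
      have hp : IsParent u c₀ := isParent_path r.addr (by simp only [levelAt]; omega)
      have hr : Q.recorded (j + 1) = insert (Q.levelAt (j + 2)) (Q.recorded j) := by
        ext i
        simp only [recorded, Finset.mem_filter, Finset.mem_univ, true_and, Finset.mem_insert,
          Fin.ext_iff, levelAt]
        omega
      have hveq : v = Q.put (Function.update (Q.get (σ.val u)) c₀.slot (ξ (Q.levelAt (j + 2)))) := by
        rw [hv, TempState.newVal, ht', hchild, hcoins, hround]
        simp
      rw [hr, override_insert hinj]
      refine ⟨fun w hw => ?_, fun w c hwc => ?_⟩
      · rw [Function.update_of_ne, h.linked.root_eq w hw]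
        rintro rfl
        have : (Q.levelAt (j + 2)).val = Q.h := hw
        simp only [levelAt] at this
        omega
      · have hrep : ∀ y, (σ₁.repack (Q.treeAt j) (σ.labels u)).val y = σ₁.val y := fun _ => rfl
        rw [hrep]
        by_cases hwu : w = u
        · subst hwu
          rw [hval', hveq, Q.get_put _ _ (slot_lt Q.β_pos c)]
          by_cases hc : c = c₀
          · rw [hc, Function.update_self]
            exact (Function.update_self (β := fun _ => Q.Lab) _ _ _).symm
          · rw [Function.update_of_ne, Function.update_of_ne hc]
            · exact h.linked.get_eq _ c hwc
            · exact fun hs => hc (hwc.child_unique hp hs)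
        · rw [hval w hwu, Function.update_of_ne]
          · exact h.linked.get_eq w c hwc
          · rintro rfl
            exact hwu (hwc.unique hp)
  · have hd := h.db
    rw [if_pos (by omega)] at hd
    have hdbv : ∀ a : Fin N, (σ₁.repack (Q.treeAt j) (σ.labels u)).db a
        = σ₁.val (path Q.β Q.h a 0) := fun _ => rfl
    funext a
    rw [hdbv]
    by_cases ht : Q.treeAt j = true
    · have hj2 := htree.1 ht
      rw [if_neg (by omega)]
      have hu0 : u = path Q.β Q.h r.addr 0 := by
        rw [hu]
        congr 1
        exact Fin.ext (by simp only [levelAt]; simp; omega)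
      have ht' : Q.treeAt x.2.1.round = true := by rw [hround]; exact ht
      by_cases haa : a = r.addr
      · subst haa
        rw [← hu0, hval', hv, TempState.newVal, if_pos ht', hreq, hu0, hdb0]
        rcases r with ⟨_ | _, ad, va⟩ <;> simp [Request.apply]
      · have hne : path Q.β Q.h a 0 ≠ u := by
          rw [hu0]
          exact fun h' => haa (path_zero_injective h')
        rw [hval _ hne]
        have := congrFun hd a
        have h2 : r.apply σ₀.db a = σ₀.db a := by
          rcases r with ⟨_ | _, ad, va⟩
          · rfl
          · simp only [Request.apply]
            exact Function.update_of_ne haa _ _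
        rw [h2]
        exact this
    · have hj2 : j ≠ 2 * Q.h := fun h' => ht (htree.2 h')
      rw [if_pos (by omega)]
      have hne : path Q.β Q.h a 0 ≠ u := by
        intro h'
        have := congrArg height h'
        rw [hheight, height_path] at this
        simp at this
        omega
      rw [hval _ hne]
      exact congrFun hd a
  · intro hlt
    have hj2 : j = 2 * Q.h := by omega
    have ht : Q.treeAt x.2.1.round = true := by rw [hround]; exact htree.2 hj2
    rw [hadv, TempState.advance]
    simp only [hev, ht, and_self, if_true]
    rw [← hdb0]
    congr 1
    rw [hu]
    congr 1
    exact Fin.ext (by simp only [levelAt]; simp; omega)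

end Rounds

end Scheme

/-! ### Overflow of the stash. -/

theorem Overloaded.mono {U Λ : Type} [Fintype U] {node : U → Λ → Option (ℕ × ℕ)} {h R R' : ℕ}
    {lam : U → Λ} (ho : Overloaded node h R' lam) (hR : R ≤ R') : Overloaded node h R lam := by
  obtain ⟨T, hT, hne, hle⟩ := ho
  exact ⟨T, hT, hne, by omega⟩

namespace Scheme

open TrieBlock

variable {B N S : ℕ} (Q : Scheme B N S)

/-- The event, in terms of the labels, without which the stash holds at most `2 R` blocks. -/
def Overflow (cnt : Bool → ℕ) (lst : Q.U → ℕ) (R : ℕ) (lam : Q.U → Q.Lab) : Prop :=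
  Overloaded (idealNodes tree (Q.D false) lst cnt false) (Q.D false + 1) R lam ∨
  Overloaded (idealNodes tree (Q.D true) lst cnt true) (Q.D true) R lam ∨
  ∃ r < 2 ^ Q.D true, Q.K + 1 ≤ load (idealNodes tree (Q.D true) lst cnt true) {(Q.D true, r)} lam

variable {Q}

theorem card_stash_le (σ : Q.State) : σ.stash.card ≤
    (located tree σ.labels σ.lev false 0 0).card + (located tree σ.labels σ.lev true 0 0).card := by
  refine Finset.card_image_le.trans (le_trans (Finset.card_le_card ?_) (Finset.card_union_le _ _))
  intro u hu
  have hu := (Finset.mem_filter.1 hu).2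
  rw [Finset.mem_union]
  simp only [located, Finset.mem_filter, Finset.mem_univ, true_and, hu, pow_zero, Nat.mod_one,
    and_true]
  cases tree u <;> simp

/-- Of more than `2 R` blocks in the stash, at least `R` belong to one of the two trees. -/
theorem overflow_of_lt {σ : Q.State} {lst : Q.U → ℕ} {cnt : Bool → ℕ}
    (h : Placed tree Q.D Q.cap σ.labels σ.lev lst cnt) {R : ℕ} (hR : 2 * R < σ.stash.card) :
    Q.Overflow cnt lst R σ.lam := by
  have h1 := card_stash_le σ
  by_cases hf : R ≤ (located tree σ.labels σ.lev false 0 0).card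
  · exact Or.inl (Overloaded.mono (Placed.overloaded (lam := σ.lam) h false
      fun d => by simp [cap]) hf)
  · rcases Placed.overloaded_or (lam := σ.lam) h true Q.K (Q.D_pos true)
      (fun d hd => by simp [cap, hd.ne]) (by simp [cap]) with h2 | h2
    · refine Or.inr (Or.inl (h2.mono ?_))
      have h3 : σ.labels = fun u => (σ.lam u).val := rfl
      rw [h3] at h1 hf
      omega
    · exact Or.inr (Or.inr h2)

/-! ### Times -/

/-- The times between two accesses are possible. -/
def Times.Valid (g : Q.Times) : Prop :=
  ValidTimes tree Q.l g.lst g.cnt ∧ ∀ u, g.lst u < g.cnt (tree u)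

theorem treeAt_succ {j : ℕ} (hj : j % 2 = 0) : Q.treeAt (j + 1) = Q.treeAt j := by
  rw [treeAt, treeAt, show (j + 1) / 2 = j / 2 by omega]

/-- Every access to a tree is followed by an eviction in it, which advances the counter, so access
times within a tree stay distinct. Between the two an access time may equal the counter, which
explains the case distinction in the strict inequality. -/
theorem Times.Valid.at {g : Q.Times} (hg : g.Valid) (a : Fin N) (j : ℕ) :
    ValidTimes tree Q.l (g.lstAt a j) (Q.cntAt g.cnt j) ∧
      ∀ u, j % 2 = 0 ∨ tree u ≠ Q.treeAt j → g.lstAt a j u < Q.cntAt g.cnt j (tree u) := by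
  induction j with
  | zero => exact ⟨hg.1, fun u _ => hg.2 u⟩
  | succ j ih =>
    obtain ⟨ih, ih'⟩ := ih
    by_cases hj : j % 2 = 0
    · have hlt := fun u => ih' u (Or.inl hj)
      rw [cntAt, if_pos hj, Times.lstAt, if_pos hj]
      refine ⟨⟨ih.le_cnt, fun u => ?_, fun u w huw hl hpos => ?_⟩, fun u hu => ?_⟩
      · by_cases hu : u = path Q.β Q.h a (Q.levelAt j)
        · subst hu
          rw [Function.update_self]; exact le_rfl
        · rw [Function.update_of_ne hu]; exact ih.lst_le u
      · by_cases hu : u = path Q.β Q.h a (Q.levelAt j)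
        · by_cases hw : w = path Q.β Q.h a (Q.levelAt j)
          · rw [hu, hw]
          · rw [hu, Function.update_self, Function.update_of_ne hw] at hl
            have := hlt w
            rw [← huw, ← hl, hu, tree_path_levelAt] at this
            exact absurd this (lt_irrefl _)
        · rw [Function.update_of_ne hu] at hl hpos
          by_cases hw : w = path Q.β Q.h a (Q.levelAt j)
          · rw [hw, Function.update_self] at hl
            have := hlt u
            rw [huw, hl, hw, tree_path_levelAt] at this
            exact absurd this (lt_irrefl _)
          · rw [Function.update_of_ne hw] at hl
            exact ih.inj u w huw hl hpos
      · have hne : u ≠ path Q.β Q.h a (Q.levelAt j) := by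
          rintro rfl
          rcases hu with hu | hu
          · omega
          · exact hu ((Q.tree_path_levelAt a j).trans (treeAt_succ hj).symm)
        rw [Function.update_of_ne hne]
        exact hlt u
    · rw [cntAt, if_neg hj, Times.lstAt, if_neg hj]
      have hle : ∀ b, Q.cntAt g.cnt j b ≤ Function.update (Q.cntAt g.cnt j) (Q.treeAt j)
          (Q.cntAt g.cnt j (Q.treeAt j) + 1) b := by
        intro b
        by_cases hb : b = Q.treeAt j
        · subst hb; simp
        · simp [hb]
      refine ⟨⟨fun b => (ih.le_cnt b).trans (hle b), fun u => (ih.lst_le u).trans (hle _),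
        ih.inj⟩, fun u _ => ?_⟩
      by_cases hu : tree u = Q.treeAt j
      · rw [hu, Function.update_self, ← hu]
        exact Nat.lt_succ_of_le (ih.lst_le u)
      · rw [Function.update_of_ne hu]
        exact ih' u (Or.inr hu)

/-! ### Probabilities -/

theorem card_tree_true_le : (Finset.univ.filter fun u : Q.U => tree u = true).card ≤ N := by
  calc _ ≤ (Finset.univ : Finset (Fin N)).card := by
        refine Finset.card_le_card_of_injOn (fun u => u.1.2) (fun _ _ => Finset.mem_univ _) ?_
        intro u hu w hw huw
        simp only [Finset.coe_filter, Finset.mem_univ, true_and, Set.mem_ofPred_eq, tree,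
          decide_eq_true_eq] at hu hw
        exact TrieBlock.ext' (hu.trans hw.symm) (congrArg Fin.val huw)
    _ = N := by simp

/-- A bound for the probability of an overflow. -/
noncomputable def overflowBound (Q : Scheme B N S) (R : ℕ) (θ : ℝ) : ℝ :=
  128 / 2 ^ R + 2 ^ Q.D true * Real.exp ((θ - 1) * N / 2 ^ Q.D true) / θ ^ Q.K

open Classical in
-- The three events of `Overflow` are bounded separately; the two overloads give `64 + 64` in the
-- numerator.
theorem average_overflow_le
    (hU : (Finset.univ.filter fun u : Q.U => tree u = false).card ≤ 2 * 2 ^ Q.D false)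
    {cnt : Bool → ℕ} {lst : Q.U → ℕ} (hv : ValidTimes tree Q.l lst cnt) (R : ℕ) {θ : ℝ}
    (hθ : 1 ≤ θ) :
    average (fun lam => if Q.Overflow cnt lst R lam then 1 else 0) ≤
      ENNReal.ofReal (Q.overflowBound R θ) := by
  refine average_indicator_le ?_
  have hcard : Fintype.card Q.Lab = 2 ^ Q.l := Fintype.card_fin _
  have h1 := card_overloaded_mul_le (Λ := Q.Lab) (idealNodes tree (Q.D false) lst cnt false)
    (Q.D false + 1) R (by
      intro d r hd _
      rw [hcard]
      rcases (Nat.lt_succ_iff.1 hd).lt_or_eq with hd | rfl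
      · exact sum_card_idealNodes_le (Q.D_le false) hv false hd
      -- By `hU` the position-map tree has at most two blocks per leaf, so its leaves behave like
      -- inner nodes.
      · refine (sum_card_idealNodes_leaf_le (Q.D_le false) lst cnt false r).trans ?_
        refine (Nat.mul_le_mul_right _ hU).trans (le_of_eq ?_)
        rw [mul_assoc, ← pow_add]
        congr 2
        have := Q.D_le false
        omega)
  have h2 := card_overloaded_mul_le (Λ := Q.Lab) (idealNodes tree (Q.D true) lst cnt true)
    (Q.D true) R (by
      intro d r hd _
      rw [hcard]
      exact sum_card_idealNodes_le (Q.D_le true) hv true hd)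
  have h3 := card_leaf_overflow_mul_le (tree := tree) lst cnt true Q.K hθ (Q.D_le true)
  have hN : Real.exp ((θ - 1) * (Finset.univ.filter fun u : Q.U => tree u = true).card
      / 2 ^ Q.D true) ≤ Real.exp ((θ - 1) * N / 2 ^ Q.D true) := by
    apply Real.exp_le_exp.2
    have : ((Finset.univ.filter fun u : Q.U => tree u = true).card : ℝ) ≤ N := by
      exact_mod_cast card_tree_true_le
    have := sub_nonneg.2 hθ
    gcongr
  have hθ0 : (0 : ℝ) < θ ^ Q.K := by positivity
  set M : ℝ := ((Fintype.card (Q.U → Q.Lab) : ℕ) : ℝ) with hM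
  have hM0 : 0 ≤ M := by positivity
  rw [← le_div_iff₀ (by positivity)] at h1 h2 h3
  have hsum : ((Finset.univ.filter fun lam : Q.U → Q.Lab => Q.Overflow cnt lst R lam).card : ℝ) ≤
      64 * M / 2 ^ R + (64 * M / 2 ^ R + M * (2 ^ Q.D true * Real.exp ((θ - 1) *
        (Finset.univ.filter fun u : Q.U => tree u = true).card / 2 ^ Q.D true)) / θ ^ Q.K) := by
    refine le_trans ?_ (add_le_add h1 (add_le_add h2 h3))
    norm_cast
    refine le_trans (Finset.card_le_card ?_) ((Finset.card_union_le _ _).trans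
      (Nat.add_le_add_left (Finset.card_union_le _ _) _))
    intro lam hlam
    rw [Finset.mem_union, Finset.mem_union, Finset.mem_filter, Finset.mem_filter, Finset.mem_filter]
    rcases (Finset.mem_filter.1 hlam).2 with h | h | h
    · exact Or.inl ⟨Finset.mem_univ _, h⟩
    · exact Or.inr (Or.inl ⟨Finset.mem_univ _, h⟩)
    · exact Or.inr (Or.inr ⟨Finset.mem_univ _, h⟩)
  refine hsum.trans ?_
  rw [overflowBound]
  have : M * (2 ^ Q.D true * Real.exp ((θ - 1) *
        (Finset.univ.filter fun u : Q.U => tree u = true).card / 2 ^ Q.D true)) / θ ^ Q.K ≤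
      M * (2 ^ Q.D true * Real.exp ((θ - 1) * N / 2 ^ Q.D true)) / θ ^ Q.K := by gcongr
  calc _ ≤ 64 * M / 2 ^ R + (64 * M / 2 ^ R +
        M * (2 ^ Q.D true * Real.exp ((θ - 1) * N / 2 ^ Q.D true)) / θ ^ Q.K) := by linarith
    _ = _ := by ring

/-! ### Encodings of the user memory -/

theorem hasCode_perm {e : ℕ} (he : Fintype.card Q.Ent ≤ 2 ^ e) :
    HasCode Q.PermState fun p => 3 * Q.l + (p.stash.card * (e + 1) + 1) := by
  have h1 : HasCode Q.Lab fun _ => Q.l := HasCode.of_card (by simp)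
  have h2 : HasCode (Bool → Q.Lab) fun _ => 2 * Q.l :=
    HasCode.of_card (by simp [← pow_mul, mul_comm])
  have h3 := h1.prod (h2.prod (HasCode.of_card he).finset)
  refine (h3.comap (fun p : Q.PermState => (p.root, p.cnt, p.stash)) ?_).mono fun p => ?_
  · rintro ⟨a, b, c⟩ ⟨a', b', c'⟩ h
    simp only [Prod.mk.injEq] at h
    obtain ⟨rfl, rfl, rfl⟩ := h
    rfl
  · simp only; omega

theorem hasCode_temp (hN : N ≤ 2 ^ B) (hS : S ≤ 2 ^ B) :
    HasCode (Q.TempState × Progress B S) fun x =>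
      (3 * B + Q.l * (Q.h + 2) + Q.h + 3) + (x.2.size * (2 * B + 1) + 3) := by
  have hb : HasCode (Block B) fun _ => B := HasCode.of_card (by simp)
  have hs : HasCode (Fin S) fun _ => B := HasCode.of_card (by simpa using hS)
  have hn : HasCode (Fin N) fun _ => B := HasCode.of_card (by simpa using hN)
  have ho : HasCode Bool fun _ => 1 := HasCode.of_card (by simp)
  have hl : HasCode Q.Lab fun _ => Q.l := HasCode.of_card (by simp)
  have hc : HasCode (Fin (Q.h + 1) → Q.Lab) fun _ => Q.l * (Q.h + 1) :=
    HasCode.of_card (by simp [← pow_mul])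
  have hr : HasCode (Fin (2 * Q.h + 3)) fun _ => Q.h + 2 := by
    refine HasCode.of_card ?_
    rw [Fintype.card_fin]
    have : Q.h + 1 ≤ 2 ^ Q.h := Nat.lt_two_pow_self
    rw [pow_add]
    omega
  have hreq := (ho.prod (hn.prod hb)).comap
    (fun r : Request N B => ((match r.op with | Op.read => false | Op.write => true), r.addr, r.val))
    (by
      rintro ⟨_ | _, a, v⟩ ⟨_ | _, a', v'⟩ h <;> simp at h ⊢ <;> exact h)
  have ht := (hreq.prod (hc.prod (hr.prod (hl.prod hb)))).comap
    (fun t : Q.TempState => (t.req, t.coins, t.round, t.label, t.answer)) (by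
      rintro ⟨a, b, c, d, e⟩ ⟨a', b', c', d', e'⟩ h
      simp only [Prod.mk.injEq] at h
      obtain ⟨rfl, rfl, rfl, rfl, rfl⟩ := h
      rfl)
  have hp := (hs.list.prod (hs.prod hb).list).sum (hs.prod hb).list
  refine (ht.prod hp).mono ?_
  rintro ⟨t, ⟨A, w⟩ | w⟩
  · simp only [Progress.size, Sum.elim_inl]
    nlinarith
  · simp only [Progress.size, Sum.elim_inr]
    nlinarith

end Scheme

/-! ### Complete accesses, and schemes as label models. -/

namespace Scheme

open TrieBlock

variable {B N S : ℕ} (Q : Scheme B N S)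

/-- The number of cells of the nodes on a path. -/
def pathLen (b : Bool) : ℕ := ∑ d ∈ Finset.Icc 1 (Q.D b), Q.ncell b d

/-- The topmost block. -/
def top : Q.U := path Q.β Q.h ⟨0, Q.N_pos⟩ (Fin.last _)

theorem path_last_eq_top (a : Fin N) : path Q.β Q.h a (Fin.last _) = Q.top :=
  path_last Q.le_pow _ _

/-- The times after the initialization. -/
def initTimes : Q.Times := ⟨fun _ => 2 ^ Q.l, fun _ => 0⟩

theorem initTimes_valid : Q.initTimes.Valid :=
  ⟨⟨fun _ => le_rfl, fun _ => Nat.zero_le _, fun _ _ _ _ h => absurd h (lt_irrefl _)⟩,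
    fun _ => Nat.two_pow_pos _⟩

variable {Q}

/-- The times after an access. -/
def Times.next (g : Q.Times) (a : Fin N) : Q.Times :=
  ⟨Q.cntAt g.cnt (2 * Q.h + 2), g.lstAt a (2 * Q.h + 2)⟩

theorem Times.Valid.next {g : Q.Times} (hg : g.Valid) (a : Fin N) : (g.next a).Valid :=
  ⟨(hg.at a _).1, fun u => (hg.at a _).2 u (Or.inl (by omega))⟩

open Classical in
/-- The initial content of a block of the position map. -/
noncomputable def initLabels (l : Q.U → Q.Lab) (u : Q.U) (s : ℕ) : Q.Lab :=
  if h : ∃ w, IsParent u w ∧ w.slot = s then l h.choose else Q.toLab 0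

theorem initLabels_slot (l : Q.U → Q.Lab) {u w : Q.U} (h : IsParent u w) :
    initLabels l u w.slot = l w := by
  have h' : ∃ w', IsParent u w' ∧ w'.slot = w.slot := ⟨w, h, rfl⟩
  rw [initLabels, dif_pos h']
  exact congrArg l (h'.choose_spec.1.child_unique h h'.choose_spec.2)

/-- The initial state. -/
noncomputable def initState (D : Store N B) (l : Q.U → Q.Lab) : Q.State where
  lam := l
  val u := if u.height = 0 then D u.1.2 else Q.put (initLabels l u)
  lev := (exists_isGreedy Finset.univ (fun u : Q.U => Q.D (tree u))
    (fun u d => (tree u, (l u).val % 2 ^ d)) fun d v => Q.cap v.1 d).choose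

theorem placed_initState (D : Store N B) (l : Q.U → Q.Lab) (lst : Q.U → ℕ) (cnt : Bool → ℕ) :
    Placed tree Q.D Q.cap (initState D l).labels (initState D l).lev lst cnt :=
  Placed.initial (exists_isGreedy Finset.univ (fun u : Q.U => Q.D (tree u))
    (fun u d => (tree u, (l u).val % 2 ^ d)) fun d v => Q.cap v.1 d).choose_spec

theorem linked_initState (D : Store N B) (l : Q.U → Q.Lab) :
    Q.Linked (l Q.top) (initState D l).val l := by
  refine ⟨fun u hu => ?_, fun w u hwu => ?_⟩
  · rw [eq_path_last Q.le_pow ⟨0, Q.N_pos⟩ hu.ge]; rfl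
  · have hw : w.height ≠ 0 := by
      have := hwu.1
      omega
    simp only [initState, if_neg hw]
    rw [Q.get_put _ _ (slot_lt Q.β_pos u), initLabels_slot l hwu]

theorem db_initState (D : Store N B) (l : Q.U → Q.Lab) : (initState D l).db = D := by
  funext a
  simp only [State.db, initState, height_path, Fin.val_zero, if_true]
  congr 1
  exact Fin.ext (by simp [path])

section Access

variable {g : Q.Times} {σ₀ σ : Q.State} {r : Request N B} {ξ : Fin (Q.h + 1) → Q.Lab} {j : ℕ}
  {x : Q.PermState × Q.TempState × Store S B}

theorem stage_zero (hp : Placed tree Q.D Q.cap σ₀.labels σ₀.lev g.lst g.cnt)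
    (hl : Q.Linked (σ₀.lam Q.top) σ₀.val σ₀.lam) :
    Stage g σ₀ r ξ 0
      ((Q.machine.start (σ₀.perm (σ₀.lam Q.top) g.cnt) r ξ).1,
        (Q.machine.start (σ₀.perm (σ₀.lam Q.top) g.cnt) r ξ).2, Q.store σ₀.node) σ₀ := by
  have hempty : ∀ u, override σ₀.lam (path Q.β Q.h r.addr) ∅ ξ u = σ₀.lam u := fun u =>
    override_of_notMem _ _ (by simp)
  have hc : Q.changed 0 = ∅ := by
    ext i
    simp only [changed, Finset.mem_filter, Finset.mem_univ, true_and, Finset.notMem_empty,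
      iff_false]
    omega
  -- The new label of the top block is recorded at the start, before any block is relabelled.
  have hr : Q.recorded 0 = insert (Fin.last _) ∅ := by
    ext i
    simp only [recorded, Finset.mem_filter, Finset.mem_univ, true_and, Finset.mem_insert,
      Finset.notMem_empty, or_false, Fin.ext_iff, Fin.val_last]
    omega
  constructor
  · rfl
  · rfl
  · rfl
  · rfl
  · rfl
  · intro _
    show σ₀.lam Q.top = _
    rw [← Q.path_last_eq_top r.addr]
    congr 1
  · exact hp
  · rw [hc]
    funext u
    exact (hempty u).symm
  · rw [hr, override_insert (path_injective r.addr)]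
    refine ⟨fun u hu => ?_, fun w u hwu => ?_⟩
    · rw [eq_path_last Q.le_pow r.addr hu.ge, Function.update_self]
    · rw [Function.update_of_ne, hempty, hl.get_eq w u hwu]
      rintro rfl
      have := hwu.1
      have := w.height_le
      simp only [height_path, Fin.val_last] at *
      omega
  · rfl
  · intro h; omega

theorem Stage.exists_iterate (h : Stage g σ₀ r ξ 0 x σ₀) (hj : j ≤ 2 * Q.h + 2) :
    ∃ σ, Stage g σ₀ r ξ j (Q.machine.round^[j] x) σ := by
  induction j with
  | zero => exact ⟨σ₀, h⟩
  | succ j ih =>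
    obtain ⟨σ, hσ⟩ := ih (by omega)
    have hx : Q.machine.round^[j + 1] x = Q.machine.round (Q.machine.round^[j] x) :=
      Function.iterate_succ_apply' _ _ _
    refine hx ▸ ?_
    rcases Nat.mod_two_eq_zero_or_one j with h2 | h2
    · obtain ⟨v, hv⟩ := hσ.access h2 (by omega)
      exact ⟨_, hv⟩
    · exact ⟨_, hσ.evict h2⟩

/-- The cells of a round, from the eviction counters and the labels. -/
noncomputable def roundCells (Q : Scheme B N S) (c : Bool → ℕ) (ρ : Fin (Q.h + 1) → Q.Lab)
    (j : ℕ) : List (Fin S) :=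
  Q.pathCells (Q.treeAt j)
    (if j % 2 = 0 then (ρ (Q.levelAt j)).val else Q.cntAt c j (Q.treeAt j) % 2 ^ Q.l)

/-- Only counters and labels from before the access enter. This is why the addresses are a function
of the clock and the revealed labels. -/
theorem Stage.cells (h : Stage g σ₀ r ξ j x σ) (hj : j < 2 * Q.h + 2) :
    Q.machine.cells x.1 x.2.1 =
      Q.roundCells g.cnt (fun i => σ₀.lam (path Q.β Q.h r.addr i)) j := by
  show Q.pathCells (Q.treeAt x.2.1.round) (leafAt x.1 x.2.1) = _
  rw [roundCells, leafAt, h.round]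
  by_cases h2 : j % 2 = 0
  · have : Q.levelAt (j + 1) = Q.levelAt j := Fin.ext (by simp only [levelAt]; omega)
    rw [if_pos h2, if_pos h2, h.label (by omega), this]
  · rw [if_neg h2, if_neg h2, h.perm]
    rfl

theorem Stage.done (h : Stage g σ₀ r ξ j x σ) (hj : j < 2 * Q.h + 2) :
    Q.machine.done x.2.1 = none := by
  show (if x.2.1.round.val = 2 * Q.h + 2 then _ else _) = _
  rw [h.round, if_neg hj.ne]

theorem Stage.done_last (h : Stage g σ₀ r ξ (2 * Q.h + 2) x σ) :
    Q.machine.done x.2.1 = some (σ₀.db r.addr) := by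
  show (if x.2.1.round.val = 2 * Q.h + 2 then some x.2.1.answer else _) = _
  rw [h.round, if_pos rfl, h.answer (by omega)]

theorem changed_last : Q.changed (2 * Q.h + 2) = Finset.univ := by
  ext i
  simp only [changed, Finset.mem_filter, Finset.mem_univ, true_and, iff_true]
  omega

theorem recorded_last : Q.recorded (2 * Q.h + 2) = Finset.univ := by
  ext i
  simp only [recorded, Finset.mem_filter, Finset.mem_univ, true_and, iff_true]
  omega

theorem Stage.root_last (h : Stage g σ₀ r ξ (2 * Q.h + 2) x σ) : ξ (Fin.last _) = σ.lam Q.top := by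
  rw [h.lam, changed_last, ← Q.path_last_eq_top r.addr,
    override_apply (path_injective r.addr) _ _ (Finset.mem_univ _)]

theorem Stage.linked_last (h : Stage g σ₀ r ξ (2 * Q.h + 2) x σ) :
    Q.Linked (σ.lam Q.top) σ.val σ.lam := by
  have h1 := h.linked
  rw [recorded_last, ← changed_last, ← h.lam, h.root_last] at h1
  exact h1

theorem length_roundCells (c : Bool → ℕ) (ρ : Fin (Q.h + 1) → Q.Lab) (j : ℕ) :
    (Q.roundCells c ρ j).length = Q.pathLen (Q.treeAt j) := Q.length_pathCells _ _

/-- The factor `4`: each block takes an access and an eviction round, and each round reads and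
writes its path. -/
theorem length_flatMap_roundCells (c : Bool → ℕ) (ρ : Fin (Q.h + 1) → Q.Lab) :
    ((List.range (2 * Q.h + 2)).flatMap fun j => Q.roundCells c ρ j ++ Q.roundCells c ρ j).length =
      4 * (Q.h * Q.pathLen false + Q.pathLen true) := by
  rw [List.length_flatMap]
  simp only [List.length_append, length_roundCells]
  have h1 : (List.map (fun j => Q.pathLen (Q.treeAt j) + Q.pathLen (Q.treeAt j))
      (List.range (2 * Q.h + 2))).sum = ∑ j ∈ Finset.range (2 * Q.h + 2),
        (Q.pathLen (Q.treeAt j) + Q.pathLen (Q.treeAt j)) := rfl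
  have h2 : ∀ j ∈ Finset.range (2 * Q.h), Q.pathLen (Q.treeAt j) + Q.pathLen (Q.treeAt j) =
      2 * Q.pathLen false := by
    intro j hj
    rw [Finset.mem_range] at hj
    have : Q.treeAt j = false := by simp only [treeAt, decide_eq_false_iff_not]; omega
    rw [this]; ring
  have h3 : Q.treeAt (2 * Q.h) = true := by simp [treeAt]
  have h4 : Q.treeAt (2 * Q.h + 1) = true := by simp only [treeAt, decide_eq_true_eq]; omega
  rw [h1, Finset.sum_range_succ, Finset.sum_range_succ, Finset.sum_congr rfl h2, h3, h4,
    Finset.sum_const, Finset.card_range, smul_eq_mul]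
  ring

end Access

/-- A bound for the length of the temporary memory. -/
def tempBits (Q : Scheme B N S) : ℕ :=
  (3 * B + Q.l * (Q.h + 2) + Q.h + 3) + ((Q.pathLen false + Q.pathLen true) * (2 * B + 1) + 3)

/-- The length of the permanent memory with `2 R` blocks of `e` bits in the stash. -/
def permBits (Q : Scheme B N S) (e R : ℕ) : ℕ := 3 * Q.l + (2 * R * (e + 1) + 1)

theorem lt_card_of_permBits_lt {e R k : ℕ} (h : Q.permBits e R < 3 * Q.l + (k * (e + 1) + 1)) :
    2 * R < k := by
  by_contra hk
  have := Nat.mul_le_mul_right (e + 1) (not_lt.1 hk)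
  rw [permBits] at h
  omega

theorem pathLen_le (b : Bool) : Q.pathLen b ≤ Q.pathLen false + Q.pathLen true := by
  cases b <;> simp

/-- The initialization. -/
noncomputable def setup (Q : Scheme B N S) (D : Store N B) : PMF (Q.machine.Perm × Store S B) :=
  (PMF.uniformOfFintype (Q.U → Q.Lab)).map fun l =>
    ((initState D l).perm (l Q.top) Q.initTimes.cnt, Q.store (initState D l).node)

/-- The simulator of a scheme, in terms of the labels. -/
noncomputable def labelModel (Q : Scheme B N S) {e : ℕ} {ep : Q.machine.Perm → List Bool}
    {et : Q.machine.Temp × Progress B S → List Bool} (hep : Function.Injective ep)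
    (het : Function.Injective et)
    (hpl : ∀ p : Q.PermState, (ep p).length ≤ 3 * Q.l + (p.stash.card * (e + 1) + 1))
    (htl : ∀ t q, q.size ≤ Q.pathLen false + Q.pathLen true → (et (t, q)).length ≤ Q.tempBits) :
    LabelModel (Q.machine.simulator ep et Q.setup
      ((2 * Q.h + 2) * (2 * (Q.pathLen false + Q.pathLen true)))) where
  U := Q.U
  Λ := Q.Lab
  I := Fin (Q.h + 1)
  St := Q.State
  G := Q.Times
  Clock := Bool → ℕ
  Inv g σ := Placed tree Q.D Q.cap σ.labels σ.lev g.lst g.cnt ∧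
    Q.Linked (σ.lam Q.top) σ.val σ.lam
  lam := State.lam
  permE g σ := ep (σ.perm (σ.lam Q.top) g.cnt)
  servE σ := Q.store σ.node
  db := State.db
  path := path Q.β Q.h
  path_inj := path_injective
  g₀ := Q.initTimes
  next g r := g.next r.addr
  time := Times.cnt
  tick c := Q.cntAt c (2 * Q.h + 2)
  init := initState
  addrs c ρ := (List.range (2 * Q.h + 2)).flatMap fun j =>
    Q.roundCells c ρ j ++ Q.roundCells c ρ j
  tempBits := Q.tempBits
  permBits := Q.permBits e
  -- The permanent memory takes one value before each of the `2 * Q.h + 2` rounds and one after the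
  -- last.
  stages := 2 * Q.h + 3
  changed := Q.changed
  bad₀ R := Q.Overflow Q.initTimes.cnt Q.initTimes.lst R
  bad R g r k := Q.Overflow (Q.cntAt g.cnt k) (g.lstAt r.addr k) R
  time_next _ _ := rfl
  setup D := by
    show (Q.setup D).map _ = _
    rw [Scheme.setup, PMF.map_comp]
    rfl
  inv_init D l := ⟨placed_initState D l _ _, linked_initState D l⟩
  lam_init _ _ := rfl
  db_init := db_initState
  bad_init D l R h :=
    overflow_of_lt (placed_initState D l _ _) (lt_card_of_permBits_lt (h.trans_le (hpl _)))
  access := by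
    rintro g σ r ⟨hp, hl⟩
    set x : (Fin (Q.h + 1) → Q.Lab) → Q.PermState × Q.TempState × Store S B := fun ξ =>
      ((Q.machine.start (σ.perm (σ.lam Q.top) g.cnt) r ξ).1,
        (Q.machine.start (σ.perm (σ.lam Q.top) g.cnt) r ξ).2, Q.store σ.node) with hx
    have hs : ∀ ξ j, j ≤ 2 * Q.h + 2 →
        ∃ σ', Stage g σ r ξ j (Q.machine.round^[j] (x ξ)) σ' := fun ξ j hj =>
      (stage_zero (r := r) (ξ := ξ) hp hl).exists_iterate hj
    have : Nonempty Q.State := ⟨σ⟩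
    choose! τ hτ using hs
    have hcell : ∀ ξ, ∀ j < 2 * Q.h + 2,
        Q.machine.cells (Q.machine.round^[j] (x ξ)).1 (Q.machine.round^[j] (x ξ)).2.1 =
          Q.roundCells g.cnt (fun i => σ.lam (TrieBlock.path Q.β Q.h r.addr i)) j :=
      fun ξ j hj => (hτ ξ j hj.le).cells hj
    have key := fun ξ => Q.machine.runs_rounds (setup := Q.setup)
      (budget := (2 * Q.h + 2) * (2 * (Q.pathLen false + Q.pathLen true)))
      (kmax := Q.pathLen false + Q.pathLen true) hep het
      (2 * Q.h + 2) (fun j => Q.machine.round^[j] (x ξ)) (σ.db r.addr)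
      (fun j _ => Function.iterate_succ_apply' _ _ _)
      (fun j hj => (hτ ξ j hj.le).done hj) (hτ ξ _ le_rfl).done_last
      (fun j hj => by rw [hcell ξ j hj]; exact Q.pathCells_ne_nil _ _)
      (fun j hj => by rw [hcell ξ j hj, length_roundCells]; exact pathLen_le _)
    choose a h1 h2 h3 h4 h5 h6 using key
    refine ⟨a, fun ξ => τ ξ (2 * Q.h + 2), Q.machine.access_eq hep _ _ _ a h1, fun ξ => ?_⟩
    have hlast := hτ ξ _ le_rfl
    refine ⟨⟨hlast.placed, hlast.linked_last⟩, ?_, ?_, h2 ξ, ?_, ?_, ?_, ?_, ?_⟩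
    · rw [h5, hlast.perm, hlast.root_last]; rfl
    · rw [h6, hlast.store]
    · rw [hlast.db, if_neg (by omega)]
    · rw [hlast.lam, changed_last]
    · rw [h3]
      refine List.flatMap_congr fun j hj => ?_
      rw [hcell ξ j (List.mem_range.1 hj)]
    · intro m hm
      obtain ⟨j, -, q, hq, rfl⟩ := h4 ξ m hm
      exact htl _ q hq
    · intro m hm R hR
      obtain ⟨j, hj, q, hq, rfl⟩ := h4 ξ m hm
      refine ⟨j, by omega, ?_⟩
      have hst := hτ ξ j hj
      rw [← hst.lam]
      refine overflow_of_lt hst.placed (lt_card_of_permBits_lt (hR.trans_le ?_))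
      have := hpl (Q.machine.round^[j] (x ξ)).1
      rw [hst.perm] at this
      refine le_trans (le_of_eq ?_) this
      show (ep (Q.machine.round^[j] (x ξ)).1).length = _
      rw [hst.perm]

/-- The simulator of a scheme. -/
theorem exists_simulator (Q : Scheme B N S) {e : ℕ} (he : Fintype.card Q.Ent ≤ 2 ^ e)
    (hN : N ≤ 2 ^ B) (hS : S ≤ 2 ^ B)
    (hU : (Finset.univ.filter fun u : Q.U => tree u = false).card ≤ 2 * 2 ^ Q.D false) :
    ∃ O : Simulator B N S, O.Correct ∧ O.Secure ∧
      O.BandwidthAtMost ((4 * (Q.h * Q.pathLen false + Q.pathLen true) : ℕ) : ℝ) ∧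
      (∀ D rs, ∀ x ∈ (O.execution D rs).support, ∀ a ∈ x.2, ∀ m ∈ a.memories,
        m.temp.length ≤ Q.tempBits) ∧
      ∀ (R : ℕ) (θ : ℝ), 1 ≤ θ → ∀ D rs,
        (O.execution D rs).toOuterMeasure
          {x | Q.permBits e R < x.1.length ∨
            ∃ a ∈ x.2, ∃ m ∈ a.memories, Q.permBits e R < m.perm.length} ≤
          ENNReal.ofReal (Q.overflowBound R θ) +
            rs.length * ((2 * Q.h + 3 : ℕ) * ENNReal.ofReal (Q.overflowBound R θ)) := by
  classical
  obtain ⟨ep, hep, hpl⟩ := (Q.hasCode_perm he).exists_injective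
  obtain ⟨et, het, htl⟩ := (Q.hasCode_temp hN hS).exists_injective
  have htl' : ∀ t q, q.size ≤ Q.pathLen false + Q.pathLen true →
      (et (t, q)).length ≤ Q.tempBits := by
    intro t q hq
    refine (htl (t, q)).trans ?_
    have := Nat.mul_le_mul_right (2 * B + 1) hq
    rw [tempBits]
    simp only
    omega
  let L := Q.labelModel (e := e) hep het hpl htl'
  refine ⟨_, L.correct, L.secure, ?_, ?_, ?_⟩
  · intro D rs x hx a ha
    obtain ⟨⟨c, ρ, hc⟩, -⟩ := L.execution_bounds hx a ha
    rw [hc]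
    exact_mod_cast (length_flatMap_roundCells c ρ).le
  · intro D rs x hx a ha
    exact (L.execution_bounds hx a ha).2
  · intro R θ hθ D rs
    exact L.toOuterMeasure_execution_le R _ Times.Valid Q.initTimes_valid
      (fun g r hg => hg.next r.addr) (average_overflow_le hU Q.initTimes_valid.1 R hθ)
      (fun g r k hg => average_overflow_le hU (hg.at r.addr k).1 R hθ) D rs

end Scheme

/-! ### Encodings of nodes -/

/-- A set of at most `k` elements is determined by a function from `Fin k` to `Option α`. -/
theorem card_finset_card_le {α : Type} [Fintype α] (k : ℕ) :
    Fintype.card {E : Finset α // E.card ≤ k} ≤ (Fintype.card α + 1) ^ k := by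
  classical
  have h : Function.Injective fun (E : {E : Finset α // E.card ≤ k}) (i : Fin k) =>
      E.1.toList[i.val]? := by
    rintro ⟨E, hE⟩ ⟨E', hE'⟩ h
    have h1 : E.toList = E'.toList := by
      refine List.ext_getElem? fun i => ?_
      by_cases hi : i < k
      · exact congrFun h ⟨i, hi⟩
      · rw [List.getElem?_eq_none, List.getElem?_eq_none]
        · rw [Finset.length_toList]; omega
        · rw [Finset.length_toList]; omega
    refine Subtype.ext (Finset.ext fun a => ?_)
    rw [← Finset.mem_toList, h1, Finset.mem_toList]
  simpa using Fintype.card_le_of_injective _ h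

open Classical in
-- A node is encoded as a whole, by counting, so entries need not be aligned with cells. Rounding is
-- paid once per node and not once per entry, which is essential for the space bound.
theorem exists_finset_code {α : Type} [Fintype α] {e k m B : ℕ}
    (he : Fintype.card α + 1 ≤ 2 ^ e) (hm : k * e ≤ m * B) :
    ∃ (enc : Finset α → ℕ → Block B) (dec : (ℕ → Block B) → Finset α),
      ∀ E v, E.card ≤ k → (∀ c < m, v c = enc E c) → dec v = E := by
  have hcard : Fintype.card {E : Finset α // E.card ≤ k} ≤ Fintype.card (Fin m → Block B) := by
    refine (card_finset_card_le k).trans ((Nat.pow_le_pow_left he k).trans ?_)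
    rw [← pow_mul]
    simp only [Fintype.card_pi, Fintype.card_bool, Finset.prod_const, Finset.card_univ,
      Fintype.card_fin, ← pow_mul]
    exact Nat.pow_le_pow_right (by omega) (by linarith [mul_comm e k, mul_comm m B])
  obtain ⟨φ⟩ := Function.Embedding.nonempty_of_card_le hcard
  set enc : Finset α → ℕ → Block B := fun E c =>
    if h : E.card ≤ k ∧ c < m then φ ⟨E, h.1⟩ ⟨c, h.2⟩ else fun _ => false with henc
  refine ⟨enc, fun v => if h : ∃ E : Finset α, E.card ≤ k ∧ ∀ c < m, v c = enc E c
    then h.choose else ∅, fun E v hE hv => ?_⟩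
  have h : ∃ E : Finset α, E.card ≤ k ∧ ∀ c < m, v c = enc E c := ⟨E, hE, hv⟩
  beta_reduce
  rw [dif_pos h]
  have hs := h.choose_spec
  have : φ ⟨h.choose, hs.1⟩ = φ ⟨E, hE⟩ := by
    funext c
    have h1 := hs.2 c c.2
    rw [hv c c.2] at h1
    simp only [henc, hs.1, hE, c.2, true_and, dif_pos] at h1
    exact h1.symm
  exact congrArg Subtype.val (φ.injective this)

theorem exists_label_code {β l B : ℕ} (h : β * l ≤ B) :
    ∃ (get : Block B → ℕ → Fin (2 ^ l)) (put : (ℕ → Fin (2 ^ l)) → Block B),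
      ∀ f, ∀ s < β, get (put f) s = f s := by
  have hcard : Fintype.card (Fin β → Fin (2 ^ l)) ≤ Fintype.card (Block B) := by
    simp only [Fintype.card_pi, Fintype.card_bool, Finset.prod_const, Finset.card_univ,
      Fintype.card_fin, ← pow_mul]
    exact Nat.pow_le_pow_right (by omega) (by linarith [mul_comm l β])
  obtain ⟨φ⟩ := Function.Embedding.nonempty_of_card_le hcard
  have : Nonempty (Fin (2 ^ l)) := ⟨⟨0, by positivity⟩⟩
  refine ⟨fun v s => if h : s < β then Function.invFun φ v ⟨s, h⟩ else ⟨0, by positivity⟩,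
    fun f => φ fun s => f s, fun f s hs => ?_⟩
  beta_reduce
  rw [dif_pos hs, Function.leftInverse_invFun φ.injective]

theorem exists_injOn_fin {α : Type} (T : Finset α) {S : ℕ} (hS : 0 < S) (h : T.card ≤ S) :
    ∃ a : α → Fin S, Set.InjOn a T := by
  classical
  have hcard : Fintype.card T ≤ Fintype.card (Fin S) := by simpa using h
  obtain ⟨φ⟩ := Function.Embedding.nonempty_of_card_le hcard
  refine ⟨fun x => if h : x ∈ T then φ ⟨x, h⟩ else ⟨0, hS⟩, fun x hx y hy hxy => ?_⟩
  rw [Finset.mem_coe] at hx hy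
  simp only [dif_pos hx, dif_pos hy] at hxy
  exact congrArg Subtype.val (φ.injective hxy)

theorem sum_Icc_two_pow (D : ℕ) : ∑ d ∈ Finset.Icc 1 D, 2 ^ d + 2 = 2 ^ (D + 1) := by
  induction D with
  | zero => simp
  | succ D ih =>
    rw [Finset.sum_Icc_succ_top (by omega), pow_succ 2 (D + 1)]
    omega

namespace TrieBlock

variable {N β h : ℕ}

/-- Height `i` has at most `N / β ^ i + 1` blocks: a geometric sum, plus `h` for rounding. -/
theorem card_tree_false_le (hβ : 2 ≤ β) :
    (Finset.univ.filter fun u : TrieBlock N β h => tree u = false).card ≤ N / (β - 1) + h := by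
  calc _ ≤ ((Finset.Ico 1 (h + 1)).sigma fun i => Finset.range (N / β ^ i + 1)).card := by
        refine Finset.card_le_card_of_injOn (fun u => ⟨u.height, u.index⟩) ?_ ?_
        · intro u hu
          simp only [Finset.coe_filter, Finset.mem_univ, true_and, Set.mem_ofPred_eq, tree,
            decide_eq_false_iff_not] at hu
          have h1 := u.height_le
          have h2 : u.index ≤ N / β ^ u.height :=
            (Nat.le_div_iff_mul_le (by positivity)).2 u.index_mul_lt.le
          simp only [Finset.coe_sigma, Set.mem_sigma_iff, Finset.coe_Ico, Set.mem_Ico,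
            Finset.coe_range, Set.mem_Iio]
          omega
        · intro u _ w _ huw
          simp only [Sigma.mk.injEq, heq_eq_eq] at huw
          exact TrieBlock.ext' huw.1 huw.2
    _ = ∑ i ∈ Finset.Ico 1 (h + 1), N / β ^ i + h := by
        rw [Finset.card_sigma]
        simp [Finset.sum_add_distrib]
    _ ≤ _ := Nat.add_le_add_right (Nat.geom_sum_Ico_le hβ N (h + 1)) h

theorem card_le (hβ : 2 ≤ β) : Fintype.card (TrieBlock N β h) ≤ N + (N / (β - 1) + h) := by
  have h1 : (Finset.univ.filter fun u : TrieBlock N β h => ¬ tree u = false).card ≤ N := by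
    calc _ ≤ (Finset.univ : Finset (Fin N)).card := by
          refine Finset.card_le_card_of_injOn (fun u => u.1.2) (fun _ _ => Finset.mem_univ _) ?_
          intro u hu w hw huw
          simp only [Finset.coe_filter, Finset.mem_univ, true_and, Set.mem_ofPred_eq, tree,
            decide_eq_false_iff_not, not_not] at hu hw
          exact TrieBlock.ext' (hu.trans hw.symm) (congrArg Fin.val huw)
      _ = N := by simp
  have h2 := card_tree_false_le (N := N) (h := h) hβ
  rw [← Finset.card_univ, ← Finset.card_filter_add_card_filter_not (fun u => tree u = false)]
  omega

end TrieBlock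

namespace Scheme

open TrieBlock

/-- The capacity of a node if the leaves of the data tree hold `K` blocks. -/
def capOf (K : ℕ) (D : Bool → ℕ) (b : Bool) (d : ℕ) : ℕ := if b = true ∧ d = D true then K else 5

section Counting

variable {B e K : ℕ} {D : Bool → ℕ}

theorem cells_five_le (he : e ≤ 2 * B) : 5 * e / B + 1 ≤ 11 := by
  have : 5 * e / B ≤ 10 := Nat.div_le_of_le_mul (by linarith)
  omega

theorem cells_le (he : e ≤ 2 * B) : K * e / B + 1 ≤ 2 * K + 1 := by
  have : K * e / B ≤ 2 * K := Nat.div_le_of_le_mul (by nlinarith)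
  omega

theorem sum_false (w : ℕ → ℕ) (he : e ≤ 2 * B) :
    ∑ d ∈ Finset.Icc 1 (D false), w d * (capOf K D false d * e / B + 1) ≤
      (∑ d ∈ Finset.Icc 1 (D false), w d) * 11 := by
  rw [Finset.sum_mul]
  refine Finset.sum_le_sum fun d _ => Nat.mul_le_mul_left _ ?_
  simpa [capOf] using cells_five_le he

theorem sum_true (w : ℕ → ℕ) (he : e ≤ 2 * B) (hD : 0 < D true) :
    ∑ d ∈ Finset.Icc 1 (D true), w d * (capOf K D true d * e / B + 1) ≤
      (∑ d ∈ Finset.Icc 1 (D true - 1), w d) * 11 + w (D true) * (K * e / B + 1) := by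
  obtain ⟨D', hD'⟩ : ∃ D', D true = D' + 1 := ⟨D true - 1, by omega⟩
  rw [hD', Finset.sum_Icc_succ_top (by omega), Nat.add_sub_cancel, Finset.sum_mul]
  refine add_le_add (Finset.sum_le_sum fun d hd => Nat.mul_le_mul_left _ ?_) ?_
  · have : d ≠ D' + 1 := by
      have := (Finset.mem_Icc.1 hd).2
      omega
    simpa [capOf, hD', this] using cells_five_le he
  · simp [capOf, hD']

end Counting

/-- A simulator with explicit parameters. -/
theorem exists_simulator_of_le {B N S l h β K M Dt : ℕ} (hN0 : 0 < N) (hβ : 2 ≤ β)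
    (hNβ : N ≤ β ^ h) (hβl : β * l ≤ B) (hlB : 2 * l + 1 ≤ B) (hDt : 0 < Dt) (hDtl : Dt ≤ l)
    (hM : N / (β - 1) + h ≤ M) (hM2 : 2 ≤ M) (hNM : N + M ≤ 2 ^ l) (hhl : h ≤ l)
    (hN : N ≤ 2 ^ B) (hS : S ≤ 2 ^ B)
    (hcells : 22 * M + 2 ^ Dt * (K * (B + 2 * l + 1) / B + 12) ≤ S) :
    ∃ O : Simulator B N S, O.Correct ∧ O.Secure ∧
      O.BandwidthAtMost ((4 * (11 * l * l + (11 * l + (2 * K + 1))) : ℕ) : ℝ) ∧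
      (∀ D rs, ∀ x ∈ (O.execution D rs).support, ∀ a ∈ x.2, ∀ m ∈ a.memories,
        m.temp.length ≤ 3 * B + l * (l + 2) + l + 3 +
          ((11 * l + (11 * l + (2 * K + 1))) * (2 * B + 1) + 3)) ∧
      ∀ (R : ℕ) (θ : ℝ), 1 ≤ θ → ∀ D rs,
        (O.execution D rs).toOuterMeasure
          {x | 3 * l + (2 * R * (B + 2 * l + 2) + 1) < x.1.length ∨
            ∃ a ∈ x.2, ∃ m ∈ a.memories, 3 * l + (2 * R * (B + 2 * l + 2) + 1) < m.perm.length} ≤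
          ENNReal.ofReal (128 / 2 ^ R + 2 ^ Dt * Real.exp ((θ - 1) * N / 2 ^ Dt) / θ ^ K) +
            rs.length * ((2 * l + 3 : ℕ) *
              ENNReal.ofReal (128 / 2 ^ R + 2 ^ Dt * Real.exp ((θ - 1) * N / 2 ^ Dt) / θ ^ K)) := by
  have hB : 0 < B := by omega
  have hU : Fintype.card (TrieBlock N β h) ≤ 2 ^ l := (card_le hβ).trans (by omega)
  have hent : Fintype.card (Entry B N l β h) ≤ 2 ^ (B + 2 * l) := by
    simp only [Fintype.card_prod, Fintype.card_fin, Fintype.card_pi, Fintype.card_bool,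
      Finset.prod_const, Finset.card_univ]
    calc _ ≤ 2 ^ l * (2 ^ l * 2 ^ B) := Nat.mul_le_mul_right _ hU
      _ = _ := by rw [← pow_add, ← pow_add]; congr 1; omega
  have he : Fintype.card (Entry B N l β h) + 1 ≤ 2 ^ (B + 2 * l + 1) := by
    have := Nat.one_le_two_pow (n := B + 2 * l)
    rw [pow_succ]
    omega
  have he2 : B + 2 * l + 1 ≤ 2 * B := by omega
  -- This depth gives at most two position-map blocks per leaf and fewer than `2 M` nodes, of at
  -- most `11` cells each; hence the `22 * M` in `hcells`.
  set Df := Nat.log 2 M with hDf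
  have hDf1 : 2 ^ Df ≤ M := Nat.pow_log_le_self 2 (by omega)
  have hDf2 : M < 2 ^ (Df + 1) := Nat.lt_pow_succ_log_self (by omega) M
  have hDf0 : 0 < Df := Nat.log_pos (by omega) hM2
  have hDfl : Df ≤ l := by
    have : 2 ^ Df ≤ 2 ^ l := by omega
    exact (Nat.pow_le_pow_iff_right (by omega)).1 this
  set D : Bool → ℕ := fun b => if b then Dt else Df with hD
  set nc : Bool → ℕ → ℕ := fun b d => capOf K D b d * (B + 2 * l + 1) / B + 1 with hnc
  have hcard : ((Finset.univ : Finset Bool).sigma fun b => (Finset.Icc 1 (D b)).sigma fun d =>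
      Finset.range (2 ^ d) ×ˢ Finset.range (nc b d)).card ≤ S := by
    refine le_trans ?_ hcells
    rw [Finset.card_sigma, Fintype.sum_bool]
    simp only [Finset.card_sigma, Finset.card_product, Finset.card_range, hnc]
    -- The fewer than `2 ^ Dt` inner nodes of the data tree cost at most `11` cells each, and
    -- rounding up the leaves one cell each; hence the `12` in `hcells`.
    refine (add_le_add (sum_true (fun d => 2 ^ d) he2 hDt)
      (sum_false (fun d => 2 ^ d) he2)).trans ?_
    have h1 := sum_Icc_two_pow (D true - 1)
    have h2 := sum_Icc_two_pow (D false)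
    have e1 : D true = Dt := rfl
    have e2 : D false = Df := rfl
    rw [e1] at h1 ⊢
    rw [e2] at h2 ⊢
    rw [Nat.sub_add_cancel hDt] at h1
    rw [pow_succ] at h2
    generalize K * (B + 2 * l + 1) / B = q
    rw [mul_add, mul_add]
    omega
  have hS0 : 0 < S := by
    have := (Nat.le_add_right _ _).trans hcells
    omega
  obtain ⟨get, put, hgp⟩ := exists_label_code hβl
  obtain ⟨addr, haddr⟩ := exists_injOn_fin _ hS0 hcard
  have hnode : ∀ b d, ∃ (enc : Finset (Entry B N l β h) → ℕ → Block B)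
      (dec : (ℕ → Block B) → Finset (Entry B N l β h)),
      ∀ E v, E.card ≤ capOf K D b d → (∀ c < nc b d, v c = enc E c) → dec v = E := by
    intro b d
    refine exists_finset_code he ?_
    have := Nat.lt_div_mul_add (a := capOf K D b d * (B + 2 * l + 1)) hB
    simp only [hnc]
    rw [add_mul, one_mul]
    exact this.le
  choose enc dec hdec using hnode
  let Q : Scheme B N S :=
    { l := l, h := h, β := β, K := K, D := D, ncell := nc, N_pos := hN0, β_pos := by omega
      le_pow := hNβ
      D_pos := by rintro (_ | _); exacts [hDf0, hDt]
      D_le := by rintro (_ | _); exacts [hDfl, hDtl]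
      ncell_pos := fun b d => Nat.succ_pos _
      get := get, put := put, get_put := hgp, addr := addr, addr_inj := haddr
      enc := enc, dec := dec, dec_enc := fun b d E v h1 h2 => hdec b d E v h1 h2 }
  have hf : Q.pathLen false ≤ 11 * l := by
    have := sum_false (K := K) (D := D) (fun _ => 1) he2
    simp only [one_mul, Finset.sum_const, Nat.card_Icc, smul_eq_mul, mul_one,
      Nat.add_sub_cancel] at this
    exact this.trans (by rw [mul_comm]; exact Nat.mul_le_mul_left _ hDfl)
  have ht : Q.pathLen true ≤ 11 * l + (2 * K + 1) := by
    have := sum_true (K := K) (D := D) (fun _ => 1) he2 hDt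
    simp only [one_mul, Finset.sum_const, Nat.card_Icc, smul_eq_mul, mul_one,
      Nat.add_sub_cancel] at this
    refine this.trans (add_le_add ?_ (cells_le he2))
    have : D true - 1 ≤ l := (Nat.sub_le _ _).trans hDtl
    omega
  obtain ⟨O, h1, h2, h3, h4, h5⟩ := Q.exists_simulator (e := B + 2 * l + 1)
    ((Nat.le_succ _).trans he) hN hS (by
      refine ((card_tree_false_le hβ).trans hM).trans ?_
      show M ≤ 2 * 2 ^ Df
      rw [pow_succ] at hDf2
      omega)
  refine ⟨O, h1, h2, ?_, ?_, ?_⟩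
  · intro D' rs x hx a ha
    refine (h3 D' rs x hx a ha).trans ?_
    have : Q.h * Q.pathLen false ≤ l * (11 * l) := Nat.mul_le_mul hhl hf
    exact_mod_cast Nat.mul_le_mul_left 4 (add_le_add (this.trans (le_of_eq (by ring))) ht)
  · intro D' rs x hx a ha m hm
    refine (h4 D' rs x hx a ha m hm).trans ?_
    have e1 : Q.h ≤ l := hhl
    have e2 : Q.l = l := rfl
    have e3 := Nat.mul_le_mul_right (2 * B + 1) (add_le_add hf ht)
    have e4 : l * (Q.h + 2) ≤ l * (l + 2) := Nat.mul_le_mul_left _ (by omega)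
    rw [tempBits, e2]
    omega
  · intro R θ hθ D' rs
    refine (h5 R θ hθ D' rs).trans ?_
    have e1 : Q.overflowBound R θ =
        128 / 2 ^ R + 2 ^ Dt * Real.exp ((θ - 1) * N / 2 ^ Dt) / θ ^ K := rfl
    have e2 : ((2 * Q.h + 3 : ℕ) : ENNReal) ≤ (2 * l + 3 : ℕ) := by
      exact_mod_cast (by
        have : Q.h ≤ l := hhl
        omega)
    rw [e1]
    gcongr

end Scheme

/-! ### The simulator that keeps the database in the permanent memory -/

/-- The simulator that keeps the database in the permanent memory. -/
noncomputable def localSimulator (B N S : ℕ) (e : Store N B → List Bool) : Simulator B N S where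
  setup D := PMF.pure (e D, fun _ _ => false)
  step m i :=
    match i with
    | Input.logical r => PMF.pure
        (⟨e (r.apply (Function.invFun e m.perm)), []⟩,
          Output.answer (Function.invFun e m.perm r.addr))
    | Input.reply v => PMF.pure (m, Output.answer v)
  budget := 0

/-- The simulator that keeps the database in the permanent memory, without labels. -/
noncomputable def localModel (B N S : ℕ) {e : Store N B → List Bool} (he : Function.Injective e) :
    LabelModel (localSimulator B N S e) where
  U := Unit
  Λ := Unit
  I := Empty
  St := Store N B
  G := Unit
  Clock := Unit
  Inv _ _ := True
  lam _ _ := ()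
  permE _ := e
  servE _ _ _ := false
  db := id
  path _ i := i.elim
  path_inj _ i := i.elim
  g₀ := ()
  next _ _ := ()
  time := id
  tick := id
  init D _ := D
  addrs _ _ := []
  tempBits := 0
  permBits _ := 0
  stages := 1
  changed _ := ∅
  bad₀ _ _ := True
  bad _ _ _ _ _ := True
  time_next _ _ := rfl
  setup D := by
    rw [show (fun l : Unit → Unit => ((e D, fun _ _ => false) : List Bool × Store S B)) =
      Function.const _ (e D, fun _ _ => false) from rfl, PMF.map_const]
    rfl
  inv_init _ _ := trivial
  lam_init _ _ := rfl
  db_init _ _ := rfl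
  bad_init _ _ _ _ := trivial
  access g σ r _ := by
    refine ⟨fun _ => ⟨some (σ r.addr), [], [⟨e (r.apply σ), []⟩], e (r.apply σ), fun _ _ => false⟩,
      fun _ => r.apply σ, ?_, fun ξ => ⟨trivial, rfl, rfl, rfl, rfl, rfl, rfl, ?_, ?_⟩⟩
    · rw [show (fun _ : Empty → Unit => (⟨some (σ r.addr), [], [⟨e (r.apply σ), []⟩], e (r.apply σ),
        fun _ _ => false⟩ : Access B S)) = Function.const _ _ from rfl, PMF.map_const]
      show PMF.map _ (PMF.pure _) = _
      rw [PMF.pure_map]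
      simp only [Function.leftInverse_invFun he σ]
    · simp
    · exact fun _ _ _ _ => ⟨0, Nat.one_pos, trivial⟩

/-- For the finitely many `n` outside the asymptotic regime: correctness and security are needed for
all `n`, while permanent space may be unbounded there. -/
theorem exists_localSimulator (B N S : ℕ) :
    ∃ O : Simulator B N S, O.Correct ∧ O.Secure ∧ O.BandwidthAtMost 0 ∧
      O.TemporarySpaceAtMost 0 := by
  obtain ⟨e, he, -⟩ := (HasCode.of_card (α := Store N B) (k := Fintype.card (Store N B))
    Nat.lt_two_pow_self.le).exists_injective
  let L := localModel B N S he
  refine ⟨_, L.correct, L.secure, fun D rs x hx a ha => ?_, fun D rs x hx a ha m hm => ?_⟩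
  · obtain ⟨⟨c, ρ, hc⟩, -⟩ := L.execution_bounds hx a ha
    have hc : a.addrs = [] := hc
    simp [hc]
  · have : m.temp.length ≤ 0 := (L.execution_bounds hx a ha).2 m hm
    rw [zero_mul]
    exact_mod_cast this

/-! ### Choice of the parameters and explicit bounds for a fixed `n`. -/

theorem le_numBlocks_mul {n B : ℕ} (hB : 0 < B) : n ≤ numBlocks n B * B := by
  rw [numBlocks, Nat.ceilDiv_eq_add_pred_div]
  have := Nat.lt_div_mul_add (a := n + B - 1) hB
  omega

theorem numBlocks_mul_lt {n B : ℕ} (hB : 0 < B) : numBlocks n B * B < n + B := by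
  rw [numBlocks, Nat.ceilDiv_eq_add_pred_div]
  have := Nat.div_mul_le_self (n + B - 1) B
  omega

/-- Here `m` is the mean load of a leaf and `θ = exp δ` with `δ = qF / (2m)`. From `exp δ - 1 ≤ δ +
δ²` and `δ m = qF / 2` the exponent is at most `-δ q F / 2`, and `m ≤ 2F` gives `δ ≥ q / 4`. -/
theorem leaf_overflow_le {m q F : ℝ} {K : ℕ} (hF : 0 < F) (hm : F ≤ m) (hm2 : m ≤ 2 * F)
    (hq0 : 0 ≤ q) (hq : q ≤ 1 / 2) (hK : m + q * F ≤ K) :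
    Real.exp ((Real.exp (q * F / (2 * m)) - 1) * m) / Real.exp (q * F / (2 * m)) ^ K ≤
      Real.exp (-(q ^ 2 * F / 8)) := by
  have hm0 : 0 < m := by linarith
  set δ := q * F / (2 * m) with hδ
  have hδ0 : 0 ≤ δ := by positivity
  have hδm : δ * m = q * F / 2 := by rw [hδ]; field_simp
  have hδ1 : δ ≤ 1 := by
    rw [hδ, div_le_one (by positivity)]
    nlinarith
  have h1 : Real.exp δ - 1 ≤ δ + δ ^ 2 := by
    have := (abs_le.1 (Real.abs_exp_sub_one_sub_id_le (abs_le.2 ⟨by linarith, hδ1⟩))).2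
    linarith
  rw [← Real.exp_nat_mul, ← Real.exp_sub]
  apply Real.exp_le_exp.2
  have h2 : (Real.exp δ - 1) * m ≤ (δ + δ ^ 2) * m := by gcongr
  have h3 : (m + q * F) * δ ≤ K * δ := by gcongr
  have h4 : q / 4 ≤ δ := by
    rw [hδ, le_div_iff₀ (by positivity)]
    nlinarith
  have h5 : q / 4 * (q * F / 2) ≤ δ * (q * F / 2) := by gcongr
  nlinarith

/-- The parameters of the simulator for databases of `n` bits. -/
structure Admissible (n B : ℕ) (F G : ℝ) : Prop where
  log_ge : 4 ≤ Real.log n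
  le_block : 3 * Real.logb 2 n ≤ B
  one_le : 1 ≤ G
  log_le : Real.log n ≤ F
  -- The spare logarithm absorbs the constant in `f = O(log²)`.
  le_pow : F ≤ Real.log n ^ 3
  slack_le : G / Real.sqrt (F / Real.log n) ≤ 1 / 2
  -- With `le_pow` this yields `N ≥ 2 F`, so the data tree has positive depth; it also makes `O(log
  -- n)` additional blocks affordable.
  block_le : B * Real.log n ^ 4 ≤ n

namespace Admissible

variable {n B : ℕ} {F G : ℝ}

/-- Turns the overflow bound `exp (-q²F/8)` of a leaf into `exp (-G² log n / 8)`. -/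
theorem slack_sq (h : Admissible n B F G) :
    (G / Real.sqrt (F / Real.log n)) ^ 2 * F = G ^ 2 * Real.log n := by
  have h1 := h.log_ge
  have h2 := h.log_le
  rw [div_pow, Real.sq_sqrt (div_nonneg (by linarith) (by linarith))]
  have : F ≠ 0 := by linarith
  have : Real.log n ≠ 0 := by linarith
  field_simp

/-- From `F ≤ log³ n` the square root is at most `log n`. So the slack cannot be too small to absorb
rounding errors. -/
theorem inv_le_slack (h : Admissible n B F G) :
    1 / Real.log n ≤ G / Real.sqrt (F / Real.log n) := by
  have h1 := h.log_ge
  have h2 := h.log_le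
  have hFL : 1 ≤ F / Real.log n := by rw [le_div_iff₀ (by linarith)]; linarith
  have h3 : Real.sqrt (F / Real.log n) ≤ Real.log n := by
    rw [Real.sqrt_le_left (by linarith), div_le_iff₀ (by linarith)]
    have := h.le_pow
    nlinarith
  have h4 : 0 < Real.sqrt (F / Real.log n) := Real.sqrt_pos.2 (by linarith)
  have h5 := h.one_le
  gcongr

theorem n_pos (h : Admissible n B F G) : 0 < n := by
  rcases Nat.eq_zero_or_pos n with rfl | h0
  · have := h.log_ge
    norm_num at this
  · exact h0

theorem natLog_le (h : Admissible n B F G) : (Nat.log 2 n : ℝ) ≤ 2 * Real.log n := by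
  have h1 : ((2 : ℝ) ^ Nat.log 2 n) ≤ n := by
    exact_mod_cast Nat.pow_log_le_self 2 h.n_pos.ne'
  have h2 := Real.log_le_log (by positivity) h1
  rw [Real.log_pow] at h2
  have := Real.log_two_gt_d9
  have : (0 : ℝ) ≤ Nat.log 2 n := by positivity
  nlinarith

theorem five_le_natLog (h : Admissible n B F G) : 5 ≤ Nat.log 2 n := by
  have h1 : (n : ℝ) ≤ (2 : ℝ) ^ (Nat.log 2 n + 1) := by
    exact_mod_cast (Nat.lt_pow_succ_log_self (b := 2) (by omega) n).le
  have hn : (0 : ℝ) < n := by exact_mod_cast h.n_pos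
  have h2 := Real.log_le_log hn h1
  rw [Real.log_pow] at h2
  have := Real.log_two_lt_d9
  have h3 := h.log_ge
  by_contra hc
  have h4 : ((Nat.log 2 n + 1 : ℕ) : ℝ) ≤ 5 := by exact_mod_cast (by omega)
  have h5 : (0 : ℝ) < Real.log 2 := Real.log_pos (by norm_num)
  nlinarith

theorem three_mul_natLog_le (h : Admissible n B F G) : 3 * Nat.log 2 n ≤ B := by
  have h1 : ((2 : ℝ) ^ Nat.log 2 n) ≤ n := by
    exact_mod_cast Nat.pow_log_le_self 2 h.n_pos.ne'
  have hn : (0 : ℝ) < n := by exact_mod_cast h.n_pos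
  have h2 : (Nat.log 2 n : ℝ) ≤ Real.logb 2 n := by
    rw [Real.le_logb_iff_rpow_le (by norm_num) hn]
    exact_mod_cast h1
  have h3 := h.le_block
  have : ((3 * Nat.log 2 n : ℕ) : ℝ) ≤ B := by push_cast; linarith
  exact_mod_cast this

theorem log_le_block (h : Admissible n B F G) : 3 * Real.log n ≤ B := by
  have h1 := h.le_block
  have h2 : Real.log n ≤ Real.logb 2 n := by
    have := h.log_ge
    have := Real.log_two_lt_d9
    have h0 : (0 : ℝ) < Real.log 2 := Real.log_pos (by norm_num)
    rw [Real.logb, le_div_iff₀ h0]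
    nlinarith
  linarith

theorem block_pos (h : Admissible n B F G) : 0 < B := by
  have := h.three_mul_natLog_le
  have := h.five_le_natLog
  omega

/-- Shows that `O(log n)` further blocks of server space stay within the slack. -/
theorem block_mul_log_le (h : Admissible n B F G) :
    B * Real.log n ≤ n * (G / Real.sqrt (F / Real.log n)) := by
  have h1 := h.log_ge
  have h2 := h.inv_le_slack
  have hB : (0 : ℝ) ≤ B := by positivity
  have h3 : B * Real.log n ^ 2 ≤ n := by
    refine le_trans ?_ h.block_le
    gcongr
    · linarith
    · norm_num
  calc (B : ℝ) * Real.log n = B * Real.log n ^ 2 * (1 / Real.log n) := by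
        have : Real.log n ≠ 0 := by linarith
        field_simp
    _ ≤ n * (1 / Real.log n) := by gcongr
    _ ≤ _ := by gcongr

/-- An upper bound for the used server space. -/
theorem space_le (h : Admissible n B F G) {N l M h' x K : ℕ} (hNB : N * B ≤ n + B)
    (hl : (l : ℝ) ≤ 2 * Real.log n) (hl1 : 1 ≤ l) (hM : M * B ≤ 2 * N * l + (h' + 1) * B)
    (hh : h' ≤ l) (hxF : x * F ≤ N) (hK : x * (K : ℝ) ≤ N +
      x * (G / Real.sqrt (F / Real.log n) * F + 1)) :
    ((22 * M + x * (K * (B + 2 * l + 1) / B + 12) : ℕ) : ℝ) ≤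
      n * (1 + 200 * (Real.log n / B + G / Real.sqrt (F / Real.log n))) / B := by
  have hB0 : (0 : ℝ) < B := by exact_mod_cast h.block_pos
  have hL := h.log_ge
  have hLB := h.log_le_block
  have hq1 := h.slack_le
  have hqL := h.inv_le_slack
  have hBL := h.block_mul_log_le
  have hLF := h.log_le
  set q := G / Real.sqrt (F / Real.log n) with hq
  set L := Real.log n with hLdef
  have hq0 : 0 ≤ q := le_trans (by positivity) hqL
  have hF0 : 0 < F := by linarith
  have hn0 : (0 : ℝ) < n := by exact_mod_cast h.n_pos
  set η := L / B with hη
  have hη0 : 0 ≤ η := by positivity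
  have hη1 : η ≤ 1 / 3 := by rw [hη, div_le_iff₀ hB0]; linarith
  have hηB : η * B = L := by rw [hη]; field_simp
  rw [le_div_iff₀ hB0]
  have hNB' : (N : ℝ) * B ≤ n + B := by exact_mod_cast hNB
  have hBn : (B : ℝ) ≤ n * q := by nlinarith
  have hNB2 : (N : ℝ) * B ≤ n * (1 + q) := by linarith
  have hNB3 : (N : ℝ) * B ≤ n * (3 / 2) := by nlinarith
  have hFq : 1 ≤ q * F := by
    have : 1 ≤ q * L := by
      rw [div_le_iff₀ (by linarith)] at hqL
      exact hqL
    nlinarith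
  have hdiv : ((K * (B + 2 * l + 1) / B : ℕ) : ℝ) * B ≤ K * (B + 2 * l + 1) := by
    exact_mod_cast Nat.div_mul_le_self _ _
  have hM' : (M : ℝ) * B ≤ 2 * N * l + (h' + 1) * B := by exact_mod_cast hM
  have hh' : (h' : ℝ) ≤ l := by exact_mod_cast hh
  have hl1' : (1 : ℝ) ≤ l := by exact_mod_cast hl1
  have hN0 : (0 : ℝ) ≤ N := by positivity
  have hx0 : (0 : ℝ) ≤ x := by positivity
  -- Leaves number at most a fraction `q` of the blocks, so a constant number of cells per leaf,
  -- inner nodes included, is within the slack.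
  have hxN : x ≤ N * q := by
    calc (x : ℝ) ≤ x * (q * F) := le_mul_of_one_le_right hx0 hFq
      _ = x * F * q := by ring
      _ ≤ N * q := by gcongr
  have hxK : x * (K : ℝ) ≤ N * (1 + 2 * q) := by
    have : x * (q * F) ≤ N * q := by
      calc x * (q * F) = x * F * q := by ring
        _ ≤ N * q := by gcongr
    nlinarith
  have e1 : (B : ℝ) + 2 * l + 1 ≤ B * (1 + 6 * η) := by nlinarith
  have hqq : q * q ≤ 1 / 2 * q := by gcongr
  have hqη : q * η ≤ 1 / 2 * η := by gcongr
  -- The main term: the contents of the leaves, with the slack factors `1 + q` and `1 + 2q` and the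
  -- factor `1 + 6η` for block numbers and labels.
  have p1 : (x : ℝ) * (K * (B + 2 * l + 1)) ≤ n * (1 + 4 * q + 18 * η) := by
    calc (x : ℝ) * (K * (B + 2 * l + 1)) = x * K * (B + 2 * l + 1) := by ring
      _ ≤ N * (1 + 2 * q) * (B * (1 + 6 * η)) := by gcongr
      _ = N * B * ((1 + 2 * q) * (1 + 6 * η)) := by ring
      _ ≤ n * (1 + q) * ((1 + 2 * q) * (1 + 6 * η)) := by gcongr
      _ = n * ((1 + q) * (1 + 2 * q) * (1 + 6 * η)) := by ring
      _ ≤ n * ((1 + 4 * q) * (1 + 6 * η)) := by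
          have : (1 + q) * (1 + 2 * q) ≤ 1 + 4 * q := by linarith
          gcongr
      _ ≤ n * (1 + 4 * q + 18 * η) := by
          have : (1 + 4 * q) * (1 + 6 * η) ≤ 1 + 4 * q + 18 * η := by linarith
          gcongr
  have p2 : (x : ℝ) * B ≤ n * (3 / 2) * q := by
    calc (x : ℝ) * B ≤ N * q * B := by gcongr
      _ = N * B * q := by ring
      _ ≤ _ := by gcongr
  have p3 : (N : ℝ) * l ≤ n * 3 * η := by
    calc (N : ℝ) * l ≤ N * (2 * L) := by gcongr
      _ = N * B * (2 * η) := by rw [← hηB]; ring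
      _ ≤ n * (3 / 2) * (2 * η) := by gcongr
      _ = _ := by ring
  have p4 : (h' + 1 : ℝ) * B ≤ 4 * (n * q) := by
    calc (h' + 1 : ℝ) * B ≤ (2 * (2 * L)) * B := by
          gcongr
          linarith
      _ = 4 * (B * L) := by ring
      _ ≤ _ := by gcongr
  have p5 : (x : ℝ) * (((K * (B + 2 * l + 1) / B : ℕ) : ℝ) * B) ≤ x * (K * (B + 2 * l + 1)) := by
    gcongr
  rw [Nat.cast_add, Nat.cast_mul, Nat.cast_mul, Nat.cast_add, Nat.cast_ofNat, Nat.cast_ofNat]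
  generalize ((K * (B + 2 * l + 1) / B : ℕ) : ℝ) = c at *
  have hnη : 0 ≤ n * η := by positivity
  have hnq : 0 ≤ n * q := by positivity
  calc (22 * (M : ℝ) + x * (c + 12)) * B = 22 * (M * B) + x * (c * B) + 12 * (x * B) := by ring
    _ ≤ 22 * (2 * (n * 3 * η) + 4 * (n * q)) + n * (1 + 4 * q + 18 * η) + 12 * (n * (3 / 2) * q) :=
        by linarith
    _ = n + 150 * (n * η) + 110 * (n * q) := by ring
    _ ≤ n + 200 * (n * η) + 200 * (n * q) := by linarith
    _ = _ := by ring

end Admissible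

namespace Admissible

variable {n B : ℕ} {F G : ℝ}

/-- The depth is the integer part of `log₂ (N / F)`, so that a leaf receives between `F` and `2F`
blocks on average. -/
theorem exists_depth (h : Admissible n B F G) (hN : numBlocks n B ≤ 2 ^ Nat.log 2 n) :
    ∃ D, 0 < D ∧ D ≤ Nat.log 2 n ∧ ((2 ^ D : ℕ) : ℝ) * F ≤ numBlocks n B ∧
      (numBlocks n B : ℝ) ≤ (2 ^ D : ℕ) * (2 * F) := by
  have hL := h.log_ge
  have hLF := h.log_le
  have hF3 := h.le_pow
  have hB4 := h.block_le
  have hB0 : (0 : ℝ) < B := by exact_mod_cast h.block_pos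
  have hF0 : 0 < F := by linarith
  have hNB : (n : ℝ) ≤ numBlocks n B * B := by exact_mod_cast le_numBlocks_mul h.block_pos
  generalize numBlocks n B = N at *
  set L := Real.log n
  have h1 : 2 * F ≤ N := by
    have h2 : F * 2 ≤ L ^ 3 * L := by gcongr; linarith
    have h3 : B * (2 * F) ≤ B * L ^ 4 := by
      gcongr
      calc 2 * F = F * 2 := by ring
        _ ≤ L ^ 3 * L := h2
        _ = L ^ 4 := by ring
    have h4 : 2 * F * B ≤ N * B := by linarith
    exact le_of_mul_le_mul_right h4 hB0
  have h2 : 2 ≤ ⌊(N : ℝ) / F⌋₊ := by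
    refine Nat.le_floor ?_
    rw [Nat.cast_ofNat, le_div_iff₀ hF0]
    exact h1
  have h3 : (2 ^ Nat.log 2 ⌊(N : ℝ) / F⌋₊ : ℕ) * F ≤ N := by
    rw [← le_div_iff₀ hF0]
    refine le_trans ?_ (Nat.floor_le (by positivity))
    exact_mod_cast Nat.pow_log_le_self 2 (by omega)
  refine ⟨Nat.log 2 ⌊(N : ℝ) / F⌋₊, Nat.log_pos (by omega) h2, ?_, h3, ?_⟩
  · have : ((2 ^ Nat.log 2 ⌊(N : ℝ) / F⌋₊ : ℕ) : ℝ) ≤ N :=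
      le_trans (le_mul_of_one_le_right (by positivity) (by linarith)) h3
    have h4 : 2 ^ Nat.log 2 ⌊(N : ℝ) / F⌋₊ ≤ N := by exact_mod_cast this
    exact (Nat.pow_le_pow_iff_right (by omega)).1 (h4.trans hN)
  · have h4 := Nat.lt_floor_add_one ((N : ℝ) / F)
    have h5 : (⌊(N : ℝ) / F⌋₊ : ℝ) + 1 ≤ (2 ^ (Nat.log 2 ⌊(N : ℝ) / F⌋₊ + 1) : ℕ) := by
      exact_mod_cast Nat.lt_pow_succ_log_self (b := 2) (by omega) _
    have h6 := h4.trans_le h5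
    rw [div_lt_iff₀ hF0] at h6
    refine h6.le.trans (le_of_eq ?_)
    push_cast
    ring

theorem four_mul_add_le_two_pow {l : ℕ} (h : 5 ≤ l) : 4 * l + 12 ≤ 2 ^ l := by
  induction l, h using Nat.le_induction with
  | base => norm_num
  | succ l h ih => rw [pow_succ]; omega

/-- As `B ≥ 15`, there are far fewer than `n` blocks, so `log₂ n` bits suffice to number data and
position-map blocks together. -/
theorem numBlocks_add_le (h : Admissible n B F G) {h' β : ℕ} (hβ : 3 ≤ β)
    (hh : h' ≤ Nat.log 2 n) :
    numBlocks n B + (numBlocks n B / (β - 1) + h' + 1) ≤ 2 ^ Nat.log 2 n := by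
  have h1 := h.three_mul_natLog_le
  have h2 := h.five_le_natLog
  have h3 := numBlocks_mul_lt (n := n) h.block_pos
  have h4 : n < 2 ^ (Nat.log 2 n + 1) := Nat.lt_pow_succ_log_self (by omega) n
  have h5 := four_mul_add_le_two_pow h2
  have h6 : numBlocks n B / (β - 1) ≤ numBlocks n B / 2 :=
    Nat.div_le_div_left (by omega) (by omega)
  rw [pow_succ] at h4
  rcases Nat.eq_zero_or_pos (numBlocks n B) with h0 | h0
  · rw [h0] at h6 ⊢
    omega
  · obtain ⟨N, hN⟩ : ∃ N, numBlocks n B = N + 1 := ⟨numBlocks n B - 1, by omega⟩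
    rw [hN] at h3 h6 ⊢
    have h7 : N * 15 ≤ N * B := Nat.mul_le_mul_left _ (by omega)
    rw [add_mul, one_mul] at h3
    omega

/-- Lets a physical address fit into one block; the hypothesis `B ≥ 3 log₂ n` leaves room for the
constant. -/
theorem serverBlocks_le (h : Admissible n B F G) :
    ⌈n * (1 + 200 * (Real.log n / B + G / Real.sqrt (F / Real.log n))) / B⌉₊ ≤ 2 ^ B := by
  have hB0 : (0 : ℝ) < B := by exact_mod_cast h.block_pos
  have hLB := h.log_le_block
  have hL := h.log_ge
  have hq := h.slack_le
  have hl := h.three_mul_natLog_le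
  have hl5 := h.five_le_natLog
  have hη : Real.log n / B ≤ 1 / 3 := by rw [div_le_iff₀ hB0]; linarith
  have h1 : 1 + 200 * (Real.log n / B + G / Real.sqrt (F / Real.log n)) ≤ 12 * B := by
    have : (15 : ℝ) ≤ B := by exact_mod_cast (by omega : 15 ≤ B)
    linarith
  have h2 : n * (1 + 200 * (Real.log n / B + G / Real.sqrt (F / Real.log n))) / B ≤
      (n * 12 : ℕ) := by
    rw [div_le_iff₀ hB0]
    push_cast
    calc _ ≤ (n : ℝ) * (12 * B) := by gcongr
      _ = _ := by ring
  refine (Nat.ceil_le.2 h2).trans ?_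
  have h4 : n < 2 ^ (Nat.log 2 n + 1) := Nat.lt_pow_succ_log_self (by omega) n
  have h5 : n * 12 ≤ 2 ^ (3 * Nat.log 2 n) := by
    have h6 := four_mul_add_le_two_pow hl5
    rw [pow_succ] at h4
    rw [mul_comm 3, pow_mul]
    generalize 2 ^ Nat.log 2 n = y at *
    have : 32 ≤ y := by omega
    calc n * 12 ≤ 24 * y := by omega
      _ ≤ (y * y) * y := Nat.mul_le_mul_right _ (by nlinarith)
      _ = y ^ 3 := by ring
  exact h5.trans (Nat.pow_le_pow_right (by omega) hl)

theorem two_mul_natLog_add_le (h : Admissible n B F G) : 2 * Nat.log 2 n + 3 ≤ n := by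
  have := four_mul_add_le_two_pow h.five_le_natLog
  have := Nat.pow_log_le_self 2 h.n_pos.ne'
  omega

theorem div_two_pow_floor_le {R : ℝ} :
    (128 : ℝ) / 2 ^ ⌊R / 8⌋₊ ≤ 256 * Real.exp (-(Real.log 2 / 8 * R)) := by
  have h1 := Nat.lt_floor_add_one (R / 8)
  have h2 : Real.exp (Real.log 2 / 8 * R) ≤ 2 ^ ⌊R / 8⌋₊ * 2 := by
    rw [← pow_succ, ← Real.rpow_natCast, Real.rpow_def_of_pos (by norm_num)]
    apply Real.exp_le_exp.2
    have : Real.log 2 * (R / 8) ≤ Real.log 2 * (⌊R / 8⌋₊ + 1) :=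
      mul_le_mul_of_nonneg_left h1.le (Real.log_nonneg (by norm_num))
    push_cast
    linarith
  rw [Real.exp_neg, div_le_iff₀ (by positivity), mul_assoc, ← div_eq_inv_mul,
    ← mul_div_assoc, le_div_iff₀ (Real.exp_pos _)]
  linarith

/-- A stash entry has at most `2 B` bits and the two trees hold `R / 8` entries each: half of `R B`.
The labels and counters fit into the other half since `R ≥ 4`. -/
theorem permanent_bits_le {B l : ℕ} {R : ℝ} (hR : 4 ≤ R) (h1 : 2 * l + 2 ≤ B)
    (h2 : 3 * l + 1 ≤ 2 * B) :
    ((3 * l + (2 * ⌊R / 8⌋₊ * (B + 2 * l + 2) + 1) : ℕ) : ℝ) ≤ R * B := by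
  have hR8 := Nat.floor_le (show 0 ≤ R / 8 by linarith)
  have e1 : (B : ℝ) + 2 * l + 2 ≤ 2 * B := by exact_mod_cast (by omega : B + 2 * l + 2 ≤ 2 * B)
  have e2 : 3 * (l : ℝ) + 1 ≤ 2 * B := by exact_mod_cast h2
  have e3 : 2 * (⌊R / 8⌋₊ : ℝ) * (B + 2 * l + 2) ≤ 2 * (R / 8) * (2 * B) := by gcongr
  have e4 : 4 * (B : ℝ) ≤ R * B := by gcongr
  push_cast
  linarith

theorem ofReal_add_mul_le {p p' : ℝ} {k a n : ℕ} (hp0 : 0 ≤ p) (hpp : p ≤ p') (ha : a ≤ n) :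
    ENNReal.ofReal p + k * (a * ENNReal.ofReal p) ≤ ENNReal.ofReal (p' * (1 + k * n)) := by
  have e : ENNReal.ofReal p + k * (a * ENNReal.ofReal p) =
      ENNReal.ofReal (p + k * (a * p)) := by
    rw [ENNReal.ofReal_add hp0 (by positivity), ENNReal.ofReal_mul (by positivity),
      ENNReal.ofReal_mul (by positivity), ENNReal.ofReal_natCast, ENNReal.ofReal_natCast]
  rw [e]
  refine ENNReal.ofReal_le_ofReal ?_
  have ha' : (a : ℝ) ≤ n := by exact_mod_cast ha
  have : 0 ≤ p' := hp0.trans hpp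
  calc p + k * (a * p) ≤ p' + k * (n * p') := by gcongr
    _ = _ := by ring

theorem temporary_bits_le {B l K : ℕ} {F : ℝ} (h1 : 3 * l ≤ B) (h2 : 5 ≤ l)
    (hlF : (l : ℝ) ≤ 2 * F) (hF : 4 ≤ F) (hK : (K : ℝ) ≤ 3 * F) :
    ((3 * B + l * (l + 2) + l + 3 +
      ((11 * l + (11 * l + (2 * K + 1))) * (2 * B + 1) + 3) : ℕ) : ℝ) ≤ 166 * F * B := by
  have hlB' : 3 * (l : ℝ) ≤ B := by exact_mod_cast h1
  have hl5' : (5 : ℝ) ≤ l := by exact_mod_cast h2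
  have e0 : 0 ≤ F * B := by positivity
  have e1 : (l : ℝ) * l ≤ 2 * F * (B / 3) := by
    gcongr
    linarith
  have e2 : (11 * (l : ℝ) + (11 * l + (2 * K + 1))) * (2 * B + 1) ≤ (51 * F) * (3 * B) := by
    have : (11 * (l : ℝ) + (11 * l + (2 * K + 1))) ≤ 51 * F := by linarith
    have : 2 * (B : ℝ) + 1 ≤ 3 * B := by linarith
    gcongr
  have e3 : 4 * (B : ℝ) ≤ F * B := by gcongr
  push_cast
  linarith

theorem exists_simulator (h : Admissible n B F G) :
    ∃ O : Simulator B (numBlocks n B)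
        ⌈n * (1 + 200 * (Real.log n / B + G / Real.sqrt (F / Real.log n))) / B⌉₊,
      O.Correct ∧ O.Secure ∧
      O.BandwidthAtMost (4 * (44 * Real.log n ^ 2 + 22 * Real.log n + 8 * F + 1)) ∧
      O.TemporarySpaceAtMost (166 * F) ∧
      ∀ R : ℝ, 4 ≤ R → ∀ D rs,
        (O.execution D rs).toOuterMeasure (Simulator.permanentSpaceExceeds B _ R) ≤
          ENNReal.ofReal ((256 * Real.exp (-(Real.log 2 / 8 * R)) +
            Real.exp (Real.log n - G ^ 2 * Real.log n / 8)) * (1 + rs.length * n)) := by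
  have hL := h.log_ge
  have hLF := h.log_le
  have hl2 := h.natLog_le
  have hl5 := h.five_le_natLog
  have hlB := h.three_mul_natLog_le
  have hq1 := h.slack_le
  have hqL := h.inv_le_slack
  have hB0 := h.block_pos
  have hn0 := h.n_pos
  have hsq := h.slack_sq
  have hS := h.serverBlocks_le
  set l := Nat.log 2 n with hl
  -- `B ≥ 3 l` gives `β ≥ 3`, whence `B ≤ (β - 1) * (2 * l)`: the position map costs `O(N l)` bits
  -- up to rounding.
  set β := B / l with hβ
  set N := numBlocks n B with hN
  have hβ3 : 3 ≤ β := (Nat.le_div_iff_mul_le (by omega)).2 hlB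
  have hNB := le_numBlocks_mul (n := n) hB0
  have hNB' := numBlocks_mul_lt (n := n) hB0
  have hNpos : 0 < N := by
    rcases Nat.eq_zero_or_pos N with h0 | h0
    · rw [← hN, h0, zero_mul] at hNB
      omega
    · exact h0
  have hNl : N ≤ 2 ^ l := by
    exact (Nat.le_add_right _ _).trans (h.numBlocks_add_le hβ3 (h' := 0) (Nat.zero_le _))
  set h' := Nat.clog β N with hh'
  have hNβ : N ≤ β ^ h' := Nat.le_pow_clog (by omega) N
  have hhl : h' ≤ l := by
    refine (Nat.clog_le_of_le_pow (hNl.trans (Nat.pow_le_pow_left (by omega) l)))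
  have hNM := h.numBlocks_add_le hβ3 hhl
  set M := N / (β - 1) + h' + 1 with hM
  have hMB : M * B ≤ 2 * N * l + (h' + 1) * B := by
    have h1 : B < (β + 1) * l := by
      have := Nat.lt_div_mul_add (a := B) (b := l) (by omega)
      rw [add_mul, one_mul]
      exact this
    have h2 : B ≤ (β - 1) * (2 * l) := by
      obtain ⟨b, hb⟩ : ∃ b, β = b + 3 := ⟨β - 3, by omega⟩
      rw [hb] at h1 ⊢
      have : b + 3 - 1 = b + 2 := by omega
      rw [this]
      nlinarith
    have h3 : N / (β - 1) * B ≤ 2 * N * l := by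
      calc N / (β - 1) * B ≤ N / (β - 1) * ((β - 1) * (2 * l)) := Nat.mul_le_mul_left _ h2
        _ = N / (β - 1) * (β - 1) * (2 * l) := by ring
        _ ≤ N * (2 * l) := Nat.mul_le_mul_right _ (Nat.div_mul_le_self _ _)
        _ = 2 * N * l := by ring
    rw [hM, add_assoc, add_mul]
    exact Nat.add_le_add_right h3 _
  have hM2 : 2 ≤ M := by
    -- Height `0` would mean a single database block, which contradicts `F ≥ 4` blocks per leaf on
    -- at least two leaves.
    rcases Nat.eq_zero_or_pos h' with h0 | h0
    · rw [h0, pow_zero] at hNβ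
      have hN1 : N = 1 := by omega
      have h1 := h.exists_depth hNl
      obtain ⟨D, hD, -, hDF, -⟩ := h1
      rw [← hN, hN1] at hDF
      have h3 : ((2 : ℕ) : ℝ) ≤ (2 ^ D : ℕ) := by
        exact_mod_cast (Nat.le_self_pow hD.ne' 2)
      exfalso
      have h4 : ((2 : ℕ) : ℝ) * 4 ≤ (2 ^ D : ℕ) * F := by
        gcongr
        linarith
      push_cast at h4 hDF
      linarith
    · have : h' + 1 ≤ M := Nat.add_le_add_right (Nat.le_add_left _ _) 1
      exact (Nat.succ_le_succ h0).trans this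
  obtain ⟨Dt, hDt0, hDtl, hDF, hDF2⟩ := h.exists_depth hNl
  set q := G / Real.sqrt (F / Real.log n) with hq
  set x : ℕ := 2 ^ Dt with hx
  have hx0 : (0 : ℝ) < x := by positivity
  have hq0 : 0 ≤ q := le_trans (by positivity) hqL
  have hF0 : 0 < F := by linarith
  -- The mean load of a leaf plus the slack `q F`, which is large enough for the Chernoff bound and
  -- small enough for the server space.
  set K := ⌈(N : ℝ) / x + q * F⌉₊ with hK
  have hK1 : (N : ℝ) / x + q * F ≤ K := Nat.le_ceil _
  have hK2 : (K : ℝ) ≤ (N : ℝ) / x + q * F + 1 := (Nat.ceil_lt_add_one (by positivity)).le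
  have hm1 : F ≤ (N : ℝ) / x := by rw [le_div_iff₀ hx0]; linarith
  have hm2 : (N : ℝ) / x ≤ 2 * F := by rw [div_le_iff₀ hx0]; linarith
  have hK3 : (K : ℝ) ≤ 3 * F := by nlinarith
  have hxK : x * (K : ℝ) ≤ N + x * (q * F + 1) := by
    have := mul_le_mul_of_nonneg_left hK2 hx0.le
    have e : x * ((N : ℝ) / x + q * F + 1) = N + x * (q * F + 1) := by field_simp; ring
    linarith
  have hspace := h.space_le (N := N) (x := x) (K := K) hNB'.le hl2 (by omega) hMB hhl hDF hxK
  have hcells := Nat.cast_le.1 (hspace.trans (Nat.le_ceil _))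
  obtain ⟨O, h1, h2, h3, h4, h5⟩ := Scheme.exists_simulator_of_le (K := K) hNpos (by omega) hNβ
    (Nat.div_mul_le_self B l) (by omega) hDt0 hDtl (Nat.le_succ _) hM2 hNM hhl
    (hNl.trans (Nat.pow_le_pow_right (by omega) (by omega))) hS hcells
  refine ⟨O, h1, h2, ?_, ?_, ?_⟩
  · intro D rs y hy a ha
    refine (h3 D rs y hy a ha).trans ?_
    push_cast
    have : (l : ℝ) * l ≤ (2 * Real.log n) * (2 * Real.log n) := by gcongr
    linarith
  · intro D rs y hy a ha m hm
    have h6 := h4 D rs y hy a ha m hm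
    exact (Nat.cast_le.2 h6).trans
      (temporary_bits_le hlB hl5 (by linarith) (by linarith) hK3)
  · intro R hR D rs
    set θ := Real.exp (q * F / (2 * ((N : ℝ) / x))) with hθ
    have hθ1 : 1 ≤ θ := Real.one_le_exp (by positivity)
    have hbits := permanent_bits_le (B := B) (l := l) hR (by omega) (by omega)
    have hsub : Simulator.permanentSpaceExceeds B _ R ⊆
        {y : List Bool × List (Access B ⌈n * (1 + 200 * (Real.log n / B + q)) / B⌉₊) |
          3 * l + (2 * ⌊R / 8⌋₊ * (B + 2 * l + 2) + 1) < y.1.length ∨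
          ∃ a ∈ y.2, ∃ m ∈ a.memories,
            3 * l + (2 * ⌊R / 8⌋₊ * (B + 2 * l + 2) + 1) < m.perm.length} := by
      rintro y (hy | ⟨a, ha, m, hm, hy⟩)
      · exact Or.inl (Nat.cast_lt.1 (hbits.trans_lt hy))
      · exact Or.inr ⟨a, ha, m, hm, Nat.cast_lt.1 (hbits.trans_lt hy)⟩
    refine ((O.execution D rs).toOuterMeasure.mono hsub).trans ((h5 ⌊R / 8⌋₊ θ hθ1 D rs).trans ?_)
    have hp2 : (2 : ℝ) ^ Dt * Real.exp ((θ - 1) * N / 2 ^ Dt) / θ ^ K ≤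
        Real.exp (Real.log n - G ^ 2 * Real.log n / 8) := by
      have e1 := leaf_overflow_le hF0 hm1 hm2 hq0 hq1 hK1
      rw [← hθ, hsq] at e1
      have e2 : (x : ℝ) = 2 ^ Dt := by rw [hx]; push_cast; rfl
      have e3 : (2 : ℝ) ^ Dt ≤ n := by
        have : 2 ^ Dt ≤ n := (Nat.pow_le_pow_right (by omega) hDtl).trans
          (Nat.pow_log_le_self 2 hn0.ne')
        exact_mod_cast this
      rw [sub_eq_add_neg (Real.log n), Real.exp_add, Real.exp_log (by exact_mod_cast hn0),
        mul_div_assoc, ← e2, mul_div_assoc (θ - 1), ]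
      rw [← e2] at e3
      gcongr
    exact ofReal_add_mul_le (by positivity) (add_le_add div_two_pow_floor_le hp2)
      h.two_mul_natLog_add_le

end Admissible

/-! ### Asymptotics. -/

theorem tendsto_log_natCast : Tendsto (fun n : ℕ => Real.log n) atTop atTop :=
  Real.tendsto_log_atTop.comp tendsto_natCast_atTop_atTop

/-- The block condition uses `c < 1`: a power of the logarithm is `o(n ^ (1 - c))`. The slack
condition is `g = o(√(f / log n))`. -/
theorem eventually_admissible {B : ℕ → ℕ} {c : ℝ} {f g : ℕ → ℝ}
    (hBlog : ∀ n : ℕ, 0 < n → 3 * Real.logb 2 n ≤ B n) (hc1 : c < 1)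
    (hBc : (fun n : ℕ => (B n : ℝ)) =O[atTop] fun n : ℕ => (n : ℝ) ^ c)
    (hf : Tendsto (fun n : ℕ => f n / Real.log n) atTop atTop)
    (hf' : f =O[atTop] fun n : ℕ => Real.log n ^ 2)
    (hg : Tendsto g atTop atTop)
    (hg' : g =o[atTop] fun n : ℕ => Real.sqrt (f n / Real.log n)) :
    ∀ᶠ n : ℕ in atTop, Admissible n (B n) (f n) (g n) := by
  have hblock : ∀ᶠ n : ℕ in atTop, B n * Real.log n ^ 4 ≤ n := by
    have h1 : (fun n : ℕ => Real.log n ^ (4 : ℝ)) =o[atTop] fun n : ℕ => (n : ℝ) ^ (1 - c) :=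
      (isLittleO_log_rpow_rpow_atTop 4 (by linarith)).comp_tendsto tendsto_natCast_atTop_atTop
    have h2 := hBc.mul_isLittleO h1
    filter_upwards [h2.def one_pos, eventually_gt_atTop 0] with n hn hn0
    have hn0' : (0 : ℝ) < n := by exact_mod_cast hn0
    rw [← Real.rpow_add hn0', add_sub_cancel, Real.rpow_one, one_mul, Real.norm_of_nonneg hn0'.le]
      at hn
    refine (le_abs_self _).trans (le_trans (le_of_eq ?_) hn)
    rw [Real.norm_eq_abs]
    congr 2
    exact_mod_cast (Real.rpow_natCast (Real.log n) 4).symm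
  obtain ⟨C, hC⟩ := hf'.bound
  filter_upwards [hblock, hC, eventually_gt_atTop 0, tendsto_log_natCast.eventually_ge_atTop 4,
    tendsto_log_natCast.eventually_ge_atTop C, hg.eventually_ge_atTop 1,
    hf.eventually_ge_atTop 1, hg'.tendsto_div_nhds_zero.eventually (ge_mem_nhds
      (show (0 : ℝ) < 1 / 2 by norm_num))] with n h1 h2 h3 h4 h5 h6 h7 h8
  refine ⟨h4, hBlog n h3, h6, ?_, ?_, h8, h1⟩
  · rw [le_div_iff₀ (by linarith)] at h7
    linarith
  · rw [Real.norm_eq_abs, Real.norm_eq_abs, abs_of_nonneg (sq_nonneg (Real.log n))] at h2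
    calc f n ≤ |f n| := le_abs_self _
      _ ≤ C * Real.log n ^ 2 := h2
      _ ≤ Real.log n * Real.log n ^ 2 := by gcongr
      _ = _ := by ring

namespace Admissible

variable {n B : ℕ} {F G : ℝ}

/-- The server size is set to the target value instead of the number of cells in use, so the lower
bound in the `Θ` holds by definition. -/
theorem le_serverSpace (h : Admissible n B F G) :
    n * (1 + 200 * (Real.log n / B + G / Real.sqrt (F / Real.log n))) ≤
      serverSpace B
        ⌈n * (1 + 200 * (Real.log n / B + G / Real.sqrt (F / Real.log n))) / B⌉₊ := by
  have hB : (0 : ℝ) < B := by exact_mod_cast h.block_pos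
  rw [serverSpace, ← div_le_iff₀ hB]
  exact Nat.le_ceil _

theorem serverSpace_le (h : Admissible n B F G) :
    serverSpace B ⌈n * (1 + 200 * (Real.log n / B + G / Real.sqrt (F / Real.log n))) / B⌉₊ ≤
      n * (1 + 201 * (Real.log n / B + G / Real.sqrt (F / Real.log n))) := by
  have hB : (0 : ℝ) < B := by exact_mod_cast h.block_pos
  have hL := h.log_ge
  have h1 := h.block_mul_log_le
  have h2 := h.inv_le_slack
  set q := G / Real.sqrt (F / Real.log n)
  have hq0 : 0 ≤ q := le_trans (by positivity) h2
  have hη : 0 ≤ Real.log n / B := by positivity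
  set X := n * (1 + 200 * (Real.log n / B + q)) with hX
  have h3 : (⌈X / B⌉₊ : ℝ) ≤ X / B + 1 := (Nat.ceil_lt_add_one (by positivity)).le
  have h4 : (⌈X / B⌉₊ : ℝ) * B ≤ (X / B + 1) * B := by gcongr
  have h5 : (X / B + 1) * B = X + B := by field_simp
  have h6 : (B : ℝ) ≤ B * Real.log n := le_mul_of_one_le_right hB.le (by linarith)
  have h7 : 0 ≤ (n : ℝ) * (Real.log n / B) := by positivity
  rw [serverSpace]
  calc _ ≤ X + B := h4.trans h5.le
    _ ≤ X + n * q + n * (Real.log n / B) := by linarith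
    _ = _ := by rw [hX]; ring

end Admissible

/-- Written as `exp (-log n * (E n / log n - b))`, the product has an exponent that tends to `-∞`.
-/
theorem tendsto_exp_neg_mul_rpow {E : ℕ → ℝ}
    (hE : Tendsto (fun n : ℕ => E n / Real.log n) atTop atTop) (b : ℝ) :
    Tendsto (fun n : ℕ => Real.exp (-E n) * (n : ℝ) ^ b) atTop (nhds 0) := by
  have h1 : Tendsto (fun n : ℕ => Real.log n * (E n / Real.log n + -b)) atTop atTop :=
    tendsto_log_natCast.atTop_mul_atTop₀ (tendsto_atTop_add_const_right _ _ hE)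
  refine (Real.tendsto_exp_neg_atTop_nhds_zero.comp h1).congr' ?_
  filter_upwards [eventually_gt_atTop 0, tendsto_log_natCast.eventually_ge_atTop 1] with n hn hL
  have hn' : (0 : ℝ) < n := by exact_mod_cast hn
  have hL0 : Real.log n ≠ 0 := by linarith
  rw [Function.comp, Real.rpow_def_of_pos hn', ← Real.exp_add]
  congr 1
  field_simp
  ring

/-- The bound for the probability that the permanent memory becomes large. -/
theorem negligible_of_eventually_le {ν E₁ E₂ : ℕ → ℝ} {κ : ℝ}
    (h₁ : Tendsto (fun n : ℕ => E₁ n / Real.log n) atTop atTop)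
    (h₂ : Tendsto (fun n : ℕ => E₂ n / Real.log n) atTop atTop) (h0 : ∀ᶠ n in atTop, 0 ≤ ν n)
    (hν : ∀ᶠ n : ℕ in atTop,
      ν n ≤ (256 * Real.exp (-E₁ n) + Real.exp (-E₂ n)) * (1 + (n : ℝ) ^ κ * n)) :
    Negligible ν := by
  intro a _
  rw [isLittleO_iff_tendsto']
  · have lim : ∀ b : ℝ, Tendsto (fun n : ℕ => 256 * (Real.exp (-E₁ n) * (n : ℝ) ^ b) +
        Real.exp (-E₂ n) * (n : ℝ) ^ b) atTop (nhds 0) := fun b => by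
      simpa using ((tendsto_exp_neg_mul_rpow h₁ b).const_mul 256).add
        (tendsto_exp_neg_mul_rpow h₂ b)
    have := (lim a).add (lim (κ + 1 + a))
    rw [add_zero] at this
    refine squeeze_zero' ?_ ?_ this
    · filter_upwards [h0] with n hn
      positivity
    · filter_upwards [hν, eventually_gt_atTop 0] with n hn hn0
      have hn' : (0 : ℝ) < n := by exact_mod_cast hn0
      rw [div_div_eq_mul_div, div_one, Real.rpow_add hn', Real.rpow_add hn', Real.rpow_one]
      calc ν n * (n : ℝ) ^ a ≤
          (256 * Real.exp (-E₁ n) + Real.exp (-E₂ n)) * (1 + (n : ℝ) ^ κ * n) * (n : ℝ) ^ a := by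
            gcongr
        _ = _ := by ring
  · filter_upwards [eventually_gt_atTop 0] with n hn h
    have hn' : (0 : ℝ) < n := by exact_mod_cast hn
    have : 1 / (n : ℝ) ^ a ≠ 0 := by positivity
    exact absurd h this

theorem toOuterMeasure_le_one {α : Type} (p : PMF α) (s : Set α) : p.toOuterMeasure s ≤ 1 :=
  (MeasureTheory.measure_mono (Set.subset_univ _)).trans
    ((PMF.toOuterMeasure_apply _ _).trans_le (by simp [PMF.tsum_coe]))

/-- A family of simulators for given block sizes. -/
theorem exists_family {B : ℕ → ℕ} {f g : ℕ → ℝ} {n₀ : ℕ}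
    (h : ∀ n ≥ n₀, Admissible n (B n) (f n) (g n)) (S : ℕ → ℕ)
    (hS : ∀ n, S n = ⌈n * (1 + 200 * (Real.log n / B n +
      g n / Real.sqrt (f n / Real.log n))) / B n⌉₊) :
    ∃ O : ∀ n : ℕ, Simulator (B n) (numBlocks n (B n)) (S n),
      ∀ n, (O n).Correct ∧ (O n).Secure ∧
        (O n).BandwidthAtMost (if n₀ ≤ n then
          4 * (44 * Real.log n ^ 2 + 22 * Real.log n + 8 * f n + 1) else 0) ∧
        (O n).TemporarySpaceAtMost (if n₀ ≤ n then 166 * f n else 0) ∧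
        ∀ R : ℝ, n₀ ≤ n → 4 ≤ R → ∀ D rs,
          ((O n).execution D rs).toOuterMeasure (Simulator.permanentSpaceExceeds (B n) (S n) R) ≤
            ENNReal.ofReal ((256 * Real.exp (-(Real.log 2 / 8 * R)) +
              Real.exp (Real.log n - g n ^ 2 * Real.log n / 8)) * (1 + rs.length * n)) := by
  have key : ∀ n, ∃ O : Simulator (B n) (numBlocks n (B n)) (S n), O.Correct ∧ O.Secure ∧
      O.BandwidthAtMost (if n₀ ≤ n then
        4 * (44 * Real.log n ^ 2 + 22 * Real.log n + 8 * f n + 1) else 0) ∧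
      O.TemporarySpaceAtMost (if n₀ ≤ n then 166 * f n else 0) ∧
      ∀ R : ℝ, n₀ ≤ n → 4 ≤ R → ∀ D rs,
        (O.execution D rs).toOuterMeasure (Simulator.permanentSpaceExceeds (B n) (S n) R) ≤
          ENNReal.ofReal ((256 * Real.exp (-(Real.log 2 / 8 * R)) +
            Real.exp (Real.log n - g n ^ 2 * Real.log n / 8)) * (1 + rs.length * n)) := by
    intro n
    by_cases hn : n₀ ≤ n
    · rw [if_pos hn, if_pos hn, hS]
      obtain ⟨O, h1, h2, h3, h4, h5⟩ := (h n hn).exists_simulator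
      exact ⟨O, h1, h2, h3, h4, fun R _ => h5 R⟩
    · rw [if_neg hn, if_neg hn]
      obtain ⟨O, h1, h2, h3, h4⟩ := exists_localSimulator (B n) (numBlocks n (B n)) (S n)
      exact ⟨O, h1, h2, h3, h4, fun R h => absurd h hn⟩
  choose O hO using key
  exact ⟨O, hO⟩

end ORAM

theorem mainTheorem1 (B : ℕ → ℕ) (c : ℝ) (f g : ℕ → ℝ)
    (hBpos : ∀ n : ℕ, 0 < n → 0 < B n)
    (hBlog : ∀ n : ℕ, 0 < n → 3 * Real.logb 2 n ≤ B n)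
    (hc0 : 0 < c) (hc1 : c < 1)
    (hBc : (fun n : ℕ => (B n : ℝ)) =O[atTop] fun n : ℕ => (n : ℝ) ^ c)
    (hf : Tendsto (fun n : ℕ => f n / Real.log n) atTop atTop)
    (hf' : f =O[atTop] fun n : ℕ => Real.log n ^ 2)
    (hg : Tendsto g atTop atTop)
    (hg' : g =o[atTop] fun n : ℕ => Real.sqrt (f n / Real.log n)) :
    ∃ (S : ℕ → ℕ) (O : ∀ n : ℕ, ORAM.Simulator (B n) (ORAM.numBlocks n (B n)) (S n)),
      (∀ n : ℕ, (O n).Correct ∧ (O n).Secure) ∧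
      -- server space
      (∃ C₁ C₂ : ℝ, 0 < C₁ ∧ 0 < C₂ ∧ ∀ᶠ n : ℕ in atTop,
        n * (1 + C₁ * (Real.log n / B n + g n / Real.sqrt (f n / Real.log n)))
            ≤ ORAM.serverSpace (B n) (S n) ∧
          ORAM.serverSpace (B n) (S n)
            ≤ n * (1 + C₂ * (Real.log n / B n + g n / Real.sqrt (f n / Real.log n)))) ∧
      -- worst-case bandwidth blowup
      (∃ W : ℕ → ℝ, (W =O[atTop] fun n : ℕ => Real.log n ^ 2) ∧
        ∀ n : ℕ, (O n).BandwidthAtMost (W n)) ∧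
      -- temporary user space
      (∃ T : ℕ → ℝ, T =O[atTop] f ∧ ∀ n : ℕ, (O n).TemporarySpaceAtMost (T n)) ∧
      -- permanent user space
      (∀ R : ℕ → ℝ, Tendsto (fun n : ℕ => R n / Real.log n) atTop atTop →
        ∀ κ : ℝ, 0 < κ → ∃ ν : ℕ → ℝ, ORAM.Negligible ν ∧
          ∀ (n : ℕ) (D : ORAM.Store (ORAM.numBlocks n (B n)) (B n))
            (rs : List (ORAM.Request (ORAM.numBlocks n (B n)) (B n))),
            (rs.length : ℝ) ≤ (n : ℝ) ^ κ →
              ((O n).execution D rs).toOuterMeasure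
                  (ORAM.Simulator.permanentSpaceExceeds (B n) (S n) (R n))
                ≤ ENNReal.ofReal (ν n)) ∧
      -- succinctness
      (Tendsto (fun n : ℕ => (B n : ℝ) / Real.log n) atTop atTop →
        ORAM.Succinct fun n : ℕ => ORAM.serverSpace (B n) (S n)) := by
  
  obtain ⟨n₀, hn₀⟩ := eventually_atTop.1
    (ORAM.eventually_admissible hBlog hc1 hBc hf hf' hg hg')
  set q : ℕ → ℝ := fun n => g n / Real.sqrt (f n / Real.log n) with hq
  set S : ℕ → ℕ := fun n => ⌈n * (1 + 200 * (Real.log n / B n + q n)) / B n⌉₊ with hS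
  have hspace : ∀ n ≥ n₀, n * (1 + 200 * (Real.log n / B n + q n)) ≤ ORAM.serverSpace (B n) (S n) ∧
      ORAM.serverSpace (B n) (S n) ≤ n * (1 + 201 * (Real.log n / B n + q n)) := fun n hn =>
    ⟨(hn₀ n hn).le_serverSpace, (hn₀ n hn).serverSpace_le⟩
  obtain ⟨O, hO⟩ := ORAM.exists_family hn₀ S fun n => rfl
  refine ⟨S, O, fun n => ⟨(hO n).1, (hO n).2.1⟩, ⟨200, 201, by norm_num, by norm_num,
    eventually_atTop.2 ⟨n₀, hspace⟩⟩, ⟨_, ?_, fun n => (hO n).2.2.1⟩,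
    ⟨_, ?_, fun n => (hO n).2.2.2.1⟩, fun R hR κ hκ => ?_, fun hB => ?_⟩
  · obtain ⟨C, hC⟩ := hf'.bound
    refine IsBigO.of_bound (4 * (67 + 8 * C)) ?_
    filter_upwards [hC, eventually_ge_atTop n₀] with n h1 hn
    have h2 := (hn₀ n hn).log_ge
    have h3 := (hn₀ n hn).log_le
    have h4 := sq_nonneg (Real.log n)
    rw [Real.norm_of_nonneg h4, Real.norm_of_nonneg (by linarith)] at h1
    rw [if_pos hn, Real.norm_of_nonneg h4, Real.norm_of_nonneg (by linarith)]
    nlinarith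
  · refine ((isBigO_refl f atTop).const_mul_left 166).congr' ?_ EventuallyEq.rfl
    filter_upwards [eventually_ge_atTop n₀] with n hn
    rw [if_pos hn]
  -- For the remaining `n`, finitely many since `R = ω(log n)`, the trivial bound `1` does not
  -- affect negligibility.
  · refine ⟨fun n => if n₀ ≤ n ∧ 4 ≤ R n then
      (256 * Real.exp (-(Real.log 2 / 8 * R n)) +
        Real.exp (Real.log n - g n ^ 2 * Real.log n / 8)) * (1 + (n : ℝ) ^ κ * n) else 1, ?_, ?_⟩
    · refine ORAM.negligible_of_eventually_le (κ := κ) (E₁ := fun n => Real.log 2 / 8 * R n)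
        (E₂ := fun n => -(Real.log n - g n ^ 2 * Real.log n / 8)) ?_ ?_ ?_ ?_
      · refine (hR.const_mul_atTop (show 0 < Real.log 2 / 8 by
          have := Real.log_pos one_lt_two
          positivity)).congr fun n => by ring
      -- The union bound over at most `n` leaves costs `log n`: the exponent divided by `log n` is
      -- `g² / 8 - 1`.
      · have h1 : Tendsto (fun n => g n ^ 2 / 8 + -1) atTop atTop :=
          tendsto_atTop_add_const_right _ _
            (((tendsto_pow_atTop two_ne_zero).comp hg).atTop_div_const (by norm_num))
        refine h1.congr' ?_
        filter_upwards [eventually_ge_atTop n₀] with n hn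
        have h2 : Real.log n ≠ 0 := by
          have := (hn₀ n hn).log_ge
          linarith
        field_simp
        ring
      · filter_upwards with n
        split_ifs
        · positivity
        · exact zero_le_one
      · filter_upwards [eventually_ge_atTop n₀, hR.eventually_ge_atTop 1] with n hn hRn
        have h1 := (hn₀ n hn).log_ge
        rw [le_div_iff₀ (by linarith)] at hRn
        rw [if_pos ⟨hn, by linarith⟩, neg_neg]
    · intro n D rs hrs
      dsimp only
      split_ifs with hn
      · refine ((hO n).2.2.2.2 (R n) hn.1 hn.2 D rs).trans (ENNReal.ofReal_le_ofReal ?_)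
        gcongr
      · rw [ENNReal.ofReal_one]
        exact ORAM.toOuterMeasure_le_one _ _
  -- Under `B = ω(log n)` both relative overheads vanish, so the excess space is `o(n)`.
  · have h1 : Tendsto (fun n : ℕ => Real.log n / B n + q n) atTop (nhds 0) := by
      have h2 := hB.inv_tendsto_atTop.add hg'.tendsto_div_nhds_zero
      rw [add_zero] at h2
      refine h2.congr fun n => ?_
      rw [Pi.inv_apply, inv_div]
    have h2 : (fun n : ℕ => (n : ℝ) * (Real.log n / B n + q n)) =o[atTop] fun n : ℕ => (n : ℝ) := by
      simpa using (isBigO_refl (fun n : ℕ => (n : ℝ)) atTop).mul_isLittleO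
        ((isLittleO_one_iff ℝ).2 h1)
    refine IsBigO.trans_isLittleO (IsBigO.of_bound 201 ?_) h2
    filter_upwards [eventually_ge_atTop n₀] with n hn
    obtain ⟨h3, h4⟩ := hspace n hn
    have h5 := (hn₀ n hn).log_ge
    have h6 := (hn₀ n hn).inv_le_slack
    have h7 : 0 ≤ (n : ℝ) * (Real.log n / B n + q n) := by
      have : 0 ≤ q n := le_trans (by positivity) h6
      positivity
    rw [Real.norm_of_nonneg h7, Real.norm_of_nonneg (by linarith)]
    linarith
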